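/- All graphs are finite, simple, undirected and have at least one vertex. The Gallai graph $\Gamma(G)$ of a graph $G$ has the edges of $G$ as its vertices, and two distinct edges of $G$ are adjacent in $\Gamma(G)$ if they share an endpoint but do not span a triangle in $G$, that is, if they are $uv$ and $vw$ with $u\neq w$ and $uw\notin E(G)$. A set $U\subseteq V(G)$ is homogeneous if every vertex of $V(G)\setminus U$ is adjacent to all vertices in $U$ or to no vertex in $U$; it is non-trivial if $|U|\notin\{0,1,|V(G)|\}$. A graph is chordal if it has no induced cycle of length at least $4$. A cut-vertex is a vertex whose deletion increases the number of components, and a block of $G$ is a maximal connected subgraph of $G$ that has no cut-vertex of its own. The gem consists of a path of order $4$ and one further vertex adjacent to all vertices of this path. The square of a path joins any two vertices at distance at most $2$ on the path. The graph $F_8^-$ is the square of the path of order $6$. A graph is $(F_1,\ldots,F_9)$-free if it has no induced subgraph isomorphic to one of the following nine graphs: - $F_1$: the claw $K_{1,3}$; - $F_2$: two triangles sharing exactly one vertex; - $F_3$: a $K_4$ with two disjoint edges $e,f$ and two further non-adjacent vertices, one adjacent exactly to the ends of $e$, the other exactly to the ends of $f$; - $F_4$: a triangle with one pendant edge attached at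 each of its three vertices; - $F_5$: a triangle and three further pairwise non-adjacent vertices of degree $2$, one for each edge of the triangle and adjacent exactly to the ends of that edge; - $F_6$: a path of order $5$ and one further vertex adjacent exactly to the three inner vertices of the path; - $F_7$: a path of order $6$ and one further vertex adjacent exactly to the four inner vertices of the path; - $F_8$: the square of the path of order $7$; - $F_9$: the square of a path of order $6$ and one further vertex adjacent exactly to the four inner vertices of that path. **Theorem.** For a graph $G$ without isolated vertices, the following statements are equivalent: (i) The Gallai graph $\Gamma(G)$ of $G$ is a tree. (ii) Every non-trivial homogeneous set in $G$ is independent, and $G$ is an $(F_1,\ldots,F_9)$-free chordal graph. (iii) Either $G$ is isomorphic to $F_8^-$, or $G$ is connected and satisfies the following conditions: - every block of $G$ is isomorphic to $K_2$, $K_3$, or a gem; - every cut-vertex of $G$ lies in at most two blocks and has degree at most $3$ in $G$; - every block of $G$ that is isomorphic to $K_3$ contains exactly two cut-vertices of $G$; - every block of $G$ that is isomorphic to a gem contains exactly one cut-vertex of $G$. -/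

import Mathlib

namespace GallaiTree

open SimpleGraph

/-- The Gallai graph of `G`: its vertices are the edges of `G`, and two distinct edges are adjacent
if they share an endpoint `v`, that is, they are `uv` and `vw` with `u ≠ w`, and they do not span a
triangle, that is, `uw` is not an edge. -/
def gallaiGraph {V : Type*} (G : SimpleGraph V) : SimpleGraph G.edgeSet where
  Adj e f := ∃ u v w : V,
    u ≠ w ∧ ¬ G.Adj u w ∧ (e : Sym2 V) = s(u, v) ∧ (f : Sym2 V) = s(v, w)
  symm := ⟨by
    rintro e f ⟨u, v, w, hne, hadj, he, hf⟩
    exact ⟨w, v, u, hne.symm, fun h => hadj h.symm, by rw [hf, Sym2.eq_swap],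
      by rw [he, Sym2.eq_swap]⟩⟩
  loopless := ⟨by
    rintro e ⟨u, v, w, hne, -, he, hf⟩
    rw [he] at hf
    have h : s(v, u) = s(v, w) := by rw [← hf, Sym2.eq_swap]
    exact hne (Sym2.congr_right.mp h)⟩

/-- The graph on `{0, …, n - 1}` whose edges are the listed pairs. -/
def ofEdges (n : ℕ) (l : List (Fin n × Fin n)) : SimpleGraph (Fin n) :=
  SimpleGraph.fromRel fun i j => (i, j) ∈ l

/-- The claw `K_{1,3}`. -/
def F1 : SimpleGraph (Fin 4) := ofEdges 4 [(0, 3), (1, 3), (2, 3)]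

/-- The butterfly: two triangles sharing exactly one vertex. -/
def F2 : SimpleGraph (Fin 5) := ofEdges 5 [(0, 1), (1, 4), (4, 0), (2, 3), (3, 4), (4, 2)]

/-- `K_4` together with two further non-adjacent vertices of degree two, joined to the two ends of one
and of the other of two disjoint edges of the `K_4`. -/
def F3 : SimpleGraph (Fin 6) :=
  ofEdges 6 [(0, 1), (1, 2), (2, 3), (3, 4), (4, 5), (5, 0), (1, 4), (4, 2), (2, 5), (5, 1)]

/-- The net: a triangle with a pendant edge at each of its vertices. -/
def F4 : SimpleGraph (Fin 6) := ofEdges 6 [(0, 1), (1, 2), (2, 3), (1, 4), (4, 2), (4, 5)]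

/-- The 3-sun: a triangle, with a further triangle on each of its edges. -/
def F5 : SimpleGraph (Fin 6) :=
  ofEdges 6 [(0, 1), (1, 2), (2, 4), (4, 5), (5, 3), (3, 0), (1, 3), (3, 4), (4, 1)]

/-- A path on five vertices and a vertex adjacent to its three inner vertices. -/
def F6 : SimpleGraph (Fin 6) :=
  ofEdges 6 [(0, 1), (1, 2), (2, 3), (3, 4), (1, 5), (5, 3), (2, 5)]

/-- A path on six vertices and a vertex adjacent to its four inner vertices. -/
def F7 : SimpleGraph (Fin 7) :=
  ofEdges 7 [(0, 1), (1, 2), (2, 3), (3, 4), (4, 5), (1, 6), (6, 2), (3, 6), (6, 4)]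

/-- The square of the path on seven vertices (in the order `0, 4, 1, 5, 2, 6, 3`). -/
def F8 : SimpleGraph (Fin 7) :=
  ofEdges 7 [(0, 1), (1, 2), (2, 3), (3, 6), (6, 5), (5, 4), (4, 0), (4, 1), (1, 5), (5, 2), (2, 6)]

/-- The square of the path on six vertices (in the order `0, 3, 1, 4, 2, 5`) and a further vertex
`6`, adjacent to the four inner vertices `3, 1, 4, 2` of that path. -/
def F9 : SimpleGraph (Fin 7) :=
  ofEdges 7 [(0, 1), (1, 2), (2, 5), (5, 4), (4, 3), (3, 0), (3, 1), (1, 4), (4, 2),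
    (1, 6), (6, 2), (3, 6), (6, 4)]

/-- The graph `F_8^-`: vertices `a, b, e, f, c, d` are `0, …, 5`. It is the square of the path on
six vertices (in the order `a, d, b, c, e, f`). -/
def F8minus : SimpleGraph (Fin 6) :=
  ofEdges 6 [(0, 1), (1, 2), (2, 3), (3, 4), (4, 5), (5, 0), (5, 1), (1, 4), (4, 2)]

/-- The gem: a path on four vertices and a vertex adjacent to all of them. -/
def gem : SimpleGraph (Fin 5) :=
  ofEdges 5 [(0, 1), (1, 2), (2, 3), (0, 4), (1, 4), (2, 4), (3, 4)]

/-- `G` is `(F_1, …, F_9)`-free: none of these graphs is isomorphic to an induced subgraph. -/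
def ForbiddenFree {V : Type*} (G : SimpleGraph V) : Prop :=
  ¬ F1.IsIndContained G ∧ ¬ F2.IsIndContained G ∧ ¬ F3.IsIndContained G ∧
  ¬ F4.IsIndContained G ∧ ¬ F5.IsIndContained G ∧ ¬ F6.IsIndContained G ∧
  ¬ F7.IsIndContained G ∧ ¬ F8.IsIndContained G ∧ ¬ F9.IsIndContained G

/-- `G` is chordal: it has no chordless (that is, induced) cycle of length at least four. -/
def IsChordal {V : Type*} (G : SimpleGraph V) : Prop :=
  ∀ n : ℕ, 4 ≤ n → ¬ (cycleGraph n).IsIndContained G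

/-- `U` is homogeneous: every vertex outside `U` is adjacent to all of `U` or to none of `U`. -/
def IsHomogeneous {V : Type*} (G : SimpleGraph V) (U : Set V) : Prop :=
  ∀ x, x ∉ U → (∀ u ∈ U, G.Adj x u) ∨ (∀ u ∈ U, ¬ G.Adj x u)

/-- A homogeneous set is non-trivial if its size is not `0`, `1` or the order of the graph. -/
def IsNontrivialHomogeneous {V : Type*} (G : SimpleGraph V) (U : Set V) : Prop :=
  IsHomogeneous G U ∧ U.ncard ≠ 0 ∧ U.ncard ≠ 1 ∧ U.ncard ≠ Nat.card V

/-- `v` is a cut-vertex: deleting `v` separates two vertices of the same component of `G`. -/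
def IsCutVertex {V : Type*} (G : SimpleGraph V) (v : V) : Prop :=
  ∃ x y : ({v}ᶜ : Set V), G.Reachable x y ∧ ¬ (G.induce ({v}ᶜ : Set V)).Reachable x y

/-- `B` is a block of `G`: a maximal connected subgraph that has no cut-vertex of its own. -/
def IsBlock {V : Type*} (G : SimpleGraph V) (B : G.Subgraph) : Prop :=
  Maximal (fun H : G.Subgraph => H.Connected ∧ ∀ v : H.verts, ¬ IsCutVertex H.coe v) B

/-- The set of the cut-vertices of `G` that lie in the subgraph `B`. -/
def cutVerticesIn {V : Type*} (G : SimpleGraph V) (B : G.Subgraph) : Set V :=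
  {v | v ∈ B.verts ∧ IsCutVertex G v}

/-- `G` is connected, and its blocks and cut-vertices satisfy the four listed conditions. -/
structure BlockConditions {V : Type*} [Fintype V] (G : SimpleGraph V) [DecidableRel G.Adj] :
    Prop where
  /-- `G` is connected. -/
  connected : G.Connected
  /-- Every block is isomorphic to `K_2`, `K_3` or the gem. -/
  blocks : ∀ B, IsBlock G B →
    Nonempty (B.coe ≃g completeGraph (Fin 2)) ∨ Nonempty (B.coe ≃g completeGraph (Fin 3)) ∨
      Nonempty (B.coe ≃g gem)
  /-- Every cut-vertex lies in at most two blocks and has degree at most three. -/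
  cutVertices : ∀ v, IsCutVertex G v →
    {B : G.Subgraph | IsBlock G B ∧ v ∈ B.verts}.encard ≤ 2 ∧ G.degree v ≤ 3
  /-- Every block that is isomorphic to `K_3` has exactly two cut-vertices of `G`. -/
  triangleBlocks : ∀ B, IsBlock G B → Nonempty (B.coe ≃g completeGraph (Fin 3)) →
    (cutVerticesIn G B).encard = 2
  /-- Every block that is isomorphic to the gem has exactly one cut-vertex of `G`. -/
  gemBlocks : ∀ B, IsBlock G B → Nonempty (B.coe ≃g gem) →
    (cutVerticesIn G B).encard = 1

end GallaiTree

/-!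
The three statements are compared with an explicit description of the graphs in question: apart
from the square of the path on six vertices, they are the *apex paths* (`IsApexPath`). An apex
path is an induced path `p` together with pairwise non-adjacent outside vertices, which share no
neighbours; each of them is an apex, adjacent to the two ends of an edge of `p` that contains no
end of `p`, or a hub, adjacent to the first four or to the last four vertices of `p`, where `p`
has at least five vertices.

*Trees.* If `F` is an induced subgraph of `G`, then the Gallai graph of `G` contains that of `F`.
The Gallai graphs of the nine forbidden graphs and of the chordless cycles have cycles, and the
edges inside a homogeneous set are a union of components of the Gallai graph. This gives the
second statement from the first. Conversely the Gallai graph of an apex path is a tree: the edges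
of `p` form a path of it, to which an apex attaches two leaves and a hub attaches a path with four
vertices.

*Structure.* Assume that the second statement holds. A component is a homogeneous set, so that `G`
is connected. If `G` has an induced copy of the square of the path on six vertices, then any
further vertex adjacent to this copy completes a forbidden subgraph (`nonempty_iso_F8minus`).
Otherwise let `p` be a longest induced path. By chordality the neighbours of an outside vertex on
`p` are consecutive; the claw and the maximality of `p` bound their number, so that every outside
vertex has a *trace* of two, three or four vertices, which contains an end of `p` if there are
more than two (`IsLongest.exists_hasTrace`). The remaining unwanted traces, and adjacent outside
vertices with equal traces, give rise to homogeneous sets: the exchange of a path vertex with an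
outside vertex leads to another longest induced path, and the forbidden subgraphs show that the
remaining vertices cannot tell these two apart. What is left is an apex path
(`exists_isApexPath`).

*Blocks.* The vertex sets of blocks are the maximal *biconnected* sets (`IsBlockSet`), so that two
of them share at most one vertex. The blocks of an apex path are the gems of the hubs, the
triangles of the apices and the remaining edges of `p`; these are separated by the inner vertices
of `p` whose two neighbours on `p` have no outside common neighbour, and the block conditions can
be read off (`IsApexPath.blockConditions`). Conversely, under the block conditions, each forbidden
subgraph and each homogeneous set with an edge would need a larger block, a further cut-vertex in
a triangle or a gem, or a cut-vertex of larger degree (`BlockConditions.forbiddenFree`,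
`BlockConditions.isIndepSet`).
-/

namespace GallaiTree

open SimpleGraph

/-! ### Patterns and forbidden induced subgraphs -/

instance ofEdges.decidableAdj (n : ℕ) (l : List (Fin n × Fin n)) :
    DecidableRel (ofEdges n l).Adj := fun i j =>
  decidable_of_iff (i ≠ j ∧ ((i, j) ∈ l ∨ (j, i) ∈ l))
    (SimpleGraph.fromRel_adj (fun i j => (i, j) ∈ l) i j).symm

instance : DecidableRel F1.Adj := ofEdges.decidableAdj _ _
instance : DecidableRel F2.Adj := ofEdges.decidableAdj _ _
instance : DecidableRel F3.Adj := ofEdges.decidableAdj _ _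
instance : DecidableRel F4.Adj := ofEdges.decidableAdj _ _
instance : DecidableRel F5.Adj := ofEdges.decidableAdj _ _
instance : DecidableRel F6.Adj := ofEdges.decidableAdj _ _
instance : DecidableRel F7.Adj := ofEdges.decidableAdj _ _
instance : DecidableRel F8.Adj := ofEdges.decidableAdj _ _
instance : DecidableRel F9.Adj := ofEdges.decidableAdj _ _
instance : DecidableRel F8minus.Adj := ofEdges.decidableAdj _ _
instance : DecidableRel gem.Adj := ofEdges.decidableAdj _ _

/-- A map that reproduces the adjacencies of a graph without two vertices of equal neighbourhood
is injective, hence an embedding onto an induced subgraph. -/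
theorem exists_embedding_of_map {V : Type*} {G : SimpleGraph V} {n : ℕ} {F : SimpleGraph (Fin n)}
    (hF : ∀ i j, i ≠ j → ∃ k, ¬ (F.Adj i k ↔ F.Adj j k)) (f : Fin n → V)
    (h : ∀ i j, F.Adj i j ↔ G.Adj (f i) (f j)) : ∃ g : F ↪g G, ∀ i, g i = f i := by
  have hinj : Function.Injective f := by
    intro i j hij
    by_contra hne
    obtain ⟨k, hk⟩ := hF i j hne
    exact hk (by rw [h, h, hij])
  exact ⟨⟨⟨f, hinj⟩, (h _ _).symm⟩, fun _ => rfl⟩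

theorem forall_adj_iff_of_lt {V : Type*} {G : SimpleGraph V} {n : ℕ} {F : SimpleGraph (Fin n)}
    {f : Fin n → V} (h : ∀ i j, i < j → (F.Adj i j ↔ G.Adj (f i) (f j))) (i j : Fin n) :
    F.Adj i j ↔ G.Adj (f i) (f j) := by
  rcases lt_trichotomy i j with hij | rfl | hij
  · exact h i j hij
  · simp
  · rw [F.adj_comm, G.adj_comm]
    exact h j i hij

/-- Adjacency in a cycle, in terms of the values of the vertices. -/
theorem cycleGraph_adj_iff {n : ℕ} (hn : 3 ≤ n) (u v : Fin n) :
    (cycleGraph n).Adj u v ↔ u.val + 1 = v.val ∨ v.val + 1 = u.val ∨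
      (u.val = 0 ∧ v.val + 1 = n) ∨ (v.val = 0 ∧ u.val + 1 = n) := by
  have hu := u.isLt
  have hv := v.isLt
  rw [cycleGraph_adj']
  rcases lt_trichotomy u v with h | rfl | h
  · rw [Fin.sub_val_of_le h.le, Fin.coe_sub_iff_lt.2 h]
    have : u.val < v.val := h
    omega
  · rw [Fin.sub_val_of_le le_rfl]
    omega
  · rw [Fin.sub_val_of_le h.le, Fin.coe_sub_iff_lt.2 h]
    have : v.val < u.val := h
    omega

section Patterns

variable {V : Type*} {G : SimpleGraph V}

theorem claw_false (h : ForbiddenFree G) {c x y z : V} (hx : G.Adj c x) (hy : G.Adj c y)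
    (hz : G.Adj c z) (nxy : ¬ G.Adj x y) (nxz : ¬ G.Adj x z) (nyz : ¬ G.Adj y z)
    (dxy : x ≠ y) (dxz : x ≠ z) (dyz : y ≠ z) : False := by
  apply h.1
  have := hx.ne; have := hy.ne; have := hz.ne
  refine ⟨⟨⟨![x, y, z, c], ?_⟩, ?_⟩⟩
  · intro i j
    fin_cases i <;> fin_cases j <;> simp_all [eq_comm]
  · intro i j
    refine (forall_adj_iff_of_lt (F := F1) (f := ![x, y, z, c]) ?_ i j).symm
    have e : ∀ i j, i < j → (F1.Adj i j ↔ j = 3) := by decide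
    intro i j hij
    rw [e i j hij]
    fin_cases i <;> fin_cases j <;> simp_all [G.adj_comm]

/-- An excluded pattern, given by its vertices and by the adjacencies between them. -/
theorem pattern_false {n : ℕ} {F : SimpleGraph (Fin n)} (hG : ¬ F.IsIndContained G) (f : Fin n → V)
    (h : ∀ i j, i < j → (F.Adj i j ↔ G.Adj (f i) (f j)))
    (hF : ∀ i j, i ≠ j → ∃ k, ¬ (F.Adj i k ↔ F.Adj j k)) : False :=
  hG ⟨(exists_embedding_of_map hF f (forall_adj_iff_of_lt h)).choose⟩

/-- The vertices `x`, `y` and `u`, `v` of the two triangles at `c`. -/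
theorem butterfly_false (h : ForbiddenFree G) {c x y u v : V}
    (cx : G.Adj c x) (cy : G.Adj c y) (cu : G.Adj c u) (cv : G.Adj c v)
    (xy : G.Adj x y) (uv : G.Adj u v) (xu : ¬ G.Adj x u) (xv : ¬ G.Adj x v)
    (yu : ¬ G.Adj y u) (yv : ¬ G.Adj y v) : False := by
  refine pattern_false h.2.1 ![x, y, u, v, c] ?_ (by decide)
  simp +decide [Fin.forall_fin_succ, G.adj_comm, *]


/-- A chordless cycle of length four. -/
theorem square_false (h : IsChordal G) {a b c d : V} (ab : G.Adj a b) (bc : G.Adj b c)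
    (cd : G.Adj c d) (da : G.Adj d a) (ac : ¬ G.Adj a c) (bd : ¬ G.Adj b d) (hac : a ≠ c)
    (hbd : b ≠ d) : False := by
  apply h 4 le_rfl
  have := ab.ne; have := bc.ne; have := cd.ne; have := da.ne
  refine ⟨⟨⟨![a, b, c, d], ?_⟩, ?_⟩⟩
  · intro i j
    fin_cases i <;> fin_cases j <;> simp_all [eq_comm]
  · intro i j
    refine (forall_adj_iff_of_lt (F := cycleGraph 4) (f := ![a, b, c, d]) ?_ i j).symm
    intro i j hij
    rw [cycleGraph_adj_iff (by norm_num)]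
    fin_cases i <;> fin_cases j <;> simp_all [G.adj_comm]

end Patterns

/-! ### Trees have no forbidden configurations -/

section Necessity

variable {V : Type*} {G : SimpleGraph V}

/-- A cyclic sequence of edges `a i b i` of an induced subgraph `F`, in which consecutive edges form
an induced path on three vertices, is a cycle of the Gallai graph. -/
theorem gallaiGraph_not_isAcyclic {W : Type*} {F : SimpleGraph W} (hFG : F.IsIndContained G)
    {m : ℕ} (hm : 3 ≤ m) (a b : Fin m → W) (hadj : ∀ i, F.Adj (a i) (b i))
    (hinj : ∀ i j, s(a i, b i) = s(a j, b j) → i = j)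
    (hnext : ∀ i j : Fin m, (i.val + 1 = j.val ∨ (i.val + 1 = m ∧ j.val = 0)) →
      ∃ u v w, u ≠ w ∧ ¬ F.Adj u w ∧ s(a i, b i) = s(u, v) ∧ s(a j, b j) = s(v, w)) :
    ¬ (gallaiGraph G).IsAcyclic := by
  obtain ⟨f⟩ := hFG
  intro hac
  let c : Fin m → G.edgeSet := fun i => ⟨s(f (a i), f (b i)), f.map_adj_iff.2 (hadj i)⟩
  have hc : ∀ i j : Fin m, (i.val + 1 = j.val ∨ (i.val + 1 = m ∧ j.val = 0)) →
      (gallaiGraph G).Adj (c i) (c j) := by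
    intro i j hij
    obtain ⟨u, v, w, hne, hn, hi, hj⟩ := hnext i j hij
    refine ⟨f u, f v, f w, fun h => hne (f.injective h), fun h => hn (f.map_adj_iff.1 h), ?_, ?_⟩
    · exact congrArg (Sym2.map f) hi
    · exact congrArg (Sym2.map f) hj
  refine isAcyclic_iff_free_cycleGraph.1 hac m hm ⟨⟨⟨c, ?_⟩, ?_⟩⟩
  · intro i j hij
    rw [cycleGraph_adj_iff hm] at hij
    rcases hij with h | h | ⟨h, h'⟩ | ⟨h, h'⟩
    · exact hc i j (Or.inl h)
    · exact (hc j i (Or.inl h)).symm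
    · exact (hc j i (Or.inr ⟨h', h⟩)).symm
    · exact hc i j (Or.inr ⟨h', h⟩)
  · intro i j hij
    refine hinj i j (Sym2.map.injective f.injective ?_)
    exact congrArg Subtype.val hij

/-- The Gallai graph of each of the nine forbidden graphs has a cycle, listed by the two ends of
its consecutive edges. -/
theorem forbiddenFree_of_isAcyclic (h : (gallaiGraph G).IsAcyclic) : ForbiddenFree G := by
  refine ⟨fun hF => ?_, fun hF => ?_, fun hF => ?_, fun hF => ?_, fun hF => ?_, fun hF => ?_,
    fun hF => ?_, fun hF => ?_, fun hF => ?_⟩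
  · exact gallaiGraph_not_isAcyclic hF (by norm_num) ![0, 1, 2]
      ![3, 3, 3] (by decide) (by decide) (by decide) h
  · exact gallaiGraph_not_isAcyclic hF (by norm_num) ![0, 2, 1, 3]
      ![4, 4, 4, 4] (by decide) (by decide) (by decide) h
  · exact gallaiGraph_not_isAcyclic hF (by norm_num) ![0, 1, 2, 2, 0, 4, 3, 1]
      ![1, 2, 3, 5, 5, 5, 4, 4] (by decide) (by decide) (by decide) h
  · exact gallaiGraph_not_isAcyclic hF (by norm_num) ![0, 1, 2, 2, 4, 1]
      ![1, 2, 3, 4, 5, 4] (by decide) (by decide) (by decide) h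
  · exact gallaiGraph_not_isAcyclic hF (by norm_num) ![0, 1, 1, 3, 0, 3, 2, 4, 1]
      ![1, 2, 3, 5, 3, 4, 4, 5, 4] (by decide) (by decide) (by decide) h
  · exact gallaiGraph_not_isAcyclic hF (by norm_num) ![0, 1, 2, 3, 3, 1]
      ![1, 2, 3, 4, 5, 5] (by decide) (by decide) (by decide) h
  · exact gallaiGraph_not_isAcyclic hF (by norm_num) ![0, 1, 2, 3, 4, 4, 1]
      ![1, 2, 3, 4, 5, 6, 6] (by decide) (by decide) (by decide) h
  · exact gallaiGraph_not_isAcyclic hF (by norm_num) ![0, 1, 2, 2, 4, 5, 1]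
      ![1, 2, 3, 5, 5, 6, 5] (by decide) (by decide) (by decide) h
  · exact gallaiGraph_not_isAcyclic hF (by norm_num) ![0, 1, 2, 2, 3, 0, 3, 4, 1]
      ![1, 2, 5, 6, 6, 3, 4, 5, 4] (by decide) (by decide) (by decide) h

/-- The edges of a chordless cycle form a cycle of the Gallai graph. -/
theorem isChordal_of_isAcyclic (h : (gallaiGraph G).IsAcyclic) : IsChordal G := by
  intro n hn hF
  have hn3 : 3 ≤ n := by omega
  let nx : Fin n → Fin n := fun i => ⟨if i.val + 1 = n then 0 else i.val + 1, by split <;> omega⟩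
  have hnx : ∀ i, (nx i).val = if i.val + 1 = n then 0 else i.val + 1 := fun _ => rfl
  refine gallaiGraph_not_isAcyclic hF hn3 id nx ?_ ?_ ?_ h
  · intro i
    rw [cycleGraph_adj_iff hn3, id, hnx]
    split <;> omega
  · intro i j hij
    have := hnx i; have := hnx j
    rw [Sym2.eq_iff] at hij
    simp only [id, Fin.ext_iff] at hij ⊢
    split_ifs at * <;> omega
  · intro i j hij
    have h1 := hnx i; have h2 := hnx j
    have hj : nx i = j := by
      rw [Fin.ext_iff, h1]
      split <;> omega
    refine ⟨i, j, nx j, ?_, ?_, ?_, rfl⟩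
    · rw [ne_eq, Fin.ext_iff, h2]
      split <;> omega
    · rw [cycleGraph_adj_iff hn3, h2]
      split <;> omega
    · rw [hj]; rfl

/-- The edges inside a homogeneous set form a union of components of the Gallai graph, so that a
connected Gallai graph admits no non-trivial homogeneous set with an edge. -/
theorem isIndepSet_of_preconnected [Finite V] (hiso : ∀ v : V, ∃ w : V, G.Adj v w)
    (h : (gallaiGraph G).Preconnected) (U : Set V) (hU : IsNontrivialHomogeneous G U) :
    G.IsIndepSet U := by
  intro a ha b hb _ hab
  obtain ⟨c, hc⟩ : ∃ c, c ∉ U := by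
    by_contra! hcon
    apply hU.2.2.2
    rw [Set.eq_univ_of_forall hcon, Set.ncard_univ]
  obtain ⟨d, hd⟩ := hiso c
  let inside : G.edgeSet → Prop := fun e => ∀ x ∈ (e : Sym2 V), x ∈ U
  have step : ∀ e f, (gallaiGraph G).Adj e f → inside e → inside f := by
    rintro ⟨e, he⟩ ⟨f, hf⟩ ⟨u, v, w, -, hn, h1, h2⟩ hin
    simp only at h1 h2
    subst h1 h2
    have hv := hin v (Sym2.mem_mk_right _ _)
    have hu := hin u (Sym2.mem_mk_left _ _)
    intro x hx
    rcases Sym2.mem_iff.1 hx with rfl | rfl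
    · exact hv
    · by_contra hxU
      rcases hU.1 x hxU with h' | h'
      · exact hn (h' u hu).symm
      · exact h' v hv (G.adj_symm hf)
  have hreach := h ⟨s(a, b), hab⟩ ⟨s(c, d), hd⟩
  have : inside ⟨s(c, d), hd⟩ := by
    obtain ⟨w⟩ := hreach
    have hin : inside ⟨s(a, b), hab⟩ := by
      intro x hx
      rcases Sym2.mem_iff.1 hx with rfl | rfl <;> assumption
    generalize (⟨s(a, b), hab⟩ : G.edgeSet) = e, (⟨s(c, d), hd⟩ : G.edgeSet) = f at w hin
    induction w with
    | nil => exact hin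
    | cons hadj _ ih => exact ih (step _ _ hadj hin)
  exact hc (this c (Sym2.mem_mk_left _ _))

end Necessity

/-! ### Longest induced paths -/

section Structure

variable {V : Type*} {G : SimpleGraph V} {k : ℕ} {p : ℕ → V}

/-- The vertices `p 0, …, p (k - 1)` form an induced path of `G`. -/
structure IsIndPath (G : SimpleGraph V) (k : ℕ) (p : ℕ → V) : Prop where
  adj : ∀ i j, i < k → j < k → (G.Adj (p i) (p j) ↔ i + 1 = j ∨ j + 1 = i)
  inj : ∀ i j, i < k → j < k → p i = p j → i = j

/-- `p` is an induced path with `k` vertices and no induced path of `G` has `k + 1` vertices. -/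
structure IsLongest (G : SimpleGraph V) (k : ℕ) (p : ℕ → V) : Prop extends IsIndPath G k p where
  max : ∀ q, ¬ IsIndPath G (k + 1) q

/-- The vertex `x` is not on the path `p`, and its neighbours on the path are
`p i, …, p (i + s - 1)`. -/
structure HasTrace (G : SimpleGraph V) (k : ℕ) (p : ℕ → V) (x : V) (i s : ℕ) : Prop where
  ne : ∀ l < k, x ≠ p l
  le : i + s ≤ k
  adj : ∀ l < k, (G.Adj x (p l) ↔ i ≤ l ∧ l < i + s)

theorem HasTrace.adj' {x : V} {i s : ℕ} (h : HasTrace G k p x i s) (l : ℕ) (hl : l < k) :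
    G.Adj (p l) x ↔ i ≤ l ∧ l < i + s := by
  rw [G.adj_comm, h.adj l hl]

theorem IsIndPath.eq_iff (h : IsIndPath G k p) (i j : ℕ) (hi : i < k) (hj : j < k) :
    p i = p j ↔ i = j :=
  ⟨h.inj i j hi hj, congrArg p⟩

theorem IsIndPath.sub (h : IsIndPath G k p) (a : ℕ) {m : ℕ} (hm : a + m ≤ k) :
    IsIndPath G m fun t => p (a + t) where
  adj i j hi hj := by
    rw [h.adj _ _ (by omega) (by omega)]
    omega
  inj i j hi hj hij := by
    have := h.inj _ _ (by omega) (by omega) hij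
    omega

theorem IsIndPath.reverse (h : IsIndPath G k p) : IsIndPath G k fun t => p (k - 1 - t) where
  adj i j hi hj := by
    rw [h.adj _ _ (by omega) (by omega)]
    omega
  inj i j hi hj hij := by
    have := h.inj _ _ (by omega) (by omega) hij
    omega

theorem IsLongest.reverse (h : IsLongest G k p) : IsLongest G k fun t => p (k - 1 - t) :=
  ⟨h.toIsIndPath.reverse, h.max⟩

theorem HasTrace.reverse {x : V} {i s : ℕ} (h : HasTrace G k p x i s) :
    HasTrace G k (fun t => p (k - 1 - t)) x (k - i - s) s where
  ne l hl := h.ne _ (by omega)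
  le := by have := h.le; omega
  adj l hl := by
    have := h.le
    rw [h.adj _ (by omega)]
    omega

/-- A vertex whose only neighbour on an induced path is the first vertex extends the path. -/
theorem IsIndPath.cons (h : IsIndPath G k p) {x : V} (hne : ∀ l < k, x ≠ p l)
    (hx : ∀ l < k, (G.Adj x (p l) ↔ l = 0)) :
    IsIndPath G (k + 1) fun t => if t = 0 then x else p (t - 1) where
  adj i j hi hj := by
    rcases i with _ | i <;> rcases j with _ | j
    · simp
    · simp [hx j (by omega), eq_comm]
    · simp [G.adj_comm _ x, hx i (by omega), eq_comm]
    · simp [h.adj i j (by omega) (by omega)]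
  inj i j hi hj hij := by
    rcases i with _ | i <;> rcases j with _ | j
    · rfl
    · exact absurd hij (by simpa using hne j (by omega))
    · exact absurd hij.symm (by simpa using hne i (by omega))
    · have := h.inj i j (by omega) (by omega) (by simpa using hij)
      omega

/-- An induced path with at least three vertices whose two ends have a further common neighbour
`x` is an induced cycle unless `x` has a neighbour inside the path. -/
theorem IsIndPath.cycle_false (hc : IsChordal G) (h : IsIndPath G k p) (hk : 3 ≤ k) {x : V}
    (hne : ∀ l < k, x ≠ p l) (hx : ∀ l < k, (G.Adj x (p l) ↔ l = 0 ∨ l + 1 = k)) : False := by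
  apply hc (k + 1) (by omega)
  let f : Fin (k + 1) → V := fun t => if t.val = 0 then x else p (t.val - 1)
  have hinj : Function.Injective f := by
    rintro ⟨i, hi⟩ ⟨j, hj⟩ hij
    simp only [f] at hij
    rcases i with _ | i <;> rcases j with _ | j
    · rfl
    · exact absurd hij (by simpa using hne j (by omega))
    · exact absurd hij.symm (by simpa using hne i (by omega))
    · have := h.inj i j (by omega) (by omega) (by simpa using hij)
      simpa using this
  refine ⟨⟨⟨f, hinj⟩, ?_⟩⟩
  rintro ⟨i, hi⟩ ⟨j, hj⟩
  change G.Adj (f _) (f _) ↔ _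
  rw [cycleGraph_adj_iff (by omega)]
  simp only [f]
  rcases i with _ | i <;> rcases j with _ | j
  · simp; omega
  · simp [hx j (by omega)]
  · simp [G.adj_comm _ x, hx i (by omega)]
  · simp [h.adj i j (by omega) (by omega)]

/-- In a chordal graph the neighbours of an outside vertex on an induced path are consecutive. -/
theorem IsIndPath.adj_of_between (hc : IsChordal G) (h : IsIndPath G k p) {x : V}
    (hne : ∀ l < k, x ≠ p l) {a l b : ℕ} (hb : b < k) (hal : a < l) (hlb : l < b)
    (ha : G.Adj x (p a)) (hb' : G.Adj x (p b)) : G.Adj x (p l) := by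
  classical
  by_contra hl
  -- the last neighbour before `l` and the first neighbour after `l`
  obtain ⟨a', ha', ha'l, hamax⟩ : ∃ a', G.Adj x (p a') ∧ a' < l ∧
      ∀ t, a' < t → t ≤ l → ¬ G.Adj x (p t) := by
    let S := (Finset.range l).filter fun t => G.Adj x (p t)
    have hS : S.Nonempty := ⟨a, by simp [S, hal, ha]⟩
    have h1 := S.max'_mem hS
    simp only [S, Finset.mem_filter, Finset.mem_range] at h1
    refine ⟨S.max' hS, h1.2, h1.1, fun t ht htl htx => ?_⟩
    rcases htl.eq_or_lt with rfl | htl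
    · exact hl htx
    · exact absurd (S.le_max' t (by simp [S, htl, htx])) (by omega)
  obtain ⟨b', hb'', hlb', hb'b, hbmin⟩ : ∃ b', G.Adj x (p b') ∧ l < b' ∧ b' ≤ b ∧
      ∀ t, l ≤ t → t < b' → ¬ G.Adj x (p t) := by
    have hex : ∃ t, l ≤ t ∧ G.Adj x (p t) := ⟨b, by omega, hb'⟩
    have h1 := Nat.find_spec hex
    refine ⟨Nat.find hex, h1.2, ?_, Nat.find_min' hex ⟨by omega, hb'⟩, fun t ht ht' htx => ?_⟩
    · rcases h1.1.eq_or_lt with h2 | h2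
      · rw [← h2] at h1; exact absurd h1.2 hl
      · exact h2
    · exact Nat.find_min hex ht' ⟨ht, htx⟩
  refine (h.sub a' (m := b' - a' + 1) (by omega)).cycle_false hc (by omega) (x := x)
    (fun t ht => hne _ (by omega)) fun t ht => ?_
  constructor
  · intro hxt
    by_contra! hcon
    rcases le_or_gt (a' + t) l with h1 | h1
    · exact hamax _ (by omega) h1 hxt
    · exact hbmin _ h1.le (by omega) hxt
  · rintro (rfl | ht')
    · simpa using ha'
    · have : a' + t = b' := by omega
      simpa [this] using hb''

/-- Exchanging a vertex of an induced path for an outside vertex with the same neighbours among the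
other vertices of the path. -/
theorem IsIndPath.update (h : IsIndPath G k p) {x : V} {i : ℕ} (hi : i < k)
    (hne : ∀ l < k, x ≠ p l) (hx : ∀ l < k, l ≠ i → (G.Adj x (p l) ↔ l + 1 = i ∨ i + 1 = l)) :
    IsIndPath G k (Function.update p i x) where
  adj a b ha hb := by
    by_cases hai : a = i <;> by_cases hbi : b = i
    · subst hai hbi; simp
    · subst hai
      rw [Function.update_self, Function.update_of_ne hbi, hx b hb hbi]
      omega
    · subst hbi
      rw [Function.update_self, Function.update_of_ne hai, G.adj_comm, hx a ha hai]
    · rw [Function.update_of_ne hai, Function.update_of_ne hbi, h.adj a b ha hb]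
  inj a b ha hb hab := by
    by_cases hai : a = i <;> by_cases hbi : b = i
    · omega
    · subst hai
      rw [Function.update_self, Function.update_of_ne hbi] at hab
      exact absurd hab (hne b hb)
    · subst hbi
      rw [Function.update_self, Function.update_of_ne hai] at hab
      exact absurd hab.symm (hne a ha)
    · rw [Function.update_of_ne hai, Function.update_of_ne hbi] at hab
      exact h.inj a b ha hb hab

theorem IsLongest.update (h : IsLongest G k p) {x : V} {i : ℕ} (hi : i < k)
    (hne : ∀ l < k, x ≠ p l) (hx : ∀ l < k, l ≠ i → (G.Adj x (p l) ↔ l + 1 = i ∨ i + 1 = l)) :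
    IsLongest G k (Function.update p i x) :=
  ⟨h.toIsIndPath.update hi hne hx, h.max⟩

theorem exists_isLongest [Finite V] {u v : V} (huv : G.Adj u v) :
    ∃ k p, 2 ≤ k ∧ IsLongest G k p := by
  classical
  have hbound : ∀ k p, IsIndPath G k p → k ≤ Nat.card V := by
    intro k p h
    have : Function.Injective fun t : Fin k => p t := fun i j hij =>
      Fin.ext (h.inj _ _ i.isLt j.isLt hij)
    simpa using Nat.card_le_card_of_injective _ this
  have h2 : IsIndPath G 2 fun t => if t = 0 then u else v := by
    have := huv.ne
    constructor
    · intro i j hi hj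
      interval_cases i <;> interval_cases j <;> simp [huv, huv.symm]
    · intro i j hi hj
      interval_cases i <;> interval_cases j <;> simp [this, this.symm]
  let P : ℕ → Prop := fun k => ∃ p, IsIndPath G k p
  have hP2 : P 2 := ⟨_, h2⟩
  have hle : 2 ≤ Nat.card V := hbound _ _ h2
  obtain ⟨p, hp⟩ := Nat.findGreatest_spec hle hP2
  refine ⟨_, p, Nat.le_findGreatest hle hP2, hp, fun q hq => ?_⟩
  exact absurd (Nat.le_findGreatest (hbound _ _ hq) (⟨q, hq⟩ : P _)) (Nat.not_succ_le_self _)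

/-- `G` is connected, chordal and free of the nine forbidden induced subgraphs. -/
structure IsAdmissible (G : SimpleGraph V) : Prop where
  preconnected : G.Preconnected
  free : ForbiddenFree G
  chordal : IsChordal G

theorem exists_boundary_adj (h : G.Preconnected) {L : Set V} {a b : V} (ha : a ∈ L) (hb : b ∉ L) :
    ∃ u v, u ∈ L ∧ v ∉ L ∧ G.Adj u v := by
  obtain ⟨w⟩ := h a b
  obtain ⟨d, -, h1, h2⟩ := w.exists_boundary_dart L ha hb
  exact ⟨d.fst, d.snd, h1, h2, d.adj⟩

theorem IsLongest.exists_hasTrace_of_adj (hG : IsAdmissible G) (hp : IsLongest G k p)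
    {x : V} (hne : ∀ l < k, x ≠ p l) {l₀ : ℕ} (hl₀ : l₀ < k) (hx : G.Adj x (p l₀)) :
    ∃ i s, HasTrace G k p x i s ∧ 2 ≤ s ∧ s ≤ 4 ∧ (3 ≤ s → i = 0 ∨ i + s = k) := by
  classical
  let S := (Finset.range k).filter fun t => G.Adj x (p t)
  have hS : S.Nonempty := ⟨l₀, by simp [S, hl₀, hx]⟩
  have hmem : ∀ t, t ∈ S ↔ t < k ∧ G.Adj x (p t) := by simp [S]
  obtain ⟨a, b, ha, hb, hab, hS'⟩ : ∃ a b, a ∈ S ∧ b ∈ S ∧ a ≤ b ∧ ∀ t ∈ S, a ≤ t ∧ t ≤ b :=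
    ⟨S.min' hS, S.max' hS, S.min'_mem hS, S.max'_mem hS, S.min'_le _ (S.max'_mem hS),
      fun t ht => ⟨S.min'_le t ht, S.le_max' t ht⟩⟩
  rw [hmem] at ha hb
  have ht : HasTrace G k p x a (b + 1 - a) := by
    refine ⟨hne, by omega, fun l hl => ⟨fun h => ?_, fun h => ?_⟩⟩
    · have := hS' l ((hmem l).2 ⟨hl, h⟩)
      omega
    · rcases h.1.eq_or_lt with rfl | h1
      · exact ha.2
      · rcases (show l ≤ b by omega).eq_or_lt with rfl | h2
        · exact hb.2
        · exact hp.adj_of_between hG.chordal hne hb.1 h1 h2 ha.2 hb.2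
  generalize hs : b + 1 - a = s at ht
  have hle := ht.le
  refine ⟨a, s, ht, ?_, ?_, ?_⟩
  · -- a single neighbour gives a claw or a longer path
    by_contra hs1
    have hs1 : s = 1 := by omega
    subst hs1
    rcases Nat.eq_zero_or_pos a with rfl | ha0
    · refine hp.max _ (hp.toIsIndPath.cons hne fun l hl => ?_)
      rw [ht.adj l hl]; omega
    · rcases hle.eq_or_lt with h | h
      · refine hp.max _ (hp.reverse.toIsIndPath.cons (fun l hl => hne _ (by omega)) fun l hl => ?_)
        rw [ht.adj _ (by omega)]; omega
      · refine claw_false hG.free (c := p a) (x := p (a - 1)) (y := p (a + 1)) (z := x)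
          ?_ ?_ ?_ ?_ ?_ ?_ ?_ (hne _ (by omega)).symm (hne _ (by omega)).symm
        · rw [hp.adj _ _ (by omega) (by omega)]; omega
        · rw [hp.adj _ _ (by omega) (by omega)]; omega
        · rw [ht.adj' _ (by omega)]; omega
        · rw [hp.adj _ _ (by omega) (by omega)]; omega
        · rw [ht.adj' _ (by omega)]; omega
        · rw [ht.adj' _ (by omega)]; omega
        · intro h
          have := hp.inj _ _ (by omega) (by omega) h
          omega
  · by_contra hs5
    refine claw_false hG.free (c := x) (x := p a) (y := p (a + 2)) (z := p (a + 4))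
      ?_ ?_ ?_ ?_ ?_ ?_ ?_ ?_ ?_
    iterate 3 rw [ht.adj _ (by omega)]; omega
    iterate 3 rw [hp.adj _ _ (by omega) (by omega)]; omega
    all_goals
      intro h
      have := hp.inj _ _ (by omega) (by omega) h
      omega
  · intro hs3
    by_contra! hcon
    by_cases h5 : 5 ≤ s
    · refine claw_false hG.free (c := x) (x := p a) (y := p (a + 2)) (z := p (a + 4))
        ?_ ?_ ?_ ?_ ?_ ?_ ?_ ?_ ?_
      iterate 3 rw [ht.adj _ (by omega)]; omega
      iterate 3 rw [hp.adj _ _ (by omega) (by omega)]; omega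
      all_goals
        intro h
        have := hp.inj _ _ (by omega) (by omega) h
        omega
    obtain ⟨c, rfl⟩ : ∃ c, a = c + 1 := ⟨a - 1, by omega⟩
    rcases (show s = 3 ∨ s = 4 by omega) with rfl | rfl
    · refine pattern_false hG.free.2.2.2.2.2.1
        ![p c, p (c + 1), p (c + 2), p (c + 3), p (c + 4), x] ?_ (by decide)
      simp +decide (disch := omega) [Fin.forall_fin_succ, hp.adj, ht.adj, ht.adj', add_assoc]
    · refine pattern_false hG.free.2.2.2.2.2.2.1
        ![p c, p (c + 1), p (c + 2), p (c + 3), p (c + 4), p (c + 5), x] ?_ (by decide)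
      simp +decide (disch := omega) [Fin.forall_fin_succ, hp.adj, ht.adj, ht.adj', add_assoc]

theorem IsLongest.not_adj_of_start (hp : IsLongest G k p) (hk : 2 ≤ k) {x y : V}
    (hx : HasTrace G k p x 0 2) (hne : ∀ l < k, y ≠ p l) (hy : ∀ l < k, ¬ G.Adj y (p l)) :
    ¬ G.Adj y x := by
  intro hyx
  have hp' := hp.update (x := x) (i := 0) (by omega) hx.ne fun l hl hl0 => by
    rw [hx.adj l hl]; omega
  refine hp.max _ (hp'.toIsIndPath.cons (x := y) (fun l hl => ?_) fun l hl => ?_)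
  · rcases eq_or_ne l 0 with rfl | h0
    · simpa using hyx.ne
    · simpa [h0] using hne l hl
  · rcases eq_or_ne l 0 with rfl | h0
    · simpa using hyx
    · simpa [h0] using hy l hl

/-- Every vertex outside a longest induced path has two, three or four neighbours on the path,
which are consecutive and, if there are more than two, contain an end of the path. -/
theorem IsLongest.exists_hasTrace (hG : IsAdmissible G) (hp : IsLongest G k p) (hk : 2 ≤ k)
    {x : V} (hne : ∀ l < k, x ≠ p l) :
    ∃ i s, HasTrace G k p x i s ∧ 2 ≤ s ∧ s ≤ 4 ∧ (3 ≤ s → i = 0 ∨ i + s = k) := by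
  suffices h : ∃ l < k, G.Adj x (p l) by
    obtain ⟨l, hl, h⟩ := h
    exact hp.exists_hasTrace_of_adj hG hne hl h
  by_contra! hx
  let L : Set V := {v | (∃ l < k, v = p l) ∨ ∃ l < k, G.Adj v (p l)}
  have hxL : x ∉ L := by
    rintro (⟨l, hl, h⟩ | ⟨l, hl, h⟩)
    · exact hne l hl h
    · exact hx l hl h
  obtain ⟨u, y, hu, hy, huy⟩ := exists_boundary_adj hG.preconnected
    (show p 0 ∈ L from Or.inl ⟨0, by omega, rfl⟩) hxL
  simp only [L, Set.mem_ofPred_eq, not_or, not_exists, not_and] at hy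
  obtain ⟨hyne, hyadj⟩ := hy
  have hyne : ∀ l < k, y ≠ p l := hyne
  have hune : ∀ l < k, u ≠ p l := by
    rintro l hl rfl
    exact hyadj l hl huy.symm
  obtain ⟨l, hl, hul⟩ : ∃ l < k, G.Adj u (p l) := by
    rcases hu with ⟨l, hl, h⟩ | h
    · exact absurd h (hune l hl)
    · exact h
  obtain ⟨i, s, ht, hs2, -, -⟩ := hp.exists_hasTrace_of_adj hG hune hl hul
  have hle := ht.le
  rcases hs2.eq_or_lt with rfl | hs3
  · rcases Nat.eq_zero_or_pos i with rfl | hi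
    · exact hp.not_adj_of_start hk ht hyne hyadj huy.symm
    · rcases hle.eq_or_lt with h | h
      · have ht' := ht.reverse
        rw [show k - i - 2 = 0 by omega] at ht'
        exact hp.reverse.not_adj_of_start hk ht' (fun l hl => hyne _ (by omega))
          (fun l hl => hyadj _ (by omega)) huy.symm
      · obtain ⟨c, rfl⟩ : ∃ c, i = c + 1 := ⟨i - 1, by omega⟩
        have hyadj' : ∀ l < k, ¬ G.Adj (p l) y := fun l hl h => hyadj l hl h.symm
        refine pattern_false hG.free.2.2.2.1
          ![p c, p (c + 1), p (c + 2), p (c + 3), u, y] ?_ (by decide)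
        simp +decide (disch := omega) [Fin.forall_fin_succ, hp.adj, ht.adj, ht.adj', add_assoc,
          hyadj', huy]
  · refine claw_false hG.free (c := u) (x := y) (y := p i) (z := p (i + 2)) huy ?_ ?_
      (hyadj _ (by omega)) (hyadj _ (by omega)) ?_ (hyne _ (by omega)) (hyne _ (by omega)) ?_
    · rw [ht.adj _ (by omega)]; omega
    · rw [ht.adj _ (by omega)]; omega
    · rw [hp.adj _ _ (by omega) (by omega)]; omega
    · intro h
      have := hp.inj _ _ (by omega) (by omega) h
      omega

/-- A set with an edge that is not the whole vertex set is distinguished by an outside vertex. -/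
theorem homogeneous_false [Finite V]
    (hom : ∀ U : Set V, IsNontrivialHomogeneous G U → G.IsIndepSet U) (M : Set V) {a b c : V}
    (ha : a ∈ M) (hb : b ∈ M) (hab : G.Adj a b) (hc : c ∉ M)
    (h : ∀ w, w ∉ M → ∀ u ∈ M, (G.Adj w u ↔ G.Adj w a)) : False := by
  refine hom M ⟨fun w hw => ?_, ?_, ?_, ?_⟩ ha hb hab.ne hab
  · by_cases hwa : G.Adj w a
    · exact Or.inl fun u hu => (h w hw u hu).2 hwa
    · exact Or.inr fun u hu h' => hwa ((h w hw u hu).1 h')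
  · exact (Set.ncard_pos (Set.toFinite M)).2 ⟨a, ha⟩ |>.ne'
  · intro h1
    obtain ⟨d, rfl⟩ := Set.ncard_eq_one.1 h1
    exact hab.ne (by rw [Set.mem_singleton_iff.1 ha, Set.mem_singleton_iff.1 hb])
  · intro h1
    have : M = Set.univ := Set.eq_of_subset_of_ncard_le (Set.subset_univ M)
      (by rw [Set.ncard_univ, h1])
    exact hc (this ▸ Set.mem_univ c)

/-- Outside vertices with separated neighbourhoods on the path are not adjacent: otherwise they
would close an induced cycle with the part of the path between these neighbourhoods. -/
theorem HasTrace.not_adj (hc : IsChordal G) (hp : IsIndPath G k p) {x y : V} {i s j t : ℕ}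
    (hx : HasTrace G k p x i s) (hy : HasTrace G k p y j t) (hs : 0 < s) (ht : 0 < t)
    (hij : i + s ≤ j) : ¬ G.Adj x y := by
  intro hxy
  have hle := hy.le
  have hq := (hp.sub (i + s - 1) (m := j + 2 - (i + s)) (by omega)).cons (x := x)
    (fun l hl => hx.ne _ (by omega)) (fun l hl => by rw [hx.adj _ (by omega)]; omega)
  refine hq.cycle_false hc (by omega) (x := y) (fun l hl => ?_) fun l hl => ?_
  · rcases l with _ | l
    · simpa using hxy.ne'
    · simpa using hy.ne _ (by omega)
  · rcases l with _ | l
    · simpa using hxy.symm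
    · simp only [Nat.add_eq_zero_iff, one_ne_zero, and_false, if_false, false_or,
        Nat.add_sub_cancel]
      rw [hy.adj _ (by omega)]
      omega

/-- Two consecutive edges of a longest induced path do not both have an apex. -/
theorem IsLongest.apex_succ_false (hG : IsAdmissible G) (hp : IsLongest G k p) {x y : V} {i : ℕ}
    (hx : HasTrace G k p x i 2) (hy : HasTrace G k p y (i + 1) 2) : False := by
  have hle := hy.le
  by_cases hxy : G.Adj x y
  · -- the detour through `x` and `y` is a longer path
    refine hp.max (fun t => if t ≤ i then p t else if t = i + 1 then x else
      if t = i + 2 then y else p (t - 1)) ⟨fun a b ha hb => ?_, fun a b ha hb hab => ?_⟩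
    · have hxy' := hxy.symm
      split_ifs <;>
        simp (disch := omega) [hp.adj, hx.adj, hx.adj', hy.adj, hy.adj', hxy, hxy'] <;> omega
    · have hxy' := hxy.ne
      have hxy'' := hxy.ne'
      have h1 := hx.ne
      have h2 := hy.ne
      have h3 := hp.inj
      split_ifs at hab <;> first
        | omega
        | exact absurd hab (h1 _ (by omega))
        | exact absurd hab (h2 _ (by omega))
        | exact absurd hab.symm (h1 _ (by omega))
        | exact absurd hab.symm (h2 _ (by omega))
        | exact absurd hab hxy'
        | exact absurd hab hxy''
        | (have := h3 _ _ (by omega) (by omega) hab; omega)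
  · refine butterfly_false hG.free (c := p (i + 1)) (x := p i) (y := x) (u := p (i + 2)) (v := y)
      ?_ ?_ ?_ ?_ ?_ ?_ ?_ ?_ ?_ hxy <;>
    simp (disch := omega) [hp.adj, hx.adj, hx.adj', hy.adj']
    omega

/-! ### The vertices outside a longest induced path -/

theorem HasTrace.update {x y : V} {i j t : ℕ} (hne : ∀ l < k, l ≠ i → y ≠ p l) (hyx : y ≠ x)
    (hle : j + t ≤ k) (h : ∀ l < k, l ≠ i → (G.Adj y (p l) ↔ j ≤ l ∧ l < j + t))
    (hi : G.Adj y x ↔ j ≤ i ∧ i < j + t) : HasTrace G k (Function.update p i x) y j t where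
  ne l hl := by
    rcases eq_or_ne l i with rfl | h0
    · simpa using hyx
    · simpa [h0] using hne l hl h0
  le := hle
  adj l hl := by
    rcases eq_or_ne l i with rfl | h0
    · simpa using hi
    · simpa [h0] using h l hl h0

/-- The vertices of a given trace form a homogeneous set if the traces of the other vertices are
disjoint from it; so no two of them are adjacent. -/
theorem IsLongest.trace_unique [Finite V] (hG : IsAdmissible G)
    (hom : ∀ U : Set V, IsNontrivialHomogeneous G U → G.IsIndepSet U)
    (hp : IsLongest G k p) (hk : 2 ≤ k) {x y : V} {i s : ℕ} (hs : 0 < s)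
    (hx : HasTrace G k p x i s) (hy : HasTrace G k p y i s) (hxy : G.Adj x y)
    (hdisj : ∀ w j t, HasTrace G k p w j t → 2 ≤ t → (3 ≤ t → j = 0 ∨ j + t = k) →
      (j = i ∧ t = s) ∨ j + t ≤ i ∨ i + s ≤ j) : False := by
  refine homogeneous_false hom {u | HasTrace G k p u i s} hx hy hxy (c := p 0)
    (fun h => h.ne 0 (by omega) rfl) fun w hw u hu => ?_
  by_cases hwp : ∃ l < k, w = p l
  · obtain ⟨l, hl, rfl⟩ := hwp
    rw [hu.adj' l hl, hx.adj' l hl]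
  · obtain ⟨j, t, ht, ht2, -, ht3⟩ := hp.exists_hasTrace hG hk (x := w)
      fun l hl h => hwp ⟨l, hl, h⟩
    rcases hdisj w j t ht ht2 ht3 with ⟨rfl, rfl⟩ | h | h
    · exact absurd ht hw
    · have h1 := ht.not_adj hG.chordal hp.toIsIndPath hu (by omega) hs h
      have h2 := ht.not_adj hG.chordal hp.toIsIndPath hx (by omega) hs h
      simp [h1, h2]
    · have h1 := hu.not_adj hG.chordal hp.toIsIndPath ht hs (by omega) h
      have h2 := hx.not_adj hG.chordal hp.toIsIndPath ht hs (by omega) h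
      rw [G.adj_comm] at h1 h2
      simp [h1, h2]

/-- On a longest induced path with four vertices, a vertex adjacent to the whole path would be
adjacent to all other vertices, which would form a homogeneous set. -/
theorem IsLongest.hub_false [Finite V] (hG : IsAdmissible G)
    (hom : ∀ U : Set V, IsNontrivialHomogeneous G U → G.IsIndepSet U)
    (hno : ¬ F8minus.IsIndContained G) (hp : IsLongest G 4 p) {x : V}
    (hx : HasTrace G 4 p x 0 4) : False := by
  refine homogeneous_false hom {u | u ≠ x} (a := p 0) (b := p 1) (c := x) (hx.ne 0 (by omega)).symm
    (hx.ne 1 (by omega)).symm (by rw [hp.adj _ _ (by omega) (by omega)]; omega) (by simp) ?_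
  intro w hw u hu
  simp only [Set.mem_ofPred_eq, not_not] at hw
  subst hw
  rw [hx.adj 0 (by omega)]
  simp only [le_refl, zero_add, Nat.ofNat_pos, and_self, iff_true]
  by_cases hup : ∃ l < 4, u = p l
  · obtain ⟨l, hl, rfl⟩ := hup
    rw [hx.adj l hl]; omega
  · obtain ⟨j, t, ht, ht2, ht4, ht3⟩ := hp.exists_hasTrace hG (by omega) (x := u)
      fun l hl h => hup ⟨l, hl, h⟩
    have hle := ht.le
    by_contra hwu
    have huw : ¬ G.Adj u w := fun h => hwu h.symm
    have hne : w ≠ u := fun h => hu h.symm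
    have sq : ∀ a b, a < 4 → b < 4 → a + 2 ≤ b → j ≤ a → b < j + t → False := by
      intro a b ha hb hab hja hbt
      refine square_false hG.chordal (a := p a) (b := u) (c := p b) (d := w) ?_ ?_ ?_ ?_ ?_ huw ?_
        hu
      · rw [ht.adj' a ha]; omega
      · rw [ht.adj b hb]; omega
      · rw [hx.adj' b hb]; omega
      · rw [hx.adj a ha]; omega
      · rw [hp.adj a b ha hb]; omega
      · intro h
        have := hp.inj a b ha hb h
        omega
    rcases (show t = 2 ∨ 3 ≤ t by omega) with rfl | h3
    · rcases (show j = 0 ∨ j = 1 ∨ j = 2 by omega) with rfl | rfl | rfl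
      · refine pattern_false hno ![u, p 1, p 2, p 3, w, p 0] ?_ (by decide)
        simp +decide (disch := omega) [Fin.forall_fin_succ, hp.adj, ht.adj, hx.adj,
          hx.adj', huw]
      · refine pattern_false hG.free.2.2.2.2.1 ![p 0, p 1, u, w, p 2, p 3] ?_ (by decide)
        simp +decide (disch := omega) [Fin.forall_fin_succ, hp.adj, ht.adj, ht.adj', hx.adj,
          hx.adj', huw]
      · refine pattern_false hno ![p 0, w, p 3, u, p 2, p 1] ?_ (by decide)
        simp +decide (disch := omega) [Fin.forall_fin_succ, hp.adj, ht.adj, ht.adj', hx.adj,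
          hx.adj', hwu]
    · exact sq j (j + 2) (by omega) (by omega) (by omega) le_rfl (by omega)

/-- No vertex is attached to the first two vertices of the path only: such vertices and the first
vertex of the path would form a homogeneous set. -/
theorem IsLongest.apex_start_false [Finite V] (hG : IsAdmissible G)
    (hom : ∀ U : Set V, IsNontrivialHomogeneous G U → G.IsIndepSet U)
    (hno : ¬ F8minus.IsIndContained G) (hp : IsLongest G k p) (hk : 4 ≤ k) {x : V}
    (hx : HasTrace G k p x 0 2) : False := by
  refine homogeneous_false hom {u | u = p 0 ∨ HasTrace G k p u 0 2} (a := p 0) (b := x) (c := p 1)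
    (Or.inl rfl) (Or.inr hx) (by rw [hx.adj' 0 (by omega)]; omega) ?_ ?_
  · rintro (h | h)
    · have := hp.inj _ _ (by omega) (by omega) h
      omega
    · exact h.ne 1 (by omega) rfl
  rintro w hw u (rfl | hu)
  · rfl
  simp only [Set.mem_ofPred_eq, not_or] at hw
  by_cases hwp : ∃ l < k, w = p l
  · obtain ⟨l, hl, rfl⟩ := hwp
    have : l ≠ 0 := fun h => hw.1 (by rw [h])
    rw [hu.adj' l hl, hp.adj l 0 hl (by omega)]
    omega
  · obtain ⟨j, t, ht, ht2, ht4, ht3⟩ := hp.exists_hasTrace hG (by omega) (x := w)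
      fun l hl h => hwp ⟨l, hl, h⟩
    have hle := ht.le
    have hwu : w ≠ u := fun h => hw.2 (h ▸ hu)
    rw [ht.adj 0 (by omega)]
    rcases (show j = 0 ∨ j = 1 ∨ 2 ≤ j by omega) with rfl | rfl | hj
    · suffices h : G.Adj w u by simp [h]; omega
      by_contra hn
      have hn' : ¬ G.Adj u w := fun h => hn h.symm
      rcases (show t = 2 ∨ t = 3 ∨ t = 4 by omega) with rfl | rfl | rfl
      · exact hw.2 ht
      · have hp' := hp.update (x := u) (i := 0) (by omega) hu.ne fun l hl hl0 => by
          rw [hu.adj l hl]; omega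
        refine hp'.apex_succ_false hG (x := p 0) (y := w) (i := 0) ?_ ?_
        · refine HasTrace.update (fun l hl hl0 h => hl0 ?_) (hu.ne 0 (by omega)).symm (by omega)
            (fun l hl hl0 => ?_) ?_
          · exact ((hp.eq_iff _ _ (by omega) hl).1 h).symm
          · rw [hp.adj _ _ (by omega) hl]; omega
          · rw [hu.adj' _ (by omega)]
        · refine HasTrace.update (fun l hl _ => ht.ne l hl) hwu (by omega) (fun l hl hl0 => ?_) ?_
          · rw [ht.adj l hl]; omega
          · simp [hn]
      · rcases hk.eq_or_lt with rfl | hk5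
        · exact hp.hub_false hG hom hno ht
        · refine pattern_false hG.free.2.2.2.2.2.1 ![u, p 1, p 2, p 3, p 4, w] ?_ (by decide)
          simp +decide (disch := omega) [Fin.forall_fin_succ, hp.adj, ht.adj', hu.adj, hn']
    · suffices h : ¬ G.Adj w u by simp [h]
      intro h
      have h' := h.symm
      rcases (show t = 2 ∨ t = 3 ∨ t = 4 by omega) with rfl | rfl | rfl
      · exact hp.apex_succ_false hG hu ht
      · obtain rfl : k = 4 := by omega
        refine pattern_false hno ![p 0, p 1, p 2, p 3, w, u] ?_ (by decide)
        simp +decide (disch := omega) [Fin.forall_fin_succ, hp.adj, ht.adj', ht.adj, hu.adj,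
          hu.adj', h]
      · refine claw_false hG.free (c := w) (x := u) (y := p 2) (z := p 4) h ?_ ?_ ?_ ?_ ?_
          (hu.ne _ (by omega)) (hu.ne _ (by omega)) ?_ <;>
          simp (disch := omega) [hp.adj, ht.adj, hu.adj, hp.eq_iff]
    · have h := hu.not_adj hG.chordal hp.toIsIndPath ht (by omega) (by omega) (by omega)
      rw [G.adj_comm] at h
      simp [h]; omega

/-- No vertex is attached to exactly the first three vertices of the path: such vertices and the
second vertex of the path would form a homogeneous set. -/
theorem IsLongest.trace_start_three_false [Finite V] (hG : IsAdmissible G)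
    (hom : ∀ U : Set V, IsNontrivialHomogeneous G U → G.IsIndepSet U)
    (hno : ¬ F8minus.IsIndContained G) (hp : IsLongest G k p) (hk : 4 ≤ k) {x : V}
    (hx : HasTrace G k p x 0 3) : False := by
  refine homogeneous_false hom {u | u = p 1 ∨ HasTrace G k p u 0 3} (a := p 1) (b := x) (c := p 0)
    (Or.inl rfl) (Or.inr hx) (by rw [hx.adj' 1 (by omega)]; omega) ?_ ?_
  · rintro (h | h)
    · have := hp.inj _ _ (by omega) (by omega) h
      omega
    · exact h.ne 0 (by omega) rfl
  rintro w hw u (rfl | hu)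
  · rfl
  simp only [Set.mem_ofPred_eq, not_or] at hw
  by_cases hwp : ∃ l < k, w = p l
  · obtain ⟨l, hl, rfl⟩ := hwp
    have : l ≠ 1 := fun h => hw.1 (by rw [h])
    rw [hu.adj' l hl, hp.adj l 1 hl (by omega)]
    omega
  · obtain ⟨j, t, ht, ht2, ht4, ht3⟩ := hp.exists_hasTrace hG (by omega) (x := w)
      fun l hl h => hwp ⟨l, hl, h⟩
    have hle := ht.le
    have hwu : w ≠ u := fun h => hw.2 (h ▸ hu)
    rw [ht.adj 1 (by omega)]
    rcases (show j ≤ 1 ∨ j = 2 ∨ 3 ≤ j by omega) with hj | rfl | hj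
    · suffices h : G.Adj w u by simp [h]; omega
      by_contra hn
      have hn' : ¬ G.Adj u w := fun h => hn h.symm
      rcases (show j = 0 ∨ j = 1 by omega) with rfl | rfl
      · rcases (show t = 2 ∨ t = 3 ∨ t = 4 by omega) with rfl | rfl | rfl
        · exact hp.apex_start_false hG hom hno hk ht
        · exact hw.2 ht
        · refine square_false hG.chordal (a := p 0) (b := u) (c := p 2) (d := w) ?_ ?_ ?_ ?_ ?_
            hn' ?_ hwu.symm <;>
          simp (disch := omega) [hp.adj, hu.adj, hu.adj', ht.adj, ht.adj', hp.eq_iff]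
      · rcases (show t = 2 ∨ t = 3 ∨ t = 4 by omega) with rfl | rfl | rfl
        · refine claw_false hG.free (c := p 2) (x := w) (y := u) (z := p 3) ?_ ?_ ?_ hn ?_ ?_ hwu
            (ht.ne _ (by omega)) (hu.ne _ (by omega)) <;>
          simp (disch := omega) [hp.adj, hu.adj, hu.adj', ht.adj, ht.adj']
        · obtain rfl : k = 4 := by omega
          refine pattern_false hno ![p 0, p 1, w, p 3, p 2, u] ?_ (by decide)
          simp +decide (disch := omega) [Fin.forall_fin_succ, hp.adj, ht.adj', ht.adj, hu.adj',
            hn]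
        · obtain rfl : k = 5 := by omega
          refine pattern_false hG.free.2.2.2.2.2.2.2.1 ![p 0, p 1, w, p 4, u, p 2, p 3] ?_
            (by decide)
          simp +decide (disch := omega) [Fin.forall_fin_succ, hp.adj, ht.adj', ht.adj, hu.adj,
            hu.adj', hn]
    · suffices h : ¬ G.Adj w u by simp [h]
      intro h
      have h' := h.symm
      rcases (show t = 2 ∨ t = 3 ∨ t = 4 by omega) with rfl | rfl | rfl
      · rcases hk.eq_or_lt with rfl | hk5
        · exact hp.reverse.apex_start_false hG hom hno hk (by simpa using ht.reverse)
        · refine pattern_false hG.free.2.2.2.2.2.1 ![p 0, u, p 2, p 3, p 4, w] ?_ (by decide)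
          simp +decide (disch := omega) [Fin.forall_fin_succ, hp.adj, ht.adj', hu.adj, hu.adj', h']
      · obtain rfl : k = 5 := by omega
        refine pattern_false hG.free.2.2.2.2.2.2.2.1 ![p 0, u, w, p 4, p 1, p 2, p 3] ?_
          (by decide)
        simp +decide (disch := omega) [Fin.forall_fin_succ, hp.adj, ht.adj', ht.adj, hu.adj,
          hu.adj', h']
      · refine claw_false hG.free (c := w) (x := u) (y := p 3) (z := p 5) h ?_ ?_ ?_ ?_ ?_
          (hu.ne _ (by omega)) (hu.ne _ (by omega)) ?_ <;>
        simp (disch := omega) [hp.adj, ht.adj, hu.adj, hp.eq_iff]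
    · have h := hu.not_adj hG.chordal hp.toIsIndPath ht (by omega) (by omega) (by omega)
      rw [G.adj_comm] at h
      simp [h]; omega

/-- The hub of a gem on the first four vertices of the path excludes an apex over the second, third
or fourth edge of the path. -/
theorem IsLongest.hub_apex_false (hG : IsAdmissible G) (hp : IsLongest G k p) (hk : 5 ≤ k)
    {x y : V} {i : ℕ} (hi : 1 ≤ i) (hi3 : i ≤ 3) (hx : HasTrace G k p x 0 4)
    (hy : HasTrace G k p y i 2) : False := by
  have hxy : x ≠ y := by
    rintro rfl
    have h0 := hx.adj 0 (by omega)
    rw [hy.adj 0 (by omega)] at h0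
    omega
  by_cases h : G.Adj x y
  · have h' := h.symm
    rcases (show i = 1 ∨ i = 2 ∨ i = 3 by omega) with rfl | rfl | rfl
    · refine claw_false hG.free (c := x) (x := p 0) (y := p 3) (z := y) ?_ ?_ h ?_ ?_ ?_ ?_
        (hy.ne _ (by omega)).symm (hy.ne _ (by omega)).symm <;>
      simp (disch := omega) [hp.adj, hx.adj, hy.adj', hp.eq_iff]
    · refine butterfly_false hG.free (c := x) (x := p 0) (y := p 1) (u := p 3) (v := y)
        ?_ ?_ ?_ h ?_ ?_ ?_ ?_ ?_ ?_ <;>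
      simp (disch := omega) [hp.adj, hx.adj, hy.adj']
    · refine claw_false hG.free (c := x) (x := p 0) (y := p 2) (z := y) ?_ ?_ h ?_ ?_ ?_ ?_
        (hy.ne _ (by omega)).symm (hy.ne _ (by omega)).symm <;>
      simp (disch := omega) [hp.adj, hx.adj, hy.adj', hp.eq_iff]
  · have h' : ¬ G.Adj y x := fun h' => h h'.symm
    rcases (show i = 1 ∨ i = 2 ∨ i = 3 by omega) with rfl | rfl | rfl
    · refine pattern_false hG.free.2.2.2.2.1 ![p 0, p 1, y, x, p 2, p 3] ?_ (by decide)
      simp +decide (disch := omega) [Fin.forall_fin_succ, hp.adj, hx.adj, hx.adj', hy.adj,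
        hy.adj', h']
    · refine claw_false hG.free (c := p 3) (x := p 4) (y := x) (z := y) ?_ ?_ ?_ ?_ ?_ h
        (hx.ne _ (by omega)).symm (hy.ne _ (by omega)).symm hxy <;>
      simp (disch := omega) [hp.adj, hx.adj', hy.adj']
    · have := hy.le
      refine butterfly_false hG.free (c := p 3) (x := y) (y := p 4) (u := x) (v := p 2)
        ?_ ?_ ?_ ?_ ?_ ?_ h' ?_ ?_ ?_ <;>
      simp (disch := omega) [hp.adj, hx.adj, hx.adj', hy.adj, hy.adj']

/-- The hubs of gems at the two ends of the path have no common neighbours on the path. -/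
theorem IsLongest.hub_hub_false (hG : IsAdmissible G) (hp : IsLongest G k p)
    {x y : V} {i : ℕ} (hi : 1 ≤ i) (hi3 : i ≤ 3) (hx : HasTrace G k p x 0 4)
    (hy : HasTrace G k p y i 4) : False := by
  have hle := hy.le
  have hxy : x ≠ y := by
    rintro rfl
    have h0 := hx.adj 0 (by omega)
    rw [hy.adj 0 (by omega)] at h0
    omega
  by_cases h : G.Adj x y
  · have h' := h.symm
    rcases (show i = 1 ∨ i = 2 ∨ i = 3 by omega) with rfl | rfl | rfl
    · refine pattern_false hG.free.2.2.2.2.2.2.2.2 ![p 0, x, p 3, p 1, y, p 4, p 2] ?_ (by decide)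
      simp +decide (disch := omega) [Fin.forall_fin_succ, hp.adj, hx.adj, hx.adj', hy.adj,
        hy.adj', h]
    · refine butterfly_false hG.free (c := x) (x := p 0) (y := p 1) (u := p 3) (v := y)
        ?_ ?_ ?_ h ?_ ?_ ?_ ?_ ?_ ?_ <;>
      simp (disch := omega) [hp.adj, hx.adj, hy.adj']
    · refine claw_false hG.free (c := x) (x := p 0) (y := p 2) (z := y) ?_ ?_ h ?_ ?_ ?_ ?_
        (hy.ne _ (by omega)).symm (hy.ne _ (by omega)).symm <;>
      simp (disch := omega) [hp.adj, hx.adj, hy.adj', hp.eq_iff]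
  · rcases (show i = 1 ∨ i = 2 ∨ i = 3 by omega) with rfl | rfl | rfl
    · refine square_false hG.chordal (a := p 1) (b := x) (c := p 3) (d := y) ?_ ?_ ?_ ?_ ?_
        h ?_ hxy <;>
      simp (disch := omega) [hp.adj, hx.adj, hx.adj', hy.adj, hy.adj', hp.eq_iff]
    · refine pattern_false hG.free.2.2.2.2.2.1 ![p 0, x, p 3, y, p 5, p 2] ?_ (by decide)
      simp +decide (disch := omega) [Fin.forall_fin_succ, hp.adj, hx.adj, hx.adj', hy.adj,
        hy.adj', h]
    · refine butterfly_false hG.free (c := p 3) (x := x) (y := p 2) (u := y) (v := p 4)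
        ?_ ?_ ?_ ?_ ?_ ?_ h ?_ ?_ ?_ <;>
      simp (disch := omega) [hp.adj, hx.adj, hx.adj', hy.adj, hy.adj']

/-- In an admissible graph no further vertex has a neighbour in an induced copy of `F8minus`. -/
theorem F8minus_extension_false (hG : IsAdmissible G) (f : F8minus ↪g G) {y : V}
    (hne : ∀ i, y ≠ f i)
    (hsome : ¬ (¬ G.Adj y (f 0) ∧ ¬ G.Adj y (f 1) ∧ ¬ G.Adj y (f 2) ∧ ¬ G.Adj y (f 3) ∧
      ¬ G.Adj y (f 4) ∧ ¬ G.Adj y (f 5))) : False := by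
  have hf : ∀ i j, G.Adj (f i) (f j) ↔ F8minus.Adj i j := fun i j => f.map_adj_iff
  have hy : ∀ i, G.Adj (f i) y ↔ G.Adj y (f i) := fun i => G.adj_comm _ _
  have hne' : ∀ i, f i ≠ y := fun i => (hne i).symm
  have hinj : ∀ i j, f i = f j ↔ i = j := fun i j => f.injective.eq_iff
  by_cases h5 : G.Adj y (f 5)
  by_cases h2 : G.Adj y (f 2)
  by_cases h1 : G.Adj y (f 1)
  by_cases h4 : G.Adj y (f 4)
  by_cases h0 : G.Adj y (f 0)
  by_cases h3 : G.Adj y (f 3)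
  · refine pattern_false hG.free.2.1 ![f 0, f 5, f 2, f 3, y] ?_ (by decide)
    simp +decide [Fin.forall_fin_succ, *]
  · refine pattern_false hG.free.2.2.1 ![f 0, f 1, f 4, f 3, f 2, y] ?_ (by decide)
    simp +decide [Fin.forall_fin_succ, *]
  by_cases h3 : G.Adj y (f 3)
  · refine pattern_false hG.free.2.2.1 ![f 0, f 5, f 4, f 3, y, f 1] ?_ (by decide)
    simp +decide [Fin.forall_fin_succ, *]
  · refine pattern_false hG.free.2.2.2.2.2.2.2.2 ![f 0, f 1, f 2, f 5, f 4, f 3, y] ?_ (by decide)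
    simp +decide [Fin.forall_fin_succ, *]
  · refine square_false hG.chordal (a := f 5) (b := f 4) (c := f 2) (d := y)
      ?_ ?_ ?_ ?_ ?_ ?_ ?_ ?_ <;>
    simp +decide [*]
  · refine square_false hG.chordal (a := f 5) (b := f 1) (c := f 2) (d := y)
      ?_ ?_ ?_ ?_ ?_ ?_ ?_ ?_ <;>
    simp +decide [*]
  by_cases h3 : G.Adj y (f 3)
  by_cases h1 : G.Adj y (f 1)
  · refine square_false hG.chordal (a := f 1) (b := f 2) (c := f 3) (d := y)
      ?_ ?_ ?_ ?_ ?_ ?_ ?_ ?_ <;>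
    simp +decide [*]
  · refine pattern_false (hG.chordal 5 (by norm_num)) ![f 5, f 1, f 2, f 3, y] ?_ (by decide)
    simp +decide [Fin.forall_fin_succ, *]
  by_cases h4 : G.Adj y (f 4)
  · refine pattern_false hG.free.2.1 ![f 5, y, f 2, f 3, f 4] ?_ (by decide)
    simp +decide [Fin.forall_fin_succ, *]
  by_cases h0 : G.Adj y (f 0)
  by_cases h1 : G.Adj y (f 1)
  · refine pattern_false hG.free.2.1 ![f 0, y, f 4, f 2, f 1] ?_ (by decide)
    simp +decide [Fin.forall_fin_succ, *]
  · refine pattern_false hG.free.2.2.2.2.2.2.2.1 ![f 3, f 4, f 5, y, f 2, f 1, f 0] ?_ (by decide)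
    simp +decide [Fin.forall_fin_succ, *]
  · refine claw_false hG.free (c := f 5) (x := f 0) (y := f 4) (z := y)
      ?_ ?_ ?_ ?_ ?_ ?_ ?_ ?_ ?_ <;>
    simp +decide [*]
  by_cases h1 : G.Adj y (f 1)
  by_cases h2 : G.Adj y (f 2)
  by_cases h0 : G.Adj y (f 0)
  by_cases h4 : G.Adj y (f 4)
  · refine square_false hG.chordal (a := f 0) (b := f 5) (c := f 4) (d := y)
      ?_ ?_ ?_ ?_ ?_ ?_ ?_ ?_ <;>
    simp +decide [*]
  · refine pattern_false (hG.chordal 5 (by norm_num)) ![f 0, f 5, f 4, f 2, y] ?_ (by decide)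
    simp +decide [Fin.forall_fin_succ, *]
  · refine pattern_false hG.free.2.1 ![f 0, f 5, f 2, y, f 1] ?_ (by decide)
    simp +decide [Fin.forall_fin_succ, *]
  · refine claw_false hG.free (c := f 1) (x := f 5) (y := f 2) (z := y)
      ?_ ?_ ?_ ?_ ?_ ?_ ?_ ?_ ?_ <;>
    simp +decide [*]
  by_cases h4 : G.Adj y (f 4)
  by_cases h3 : G.Adj y (f 3)
  · refine pattern_false hG.free.2.1 ![f 5, f 1, f 3, y, f 4] ?_ (by decide)
    simp +decide [Fin.forall_fin_succ, *]
  · refine claw_false hG.free (c := f 4) (x := f 5) (y := f 3) (z := y)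
      ?_ ?_ ?_ ?_ ?_ ?_ ?_ ?_ ?_ <;>
    simp +decide [*]
  by_cases h0 : G.Adj y (f 0)
  by_cases h3 : G.Adj y (f 3)
  · refine pattern_false (hG.chordal 5 (by norm_num)) ![f 0, f 5, f 4, f 3, y] ?_ (by decide)
    simp +decide [Fin.forall_fin_succ, *]
  · refine pattern_false hG.free.2.2.2.2.2.1 ![f 3, f 4, f 5, f 0, y, f 1] ?_ (by decide)
    simp +decide [Fin.forall_fin_succ, *]
  by_cases h2 : G.Adj y (f 2)
  by_cases h3 : G.Adj y (f 3)
  · refine pattern_false hG.free.2.2.2.2.2.2.2.1 ![f 0, f 1, f 2, y, f 5, f 4, f 3] ?_ (by decide)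
    simp +decide [Fin.forall_fin_succ, *]
  · refine claw_false hG.free (c := f 2) (x := f 1) (y := f 3) (z := y)
      ?_ ?_ ?_ ?_ ?_ ?_ ?_ ?_ ?_ <;>
    simp +decide [*]
  by_cases h3 : G.Adj y (f 3)
  · refine pattern_false hG.free.2.2.2.2.2.1 ![f 0, f 1, f 4, f 3, y, f 2] ?_ (by decide)
    simp +decide [Fin.forall_fin_succ, *]
  · exact hsome ⟨h0, h1, h2, h3, h4, h5⟩

/-- An admissible graph with an induced copy of `F8minus` is that copy. -/
theorem nonempty_iso_F8minus (hG : IsAdmissible G) (h : F8minus.IsIndContained G) :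
    Nonempty (G ≃g F8minus) := by
  obtain ⟨f⟩ := h
  have hsurj : Function.Surjective f := by
    by_contra hns
    simp only [Function.Surjective, not_forall] at hns
    obtain ⟨b, hb⟩ := hns
    obtain ⟨u, y, ⟨i, rfl⟩, hy, huy⟩ := exists_boundary_adj hG.preconnected
      (L := Set.range f) ⟨0, rfl⟩ hb
    refine F8minus_extension_false hG f (fun j h => hy ⟨j, h.symm⟩) fun hall => ?_
    have h' := huy.symm
    fin_cases i
    exacts [hall.1 h', hall.2.1 h', hall.2.2.1 h', hall.2.2.2.1 h', hall.2.2.2.2.1 h',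
      hall.2.2.2.2.2 h']
  exact ⟨(RelIso.ofSurjective f hsurj).symm⟩

/-- The possible traces of the vertices outside a longest induced path with `k` vertices: the
apex of a triangle over an inner edge of the path, and the hub of a gem over the first or the last
four vertices of the path. -/
def IsShape (k i s : ℕ) : Prop :=
  (s = 2 ∧ 1 ≤ i ∧ i + 3 ≤ k) ∨ (s = 4 ∧ 5 ≤ k ∧ (i = 0 ∨ i + 4 = k))

/-- The graph `G` consists of the induced path `p 0, …, p (k - 1)` and of outside vertices, each of
which is an apex over an inner edge or the hub of a gem at an end of the path, has no neighbours
outside the path, and shares no neighbour with any other outside vertex. -/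
structure IsApexPath (G : SimpleGraph V) (k : ℕ) (p : ℕ → V) : Prop extends IsIndPath G k p where
  two_le : 2 ≤ k
  exists_trace : ∀ x, (∀ l < k, x ≠ p l) → ∃ i s, IsShape k i s ∧ HasTrace G k p x i s
  mem_path : ∀ x, (∀ l < k, x ≠ p l) → ∀ w, G.Adj x w → ∃ l < k, w = p l
  unique : ∀ x y w, (∀ l < k, x ≠ p l) → (∀ l < k, y ≠ p l) → G.Adj x w → G.Adj y w → x = y

theorem IsLongest.isApexPath (hG : IsAdmissible G) (hp : IsLongest G k p) (hk : 2 ≤ k)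
    (hshape : ∀ x i s, HasTrace G k p x i s → 2 ≤ s → s ≤ 4 → (3 ≤ s → i = 0 ∨ i + s = k) →
      IsShape k i s)
    (hdisj : ∀ x y i s j t, HasTrace G k p x i s → HasTrace G k p y j t → IsShape k i s →
      IsShape k j t → x ≠ y → i ≤ j → i + s ≤ j) : IsApexPath G k p := by
  have htr : ∀ x, (∀ l < k, x ≠ p l) → ∃ i s, IsShape k i s ∧ HasTrace G k p x i s := by
    intro x hx
    obtain ⟨i, s, h, h2, h4, h3⟩ := hp.exists_hasTrace hG hk hx
    exact ⟨i, s, hshape x i s h h2 h4 h3, h⟩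
  have hpos : ∀ i s, IsShape k i s → 0 < s := by
    rintro i s (h | h) <;> omega
  have hsep : ∀ x y, (∀ l < k, x ≠ p l) → (∀ l < k, y ≠ p l) → x ≠ y →
      ∃ i s j t, HasTrace G k p x i s ∧ HasTrace G k p y j t ∧ 0 < s ∧ 0 < t ∧
        (i + s ≤ j ∨ j + t ≤ i) := by
    intro x y hx hy hxy
    obtain ⟨i, s, hs, h⟩ := htr x hx
    obtain ⟨j, t, ht, h'⟩ := htr y hy
    refine ⟨i, s, j, t, h, h', hpos _ _ hs, hpos _ _ ht, ?_⟩
    rcases le_total i j with hij | hij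
    · exact Or.inl (hdisj x y i s j t h h' hs ht hxy hij)
    · exact Or.inr (hdisj y x j t i s h' h ht hs hxy.symm hij)
  have hnadj : ∀ x y, (∀ l < k, x ≠ p l) → (∀ l < k, y ≠ p l) → ¬ G.Adj x y := by
    intro x y hx hy hxy
    obtain ⟨i, s, j, t, h, h', hs, ht, hd⟩ := hsep x y hx hy hxy.ne
    rcases hd with hd | hd
    · exact h.not_adj hG.chordal hp.toIsIndPath h' hs ht hd hxy
    · exact h'.not_adj hG.chordal hp.toIsIndPath h ht hs hd hxy.symm
  have hmem : ∀ x, (∀ l < k, x ≠ p l) → ∀ w, G.Adj x w → ∃ l < k, w = p l := by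
    intro x hx w hxw
    by_contra! hcon
    exact hnadj x w hx hcon hxw
  refine ⟨hp.toIsIndPath, hk, htr, hmem, fun x y w hx hy hxw hyw => ?_⟩
  by_contra hxy
  obtain ⟨l, hl, rfl⟩ := hmem x hx w hxw
  obtain ⟨i, s, j, t, h, h', hs, ht, hd⟩ := hsep x y hx hy hxy
  rw [h.adj l hl] at hxw
  rw [h'.adj l hl] at hyw
  omega

/-- An admissible graph without non-trivial homogeneous sets spanning an edge and without an induced
`F8minus` consists of a longest induced path with apices and hubs. -/
theorem IsLongest.isApexPath_of_not_isIndContained [Finite V] (hG : IsAdmissible G)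
    (hom : ∀ U : Set V, IsNontrivialHomogeneous G U → G.IsIndepSet U)
    (hno : ¬ F8minus.IsIndContained G) (hp : IsLongest G k p) (hk : 2 ≤ k) :
    IsApexPath G k p := by
  rcases (show k = 2 ∨ k = 3 ∨ 4 ≤ k by omega) with rfl | rfl | hk4
  · -- the graph is complete, so that the two vertices of the path form a homogeneous set
    have hout : ∀ x, ¬ ∀ l < 2, x ≠ p l := by
      intro x hx
      refine homogeneous_false hom {u | u = p 0 ∨ u = p 1} (a := p 0) (b := p 1) (c := x)
        (Or.inl rfl) (Or.inr rfl) (by rw [hp.adj _ _ (by omega) (by omega)]; omega)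
        (by rintro (h | h); exacts [hx 0 (by omega) h, hx 1 (by omega) h]) fun w hw u hu => ?_
      have hwne : ∀ l < 2, w ≠ p l := by
        intro l hl h
        interval_cases l
        exacts [hw (Or.inl h), hw (Or.inr h)]
      obtain ⟨i, s, h, h2, -, -⟩ := hp.exists_hasTrace hG hk hwne
      have hle := h.le
      rcases hu with rfl | rfl
      · rfl
      · rw [h.adj 1 (by omega), h.adj 0 (by omega)]; omega
    exact hp.isApexPath hG hk (fun x i s h => absurd h.ne (hout x))
      fun x y i s j t h => absurd h.ne (hout x)
  · -- the middle vertex of the path is adjacent to all other vertices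
    have hout : ∀ x, ¬ ∀ l < 3, x ≠ p l := by
      intro x hx
      have key : ∃ l, (l = 0 ∨ l = 2) ∧ G.Adj x (p l) := by
        obtain ⟨i, s, h, h2, -, -⟩ := hp.exists_hasTrace hG hk hx
        have hle := h.le
        rcases Nat.eq_zero_or_pos i with rfl | hi
        · exact ⟨0, by omega, (h.adj 0 (by omega)).2 (by omega)⟩
        · exact ⟨2, by omega, (h.adj 2 (by omega)).2 (by omega)⟩
      obtain ⟨l, hl, hxl⟩ := key
      refine homogeneous_false hom {u | u ≠ p 1} (a := x) (b := p l) (c := p 1)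
        (hx 1 (by omega)) ?_ hxl (by simp) fun w hw u hu => ?_
      · rw [Set.mem_ofPred_eq, ne_eq, hp.eq_iff _ _ (by omega) (by omega)]; omega
      · simp only [Set.mem_ofPred_eq, not_not] at hw
        subst hw
        have hall : ∀ u, u ≠ p 1 → G.Adj (p 1) u := by
          intro u hu
          by_cases hup : ∃ m < 3, u = p m
          · obtain ⟨m, hm, rfl⟩ := hup
            have : m ≠ 1 := fun h => hu (by rw [h])
            rw [hp.adj _ _ (by omega) hm]; omega
          · obtain ⟨i, s, h, h2, -, -⟩ := hp.exists_hasTrace hG hk (x := u)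
              fun m hm h => hup ⟨m, hm, h⟩
            have hle := h.le
            rw [h.adj' _ (by omega)]; omega
        simp [hall u hu, hall x (hx 1 (by omega))]
    exact hp.isApexPath hG hk (fun x i s h => absurd h.ne (hout x))
      fun x y i s j t h => absurd h.ne (hout x)
  · have hshape : ∀ x i s, HasTrace G k p x i s → 2 ≤ s → s ≤ 4 →
        (3 ≤ s → i = 0 ∨ i + s = k) → IsShape k i s := by
      intro x i s h h2 h4 h3
      have hle := h.le
      have hr := h.reverse
      have aux : ∀ a, k - i - s = a → HasTrace G k (fun t => p (k - 1 - t)) x a s := by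
        rintro a rfl; exact hr
      rcases (show s = 2 ∨ s = 3 ∨ s = 4 by omega) with rfl | rfl | rfl
      · have h0 : i ≠ 0 := by
          rintro rfl
          exact hp.apex_start_false hG hom hno hk4 h
        have h1 : i + 2 ≠ k := fun hik =>
          hp.reverse.apex_start_false hG hom hno hk4 (aux 0 (by omega))
        exact Or.inl (by omega)
      · exfalso
        rcases h3 le_rfl with rfl | hik
        · exact hp.trace_start_three_false hG hom hno hk4 h
        · exact hp.reverse.trace_start_three_false hG hom hno hk4 (aux 0 (by omega))
      · have : k ≠ 4 := by
          rintro rfl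
          obtain rfl : i = 0 := by omega
          exact hp.hub_false hG hom hno h
        exact Or.inr (by omega)
    -- different traces are disjoint
    have hpair : ∀ x y i s j t, HasTrace G k p x i s → HasTrace G k p y j t → IsShape k i s →
        IsShape k j t → i ≤ j → (i = j ∧ s = t) ∨ i + s ≤ j := by
      intro x y i s j t hx hy hs ht hij
      by_contra! hcon
      rcases hs with ⟨rfl, hi⟩ | ⟨rfl, hi⟩ <;> rcases ht with ⟨rfl, hj⟩ | ⟨rfl, hj⟩
      · obtain rfl : j = i + 1 := by
          have := hcon.1
          omega
        exact hp.apex_succ_false hG hx hy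
      · have hx' := hx.reverse
        have hy' := hy.reverse
        rw [show k - j - 4 = 0 by omega] at hy'
        exact hp.reverse.hub_apex_false hG (by omega) (by omega) (by omega) hy' hx'
      · rcases Nat.eq_zero_or_pos i with rfl | hi0
        · exact hp.hub_apex_false hG (by omega) (by omega) (by omega) hx hy
        · have hx' := hx.reverse
          have hy' := hy.reverse
          rw [show k - i - 4 = 0 by omega] at hx'
          exact hp.reverse.hub_apex_false hG (by omega) (by omega) (by omega) hx' hy'
      · have : i ≠ j := fun h => hcon.1 h rfl
        obtain rfl : i = 0 := by omega
        exact hp.hub_hub_false hG (by omega) (by omega) hx hy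
    refine hp.isApexPath hG hk hshape fun x y i s j t hx hy hs ht hxy hij => ?_
    rcases hpair x y i s j t hx hy hs ht hij with ⟨rfl, rfl⟩ | h
    swap
    · exact h
    exfalso
    refine hp.trace_unique hG hom hk (by rcases hs with h | h <;> omega) hx hy ?_ ?_
    · by_contra hn
      rcases hs with ⟨rfl, hi⟩ | ⟨rfl, hi⟩
      · refine claw_false hG.free (c := p i) (x := p (i - 1)) (y := x) (z := y) ?_ ?_ ?_ ?_ ?_ hn
          (hx.ne _ (by omega)).symm (hy.ne _ (by omega)).symm hxy
        · rw [hp.adj _ _ (by omega) (by omega)]; omega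
        · rw [hx.adj' _ (by omega)]; omega
        · rw [hy.adj' _ (by omega)]; omega
        · rw [hx.adj' _ (by omega)]; omega
        · rw [hy.adj' _ (by omega)]; omega
      · refine square_false hG.chordal (a := p i) (b := x) (c := p (i + 2)) (d := y) ?_ ?_ ?_ ?_ ?_
          hn ?_ hxy
        · rw [hx.adj' _ (by omega)]; omega
        · rw [hx.adj _ (by omega)]; omega
        · rw [hy.adj' _ (by omega)]; omega
        · rw [hy.adj _ (by omega)]; omega
        · rw [hp.adj _ _ (by omega) (by omega)]; omega
        · rw [ne_eq, hp.eq_iff _ _ (by omega) (by omega)]; omega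
    · intro w j t hw h2 h3
      have hle := hw.le
      have h4 : t ≤ 4 := by
        by_contra h5
        obtain ⟨j', t', hw', -, ht', -⟩ := hp.exists_hasTrace hG hk hw.ne
        have hle' := hw'.le
        have e1 := hw'.adj j (by omega)
        have e2 := hw'.adj (j + 4) (by omega)
        rw [hw.adj _ (by omega)] at e1 e2
        omega
      have hsh := hshape w j t hw h2 h4 h3
      rcases le_total i j with hij | hij
      · rcases hpair x w i s j t hx hw hs hsh hij with ⟨h, h'⟩ | h
        · exact Or.inl ⟨h.symm, h'.symm⟩
        · exact Or.inr (Or.inr h)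
      · rcases hpair w x j t i s hw hx hsh hs hij with h | h
        · exact Or.inl h
        · exact Or.inr (Or.inl h)

/-- A graph without isolated vertices that satisfies the conditions on homogeneous sets and induced
subgraphs is `F8minus` or an apex path. It is connected, as a component would be homogeneous. -/
theorem exists_isApexPath [Finite V] [Nonempty V] (hiso : ∀ v : V, ∃ w : V, G.Adj v w)
    (hom : ∀ U : Set V, IsNontrivialHomogeneous G U → G.IsIndepSet U)
    (hfree : ForbiddenFree G) (hch : IsChordal G) :
    Nonempty (G ≃g F8minus) ∨ ∃ k p, IsApexPath G k p := by
  have hconn : G.Preconnected := by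
    intro a b
    by_contra hab
    obtain ⟨c, hc⟩ := hiso a
    refine homogeneous_false hom {u | G.Reachable a u} (a := a) (b := c) (c := b)
      (Reachable.refl a) hc.reachable hc hab fun w hw u hu => ?_
    have h1 : ∀ v, G.Reachable a v → ¬ G.Adj w v := fun v hv h => hw (hv.trans h.symm.reachable)
    simp [h1 u hu, h1 a (Reachable.refl a)]
  have hG : IsAdmissible G := ⟨hconn, hfree, hch⟩
  by_cases hno : F8minus.IsIndContained G
  · exact Or.inl (nonempty_iso_F8minus hG hno)
  · obtain ⟨v⟩ := ‹Nonempty V›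
    obtain ⟨w, hw⟩ := hiso v
    obtain ⟨k, p, hk, hp⟩ := exists_isLongest hw
    exact Or.inr ⟨k, p, hp.isApexPath_of_not_isIndContained hG hom hno hk⟩

end Structure

/-! ### Gallai graphs that are trees -/

/-- The vertices of a cycle form a finite set in which each vertex has two neighbours. -/
theorem isAcyclic_of_no_core {W : Type*} {H : SimpleGraph W}
    (h : ∀ S : Set W, S.Finite → S.Nonempty →
      ¬ ∀ e ∈ S, ∃ a ∈ S, ∃ b ∈ S, a ≠ b ∧ H.Adj e a ∧ H.Adj e b) : H.IsAcyclic := by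
  rw [isAcyclic_iff_free_cycleGraph]
  rintro n hn ⟨f⟩
  refine h (Set.range f) (Set.finite_range f) ⟨f ⟨0, by omega⟩, ⟨_, rfl⟩⟩ ?_
  rintro _ ⟨i, rfl⟩
  have hi := i.isLt
  refine ⟨_, ⟨(⟨if i.val + 1 = n then 0 else i.val + 1, by split <;> omega⟩ : Fin n), rfl⟩, _,
    ⟨(⟨if i.val = 0 then n - 1 else i.val - 1, by split <;> omega⟩ : Fin n), rfl⟩, ?_, ?_, ?_⟩
  · intro heq
    have := congrArg Fin.val (f.injective heq)
    simp only at this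
    split_ifs at this <;> omega
  · refine f.toHom.map_adj ?_
    rw [cycleGraph_adj_iff hn]
    simp only
    split_ifs <;> omega
  · refine f.toHom.map_adj ?_
    rw [cycleGraph_adj_iff hn]
    simp only
    split_ifs <;> omega

/-- A graph in which every vertex but the first has exactly one earlier neighbour is a tree. -/
theorem isTree_of_parent {W : Type*} {H : SimpleGraph W} {n : ℕ} (c : Fin (n + 1) → W)
    (hc : Function.Surjective c) (par : Fin (n + 1) → Fin (n + 1)) (hpar : ∀ i, i ≠ 0 → par i < i)
    (hadj : ∀ i, i ≠ 0 → H.Adj (c i) (c (par i)))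
    (huniq : ∀ i j, j ≤ i → H.Adj (c i) (c j) → j = par i) : H.IsTree := by
  have : Nonempty W := ⟨c 0⟩
  refine ⟨connected_iff_exists_forall_reachable _ |>.2 ⟨c 0, fun w => ?_⟩, ?_⟩
  · obtain ⟨i, rfl⟩ := hc w
    induction i using WellFoundedLT.induction with
    | ind i ih =>
      by_cases hi : i = 0
      · rw [hi]
      · exact (ih _ (hpar i hi)).trans (hadj i hi).symm.reachable
  · classical
    refine isAcyclic_of_no_core fun S _ ⟨e, he⟩ hS => ?_
    obtain ⟨i₀, rfl⟩ := hc e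
    let T := Finset.univ.filter fun i => c i ∈ S
    have hT : T.Nonempty := ⟨i₀, by simp [T, he]⟩
    have hi : c (T.max' hT) ∈ S := by simpa [T] using T.max'_mem hT
    have hmax : ∀ j, c j ∈ S → j ≤ T.max' hT := fun j hj => T.le_max' j (by simp [T, hj])
    obtain ⟨a, ha, b, hb, hne, h1, h2⟩ := hS _ hi
    obtain ⟨j, rfl⟩ := hc a
    obtain ⟨j', rfl⟩ := hc b
    exact hne (by rw [huniq _ _ (hmax j ha) h1, huniq _ _ (hmax j' hb) h2])

section GallaiAdj

variable {V : Type*} {G : SimpleGraph V}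

theorem gallaiGraph_adj {u v w : V} (huv : G.Adj u v) (hvw : G.Adj v w) (hne : u ≠ w)
    (hn : ¬ G.Adj u w) : (gallaiGraph G).Adj ⟨s(u, v), huv⟩ ⟨s(v, w), hvw⟩ :=
  ⟨u, v, w, hne, hn, rfl, rfl⟩

theorem gallaiGraph_adj_left {u v w : V} (huv : G.Adj v u) (hvw : G.Adj v w) (hne : u ≠ w)
    (hn : ¬ G.Adj u w) : (gallaiGraph G).Adj ⟨s(v, u), huv⟩ ⟨s(v, w), hvw⟩ :=
  ⟨u, v, w, hne, hn, Sym2.eq_swap, rfl⟩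

theorem gallaiGraph_adj_cases {u v : V} {h : G.Adj u v} {f : G.edgeSet}
    (hf : (gallaiGraph G).Adj ⟨s(u, v), h⟩ f) :
    (∃ w, (f : Sym2 V) = s(v, w) ∧ G.Adj v w ∧ w ≠ u ∧ ¬ G.Adj u w) ∨
      ∃ w, (f : Sym2 V) = s(u, w) ∧ G.Adj u w ∧ w ≠ v ∧ ¬ G.Adj v w := by
  obtain ⟨f, hfe⟩ := f
  obtain ⟨a, b, c, hne, hn, h1, h2⟩ := hf
  simp only at h1 h2
  subst h2
  rcases Sym2.eq_iff.1 h1 with ⟨rfl, rfl⟩ | ⟨rfl, rfl⟩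
  · exact Or.inl ⟨c, rfl, hfe, hne.symm, hn⟩
  · exact Or.inr ⟨c, rfl, hfe, hne.symm, hn⟩

/-- An isomorphism of graphs induces one of their Gallai graphs. -/
def gallaiGraphIso {W : Type*} {H : SimpleGraph W} (e : G ≃g H) :
    gallaiGraph G ≃g gallaiGraph H where
  toEquiv := e.mapEdgeSet
  map_rel_iff' := by
    rintro ⟨a, ha⟩ ⟨b, hb⟩
    constructor
    · rintro ⟨u, v, w, hne, hn, h1, h2⟩
      have inv : ∀ z : Sym2 V, Sym2.map e.symm (Sym2.map e z) = z := by
        intro z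
        rw [Sym2.map_map]
        convert congrFun Sym2.map_id' z
        · simp
        · rfl
      refine ⟨e.symm u, e.symm v, e.symm w, fun h => hne (e.symm.injective h),
        fun h => hn (e.symm.map_adj_iff.1 h), ?_, ?_⟩
      · have := congrArg (Sym2.map e.symm) (show Sym2.map e a = s(u, v) from h1)
        rwa [inv] at this
      · have := congrArg (Sym2.map e.symm) (show Sym2.map e b = s(v, w) from h2)
        rwa [inv] at this
    · rintro ⟨u, v, w, hne, hn, h1, h2⟩
      simp only at h1 h2
      subst h1 h2
      exact ⟨e u, e v, e w, fun h => hne (e.injective h), fun h => hn (e.map_adj_iff.1 h), rfl,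
        rfl⟩

end GallaiAdj

section ApexPath

variable {V : Type*} {G : SimpleGraph V} {k : ℕ} {p : ℕ → V}

theorem IsApexPath.reverse (h : IsApexPath G k p) : IsApexPath G k fun t => p (k - 1 - t) := by
  have hne : ∀ x, (∀ l < k, x ≠ p (k - 1 - l)) → ∀ l < k, x ≠ p l := by
    intro x hx l hl
    have := hx (k - 1 - l) (by omega)
    rwa [show k - 1 - (k - 1 - l) = l by omega] at this
  refine ⟨h.toIsIndPath.reverse, h.two_le, fun x hx => ?_, fun x hx w hxw => ?_,
    fun x y w hx hy => h.unique x y w (hne x hx) (hne y hy)⟩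
  · obtain ⟨i, s, hs, ht⟩ := h.exists_trace x (hne x hx)
    have hle := ht.le
    refine ⟨_, _, ?_, ht.reverse⟩
    rcases hs with ⟨rfl, hs⟩ | ⟨rfl, hs⟩
    · exact Or.inl (by omega)
    · exact Or.inr (by omega)
  · obtain ⟨l, hl, rfl⟩ := h.mem_path x (hne x hx) w hxw
    exact ⟨k - 1 - l, by omega, by rw [show k - 1 - (k - 1 - l) = l by omega]⟩

/-- The Gallai neighbours of an edge `x (p l)` at an outside vertex `x`. -/
theorem IsApexPath.adj_cases (h : IsApexPath G k p) {x : V} {i s l : ℕ}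
    (hx : HasTrace G k p x i s) (hl : l < k) {hxl : G.Adj x (p l)} {f : G.edgeSet}
    (hf : (gallaiGraph G).Adj ⟨s(x, p l), hxl⟩ f) :
    ∃ m < k, ((f : Sym2 V) = s(p l, p m) ∧ (l + 1 = m ∨ m + 1 = l) ∧ ¬ (i ≤ m ∧ m < i + s)) ∨
      ((f : Sym2 V) = s(x, p m) ∧ i ≤ m ∧ m < i + s ∧ (l + 2 ≤ m ∨ m + 2 ≤ l)) := by
  rcases gallaiGraph_adj_cases hf with ⟨w, hfw, hlw, hwx, hxw⟩ | ⟨w, hfw, hxw, hwl, hlw⟩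
  · have hw : ∃ m < k, w = p m := by
      by_contra! hcon
      exact hwx (h.unique w x (p l) hcon hx.ne hlw.symm hxl)
    obtain ⟨m, hm, rfl⟩ := hw
    refine ⟨m, hm, Or.inl ⟨hfw, (h.adj l m hl hm).1 hlw, fun hmi => hxw ((hx.adj m hm).2 hmi)⟩⟩
  · obtain ⟨m, hm, rfl⟩ := h.mem_path x hx.ne w hxw
    have h1 := (hx.adj m hm).1 hxw
    have h2 : m ≠ l := fun h => hwl (by rw [h])
    rw [h.adj l m hl hm] at hlw
    exact ⟨m, hm, Or.inr ⟨hfw, h1.1, h1.2, by omega⟩⟩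

/-- Every member of the set `S` of edges has two Gallai neighbours in `S`. -/
def HasTwo (G : SimpleGraph V) (S : Set G.edgeSet) : Prop :=
  ∀ e ∈ S, ∃ a ∈ S, ∃ b ∈ S, a ≠ b ∧ (gallaiGraph G).Adj e a ∧ (gallaiGraph G).Adj e b

/-- An edge all of whose Gallai neighbours in `S` are equal is not in `S`. -/
theorem HasTwo.not_mem {S : Set G.edgeSet} (hS : HasTwo G S) {e : G.edgeSet} {z : Sym2 V}
    (h : ∀ f ∈ S, (gallaiGraph G).Adj e f → (f : Sym2 V) = z) : e ∉ S := by
  intro he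
  obtain ⟨a, ha, b, hb, hne, hea, heb⟩ := hS e he
  exact hne (Subtype.ext ((h a ha hea).trans (h b hb heb).symm))

/-- An edge at the apex of a triangle is a leaf of the Gallai graph: its only neighbour is the next
edge of the path. -/
theorem IsApexPath.apex_not_mem (h : IsApexPath G k p) {S : Set G.edgeSet} (hS : HasTwo G S)
    {x : V} {i l : ℕ} (hi : 1 ≤ i) (hx : HasTrace G k p x i 2) (hl : l < k)
    (hxl : G.Adj x (p l)) : ⟨s(x, p l), hxl⟩ ∉ S := by
  have hli := (hx.adj l hl).1 hxl
  refine hS.not_mem (z := if l = i then s(p l, p (l - 1)) else s(p l, p (l + 1))) fun f _ hf => ?_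
  obtain ⟨m, hm, ⟨hfm, h1, h2⟩ | ⟨-, h1, h2, h3⟩⟩ := h.adj_cases hx hl hf
  · split_ifs with hl'
    · obtain rfl : m = l - 1 := by omega
      exact hfm
    · obtain rfl : m = l + 1 := by omega
      exact hfm
  · omega

/-- The edges at the hub `x` of a gem form the path `x p 2`, `x p 0`, `x p 3`, `x p 1` of the Gallai
graph, which is attached to its other vertices by the edge from `x p 3` to `p 3 p 4` only; so these
edges are eliminated one after the other. -/
theorem IsApexPath.hub_not_mem (h : IsApexPath G k p) {S : Set G.edgeSet} (hS : HasTwo G S)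
    {x : V} {l : ℕ} (hk : 5 ≤ k) (hx : HasTrace G k p x 0 4) (hl : l < k)
    (hxl : G.Adj x (p l)) : ⟨s(x, p l), hxl⟩ ∉ S := by
  have hli := (hx.adj l hl).1 hxl
  have hadj : ∀ m < 4, G.Adj x (p m) := fun m hm => (hx.adj m (by omega)).2 (by omega)
  have h2 : ⟨s(x, p 2), hadj 2 (by omega)⟩ ∉ S := by
    refine hS.not_mem (z := s(x, p 0)) fun f _ hf => ?_
    obtain ⟨m, hm, ⟨-, hm1, hm2⟩ | ⟨hfm, hm1, hm2, hm3⟩⟩ := h.adj_cases hx (by omega) hf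
    · omega
    · obtain rfl : m = 0 := by omega
      exact hfm
  have h1 : ⟨s(x, p 1), hadj 1 (by omega)⟩ ∉ S := by
    refine hS.not_mem (z := s(x, p 3)) fun f _ hf => ?_
    obtain ⟨m, hm, ⟨-, hm1, hm2⟩ | ⟨hfm, hm1, hm2, hm3⟩⟩ := h.adj_cases hx (by omega) hf
    · omega
    · obtain rfl : m = 3 := by omega
      exact hfm
  have h0 : ⟨s(x, p 0), hadj 0 (by omega)⟩ ∉ S := by
    refine hS.not_mem (z := s(x, p 3)) fun f hfS hf => ?_
    obtain ⟨m, hm, ⟨-, hm1, hm2⟩ | ⟨hfm, hm1, hm2, hm3⟩⟩ := h.adj_cases hx (by omega) hf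
    · omega
    · rcases (show m = 2 ∨ m = 3 by omega) with rfl | rfl
      · exact absurd ((Subtype.ext hfm : f = ⟨s(x, p 2), hadj 2 (by omega)⟩) ▸ hfS) h2
      · exact hfm
  have h3 : ⟨s(x, p 3), hadj 3 (by omega)⟩ ∉ S := by
    refine hS.not_mem (z := s(p 3, p 4)) fun f hfS hf => ?_
    obtain ⟨m, hm, ⟨hfm, hm1, hm2⟩ | ⟨hfm, hm1, hm2, hm3⟩⟩ := h.adj_cases hx (by omega) hf
    · obtain rfl : m = 4 := by omega
      exact hfm
    · rcases (show m = 0 ∨ m = 1 by omega) with rfl | rfl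
      · exact absurd ((Subtype.ext hfm : f = ⟨s(x, p 0), hadj 0 (by omega)⟩) ▸ hfS) h0
      · exact absurd ((Subtype.ext hfm : f = ⟨s(x, p 1), hadj 1 (by omega)⟩) ▸ hfS) h1
  rcases (show l = 0 ∨ l = 1 ∨ l = 2 ∨ l = 3 by omega) with rfl | rfl | rfl | rfl
  exacts [h0, h1, h2, h3]

theorem IsApexPath.outer_not_mem (h : IsApexPath G k p) {S : Set G.edgeSet} (hS : HasTwo G S)
    {x w : V} (hx : ∀ l < k, x ≠ p l) (hxw : G.Adj x w) : ⟨s(x, w), hxw⟩ ∉ S := by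
  obtain ⟨l, hl, rfl⟩ := h.mem_path x hx w hxw
  obtain ⟨i, s, hs, ht⟩ := h.exists_trace x hx
  rcases hs with ⟨rfl, hi⟩ | ⟨rfl, hk, rfl | hi⟩
  · exact h.apex_not_mem hS hi.1 ht hl hxw
  · exact h.hub_not_mem hS hk ht hl hxw
  · have ht' := ht.reverse
    rw [show k - i - 4 = 0 by omega] at ht'
    have hr : p (k - 1 - (k - 1 - l)) = p l := by rw [show k - 1 - (k - 1 - l) = l by omega]
    have := h.reverse.hub_not_mem hS hk ht' (l := k - 1 - l) (by omega)
      (show G.Adj x (p (k - 1 - (k - 1 - l))) by rwa [hr])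
    simpa only [hr] using this

/-- A set of edges with two Gallai neighbours each consists of edges of the path, and the last of
these has only one neighbour in the set. -/
theorem IsApexPath.isAcyclic (h : IsApexPath G k p) : (gallaiGraph G).IsAcyclic := by
  classical
  refine isAcyclic_of_no_core fun S _ hne hS => ?_
  change HasTwo G S at hS
  have hform : ∀ e ∈ S, ∃ l, l + 1 < k ∧ (e : Sym2 V) = s(p l, p (l + 1)) := by
    rintro ⟨e, he⟩ heS
    induction e with
    | h u v =>
      have hu : ∃ a < k, u = p a := by
        by_contra! hcon
        exact h.outer_not_mem hS hcon he heS
      have hv : ∃ b < k, v = p b := by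
        by_contra! hcon
        refine h.outer_not_mem hS hcon (G.adj_symm he) ?_
        simpa only [Sym2.eq_swap (a := v)] using heS
      obtain ⟨a, ha, rfl⟩ := hu
      obtain ⟨b, hb, rfl⟩ := hv
      rcases (h.adj a b ha hb).1 he with rfl | rfl
      · exact ⟨a, hb, rfl⟩
      · exact ⟨b, ha, Sym2.eq_swap⟩
  obtain ⟨e₀, he₀⟩ := hne
  -- the last edge of the path in `S` has at most one neighbour in `S`
  let P : ℕ → Prop := fun l => ∃ e ∈ S, l + 1 < k ∧ (e : Sym2 V) = s(p l, p (l + 1))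
  obtain ⟨l₀, hl₀, hel₀⟩ := hform e₀ he₀
  have hP : P (Nat.findGreatest P k) :=
    Nat.findGreatest_spec (m := l₀) (by omega) ⟨e₀, he₀, hl₀, hel₀⟩
  have hmax : ∀ m, P m → m ≤ Nat.findGreatest P k := by
    intro m hm
    refine Nat.le_findGreatest ?_ hm
    obtain ⟨_, _, h1, _⟩ := hm
    omega
  generalize Nat.findGreatest P k = l at hP hmax
  obtain ⟨⟨e, he⟩, heS, hl, hel⟩ := hP
  simp only at hel
  subst hel
  refine hS.not_mem (z := s(p (l - 1), p l)) (fun f hfS hf => ?_) heS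
  obtain ⟨m, hm, hfm⟩ := hform f hfS
  have hml := hmax m ⟨f, hfS, hm, hfm⟩
  have hmne : m ≠ l := by
    rintro rfl
    exact hf.ne (Subtype.ext hfm.symm)
  have : m + 1 = l := by
    rcases gallaiGraph_adj_cases hf with ⟨w, hfw, -⟩ | ⟨w, hfw, -⟩
    · have := Sym2.mem_mk_left (p (l + 1)) w
      rw [← hfw, hfm, Sym2.mem_iff, h.eq_iff _ _ (by omega) (by omega),
        h.eq_iff _ _ (by omega) (by omega)] at this
      omega
    · have := Sym2.mem_mk_left (p l) w
      rw [← hfw, hfm, Sym2.mem_iff, h.eq_iff _ _ (by omega) (by omega),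
        h.eq_iff _ _ (by omega) (by omega)] at this
      omega
  subst this
  exact hfm

/-- Every edge at a vertex of trace `p 0, …, p 3` is joined to `p 3 p 4` in the Gallai graph. The
statement leaves the edge of the path open so that it can be reversed. -/
theorem IsApexPath.hub_reachable (h : IsApexPath G k p) {x : V} {l : ℕ} (hk : 5 ≤ k)
    (hx : HasTrace G k p x 0 4) (hl : l < k) (hxl : G.Adj x (p l)) :
    ∃ m, ∃ hm : G.Adj (p m) (p (m + 1)), m + 1 < k ∧
      (gallaiGraph G).Reachable ⟨s(x, p l), hxl⟩ ⟨s(p m, p (m + 1)), hm⟩ := by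
  have hadj : ∀ m < 4, G.Adj x (p m) := fun m hm => (hx.adj m (by omega)).2 (by omega)
  have hli := (hx.adj l hl).1 hxl
  have h34 : G.Adj (p 3) (p 4) := (h.adj _ _ (by omega) (by omega)).2 (by omega)
  refine ⟨3, h34, by omega, ?_⟩
  have hjoin : ∀ a b (ha : a < 4) (hb : b < 4), a + 2 ≤ b →
      (gallaiGraph G).Adj ⟨s(x, p a), hadj a ha⟩ ⟨s(x, p b), hadj b hb⟩ := by
    intro a b ha hb hab
    refine gallaiGraph_adj_left (hadj a ha) (hadj b hb) ?_ ?_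
    · rw [ne_eq, h.eq_iff _ _ (by omega) (by omega)]; omega
    · rw [h.adj _ _ (by omega) (by omega)]; omega
  have h3 : (gallaiGraph G).Reachable ⟨s(x, p 3), hadj 3 (by omega)⟩ ⟨s(p 3, p 4), h34⟩ := by
    refine (gallaiGraph_adj _ _ (hx.ne 4 (by omega)) ?_).reachable
    rw [hx.adj _ (by omega)]; omega
  have h0 := (hjoin 0 3 (by omega) (by omega) (by omega)).reachable.trans h3
  rcases (show l = 0 ∨ l = 1 ∨ l = 2 ∨ l = 3 by omega) with rfl | rfl | rfl | rfl
  · exact h0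
  · exact (hjoin 1 3 (by omega) (by omega) (by omega)).reachable.trans h3
  · exact (hjoin 0 2 (by omega) (by omega) (by omega)).symm.reachable.trans h0
  · exact h3

/-- In the Gallai graph every edge is joined to an edge of the path. -/
theorem IsApexPath.exists_reachable (h : IsApexPath G k p) {u v : V} (huv : G.Adj u v) :
    ∃ m, ∃ hm : G.Adj (p m) (p (m + 1)), m + 1 < k ∧
      (gallaiGraph G).Reachable ⟨s(u, v), huv⟩ ⟨s(p m, p (m + 1)), hm⟩ := by
  -- an edge at an outside vertex
  have outer : ∀ x w, (∀ l < k, x ≠ p l) → ∀ hxw : G.Adj x w,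
      ∃ m, ∃ hm : G.Adj (p m) (p (m + 1)), m + 1 < k ∧
        (gallaiGraph G).Reachable ⟨s(x, w), hxw⟩ ⟨s(p m, p (m + 1)), hm⟩ := by
    intro x w hx hxw
    obtain ⟨l, hl, rfl⟩ := h.mem_path x hx w hxw
    obtain ⟨i, s, hs, ht⟩ := h.exists_trace x hx
    have hli := (ht.adj l hl).1 hxw
    rcases hs with ⟨rfl, hi⟩ | ⟨rfl, hk, rfl | hi⟩
    · rcases (show l = i ∨ l = i + 1 by omega) with rfl | rfl
      · obtain ⟨c, rfl⟩ : ∃ c, l = c + 1 := ⟨l - 1, by omega⟩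
        have hm : G.Adj (p c) (p (c + 1)) := (h.adj _ _ (by omega) (by omega)).2 (by omega)
        refine ⟨c, hm, by omega, (Adj.reachable ?_).symm⟩
        have := gallaiGraph_adj hm hxw.symm (ht.ne c (by omega)).symm
          (by rw [ht.adj' _ (by omega)]; omega)
        simpa only [Sym2.eq_swap (a := x)] using this
      · have hm : G.Adj (p (i + 1)) (p (i + 1 + 1)) :=
          (h.adj _ _ (by omega) (by omega)).2 (by omega)
        refine ⟨i + 1, hm, by omega, (gallaiGraph_adj hxw hm (ht.ne _ (by omega)) ?_).reachable⟩
        rw [ht.adj _ (by omega)]; omega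
    · exact h.hub_reachable hk ht hl hxw
    · have ht' := ht.reverse
      rw [show k - i - 4 = 0 by omega] at ht'
      have hr : p (k - 1 - (k - 1 - l)) = p l := by rw [show k - 1 - (k - 1 - l) = l by omega]
      obtain ⟨m, hm, hmk, hreach⟩ := h.reverse.hub_reachable hk ht' (l := k - 1 - l) (by omega)
        (show G.Adj x (p (k - 1 - (k - 1 - l))) by rwa [hr])
      have h1 : p (k - 1 - m) = p (k - 1 - (m + 1) + 1) := by
        rw [show k - 1 - (m + 1) + 1 = k - 1 - m by omega]
      refine ⟨k - 1 - (m + 1), ?_, by omega, ?_⟩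
      · rw [← h1]; exact hm.symm
      · simpa only [hr, h1, Sym2.eq_swap (b := p (k - 1 - (m + 1)))] using hreach
  by_cases hu : ∃ a < k, u = p a
  · by_cases hv : ∃ b < k, v = p b
    · obtain ⟨a, ha, rfl⟩ := hu
      obtain ⟨b, hb, rfl⟩ := hv
      rcases (h.adj a b ha hb).1 huv with rfl | rfl
      · exact ⟨a, huv, hb, Reachable.refl _⟩
      · refine ⟨b, huv.symm, ha, ?_⟩
        simp only [Sym2.eq_swap (a := p b)]
        exact Reachable.refl _
    · obtain ⟨m, hm, hmk, hreach⟩ := outer v u (fun l hl h => hv ⟨l, hl, h⟩) huv.symm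
      refine ⟨m, hm, hmk, ?_⟩
      simpa only [Sym2.eq_swap (a := v)] using hreach
  · exact outer u v (fun l hl h => hu ⟨l, hl, h⟩) huv

theorem IsApexPath.gallaiGraph_isTree (h : IsApexPath G k p) : (gallaiGraph G).IsTree := by
  have h2 := h.two_le
  have hedge : ∀ m, m + 1 < k → G.Adj (p m) (p (m + 1)) := fun m hm =>
    (h.adj _ _ (by omega) (by omega)).2 (by omega)
  have hpath : ∀ m (hm : m + 1 < k), (gallaiGraph G).Reachable
      ⟨s(p 0, p (0 + 1)), hedge 0 (by omega)⟩ ⟨s(p m, p (m + 1)), hedge m hm⟩ := by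
    intro m
    induction m with
    | zero => exact fun _ => Reachable.refl _
    | succ m ih =>
      intro hm
      refine (ih (by omega)).trans (gallaiGraph_adj _ _ ?_ ?_).reachable
      · rw [ne_eq, h.eq_iff _ _ (by omega) (by omega)]; omega
      · rw [h.adj _ _ (by omega) (by omega)]; omega
  refine ⟨connected_iff_exists_forall_reachable _ |>.2
    ⟨⟨s(p 0, p (0 + 1)), hedge 0 (by omega)⟩, ?_⟩, h.isAcyclic⟩
  rintro ⟨e, he⟩
  induction e with
  | h u v =>
    obtain ⟨m, hm, hmk, hreach⟩ := h.exists_reachable (show G.Adj u v from he)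
    exact (hpath m hmk).trans hreach.symm

end ApexPath

/-- The Gallai graph of `F8minus` is a tree, here with its nine vertices in breadth-first order. -/
theorem gallaiGraph_F8minus_isTree : (gallaiGraph F8minus).IsTree := by
  let a : Fin 9 → Fin 6 := ![0, 1, 1, 2, 5, 3, 4, 5, 4]
  let b : Fin 9 → Fin 6 := ![1, 2, 4, 3, 1, 4, 5, 0, 2]
  have hab : ∀ i, F8minus.Adj (a i) (b i) := by decide
  let c : Fin 9 → F8minus.edgeSet := fun i => ⟨s(a i, b i), hab i⟩
  let par : Fin 9 → Fin 9 := ![0, 0, 0, 1, 1, 2, 5, 6, 6]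
  have key : ∀ i j, j ≤ i → ((∃ u v w : Fin 6, u ≠ w ∧ ¬ F8minus.Adj u w ∧
      s(a i, b i) = s(u, v) ∧ s(a j, b j) = s(v, w)) ↔ i ≠ 0 ∧ j = par i) := by decide
  have hpar : ∀ i, i ≠ 0 → par i < i := by decide
  refine isTree_of_parent c ?_ par hpar (fun i hi => (key i _ (hpar i hi).le).2 ⟨hi, rfl⟩)
    fun i j hji hadj => ((key i j hji).1 hadj).2
  have hsurj : ∀ u v, F8minus.Adj u v → ∃ i, s(a i, b i) = s(u, v) := by decide
  rintro ⟨e, he⟩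
  induction e with
  | h u v =>
    obtain ⟨i, hi⟩ := hsurj u v he
    exact ⟨i, Subtype.ext hi⟩

/-! ### Biconnected sets and blocks -/

section Biconnected

variable {V : Type*} {G : SimpleGraph V}

/-- `a` and `b` are joined by a walk of `G` whose steps stay in `S`. -/
def JoinedIn (G : SimpleGraph V) (S : Set V) (a b : V) : Prop :=
  Relation.ReflTransGen (fun u v => G.Adj u v ∧ u ∈ S ∧ v ∈ S) a b

theorem JoinedIn.refl {S : Set V} (a : V) : JoinedIn G S a a := Relation.ReflTransGen.refl

theorem JoinedIn.trans {S : Set V} {a b c : V} (h : JoinedIn G S a b) (h' : JoinedIn G S b c) :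
    JoinedIn G S a c := Relation.ReflTransGen.trans h h'

theorem JoinedIn.symm {S : Set V} {a b : V} (h : JoinedIn G S a b) : JoinedIn G S b a := by
  have : Std.Symm fun u v => G.Adj u v ∧ u ∈ S ∧ v ∈ S := ⟨fun u v h => ⟨h.1.symm, h.2.2, h.2.1⟩⟩
  exact Relation.ReflTransGen.stdSymm.symm _ _ h

theorem JoinedIn.of_adj {S : Set V} {a b : V} (h : G.Adj a b) (ha : a ∈ S) (hb : b ∈ S) :
    JoinedIn G S a b := Relation.ReflTransGen.single ⟨h, ha, hb⟩

theorem JoinedIn.mono {S T : Set V} (hST : S ⊆ T) {a b : V} (h : JoinedIn G S a b) :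
    JoinedIn G T a b :=
  Relation.ReflTransGen.mono (fun _ _ h => ⟨h.1, hST h.2.1, hST h.2.2⟩) _ _ h

theorem JoinedIn.mem_of_closed {S L : Set V} {a b : V} (h : JoinedIn G S a b) (ha : a ∈ L)
    (hL : ∀ u v, u ∈ L → u ∈ S → v ∈ S → G.Adj u v → v ∈ L) : b ∈ L := by
  induction h with
  | refl => exact ha
  | tail _ hbc ih => exact hL _ _ ih hbc.2.1 hbc.2.2 hbc.1

theorem reachable_induce_iff {S : Set V} (a b : S) :
    (G.induce S).Reachable a b ↔ JoinedIn G S a b := by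
  rw [reachable_iff_reflTransGen]
  constructor
  · intro h
    exact Relation.ReflTransGen.lift (p := fun u v => G.Adj u v ∧ u ∈ S ∧ v ∈ S) Subtype.val
      (fun u v huv => ⟨huv, u.2, v.2⟩) _ _ h
  · intro h
    obtain ⟨a, ha⟩ := a
    obtain ⟨b, hb⟩ := b
    simp only at h
    induction h with
    | refl => exact Relation.ReflTransGen.refl
    | tail _ hbc ih => exact (ih hbc.2.1).tail hbc.1

theorem isCutVertex_iff {v : V} : IsCutVertex G v ↔
    ∃ x y, x ≠ v ∧ y ≠ v ∧ G.Reachable x y ∧ ¬ JoinedIn G ({v}ᶜ : Set V) x y := by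
  constructor
  · rintro ⟨x, y, h1, h2⟩
    exact ⟨x, y, x.2, y.2, h1, fun h => h2 ((reachable_induce_iff x y).2 h)⟩
  · rintro ⟨x, y, hx, hy, h1, h2⟩
    exact ⟨⟨x, hx⟩, ⟨y, hy⟩, h1, fun h => h2 ((reachable_induce_iff _ _).1 h)⟩

/-- Any two vertices of `S` are joined within `S`. -/
def IsJoined (G : SimpleGraph V) (S : Set V) : Prop := ∀ a ∈ S, ∀ b ∈ S, JoinedIn G S a b

theorem isJoined_of_base {S : Set V} {c : V} (h : ∀ a ∈ S, JoinedIn G S a c) : IsJoined G S :=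
  fun a ha b hb => (h a ha).trans (h b hb).symm

theorem IsJoined.insert_vertex {S : Set V} (h : IsJoined G S) {x u : V} (hu : u ∈ S)
    (hxu : G.Adj x u) :
    IsJoined G (insert x S) := by
  refine isJoined_of_base (c := u) ?_
  rintro a (rfl | ha)
  · exact JoinedIn.of_adj hxu (Set.mem_insert _ _) (Set.mem_insert_of_mem _ hu)
  · exact (h a ha u hu).mono (Set.subset_insert _ _)

theorem IsJoined.union {S T : Set V} (hS : IsJoined G S) (hT : IsJoined G T) {c : V} (hc : c ∈ S)
    (hc' : c ∈ T) : IsJoined G (S ∪ T) := by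
  refine isJoined_of_base (c := c) ?_
  rintro a (ha | ha)
  · exact (hS a ha c hc).mono Set.subset_union_left
  · exact (hT a ha c hc').mono Set.subset_union_right

/-- The set `W` induces a connected graph without cut-vertices. -/
structure IsBiconnected (G : SimpleGraph V) (W : Set V) : Prop where
  nonempty : W.Nonempty
  joined : IsJoined G W
  diff : ∀ t ∈ W, IsJoined G (W \ {t})

theorem IsBiconnected.diff' {W : Set V} (h : IsBiconnected G W) (t : V) : IsJoined G (W \ {t}) := by
  by_cases ht : t ∈ W
  · exact h.diff t ht
  · rw [Set.sdiff_singleton_eq_self ht]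
    exact h.joined

theorem isBiconnected_pair {a b : V} (h : G.Adj a b) : IsBiconnected G {a, b} := by
  have hj : ∀ S : Set V, S ⊆ {a, b} → IsJoined G S := by
    intro S hS x hx y hy
    rcases hS hx with rfl | rfl <;> rcases hS hy with rfl | rfl
    · exact JoinedIn.refl _
    · exact JoinedIn.of_adj h hx hy
    · exact JoinedIn.of_adj h.symm hx hy
    · exact JoinedIn.refl _
  exact ⟨⟨a, Or.inl rfl⟩, hj _ subset_rfl, fun t _ => hj _ Set.sdiff_subset⟩

/-- Adding a vertex with two neighbours keeps a set biconnected. -/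
theorem IsBiconnected.insert_vertex {W : Set V} (h : IsBiconnected G W) {x u v : V} (hu : u ∈ W)
    (hv : v ∈ W) (huv : u ≠ v) (hxu : G.Adj x u) (hxv : G.Adj x v) :
    IsBiconnected G (insert x W) := by
  by_cases hx : x ∈ W
  · rwa [Set.insert_eq_of_mem hx]
  refine ⟨⟨x, Set.mem_insert _ _⟩, h.joined.insert_vertex hu hxu, fun t _ => ?_⟩
  by_cases htx : x = t
  · subst htx
    have : insert x W \ {x} = W := by
      rw [Set.insert_sdiff_of_mem _ (Set.mem_singleton x), Set.sdiff_singleton_eq_self hx]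
    rw [this]
    exact h.joined
  · rw [Set.insert_sdiff_of_notMem _ (by simpa using htx)]
    by_cases htu : u = t
    · subst htu
      exact (h.diff' u).insert_vertex ⟨hv, by simpa using huv.symm⟩ hxv
    · exact (h.diff' t).insert_vertex ⟨hu, by simpa using htu⟩ hxu

theorem IsBiconnected.union {W W' : Set V} (h : IsBiconnected G W) (h' : IsBiconnected G W')
    {u v : V} (hu : u ∈ W) (hv : v ∈ W) (hu' : u ∈ W') (hv' : v ∈ W') (huv : u ≠ v) :
    IsBiconnected G (W ∪ W') := by
  refine ⟨h.nonempty.inl, h.joined.union h'.joined hu hu', fun t _ => ?_⟩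
  rw [Set.union_sdiff_distrib]
  by_cases htu : u = t
  · subst htu
    exact (h.diff' u).union (h'.diff' u) (c := v) ⟨hv, by simpa using huv.symm⟩
      ⟨hv', by simpa using huv.symm⟩
  · exact (h.diff' t).union (h'.diff' t) (c := u) ⟨hu, by simpa using htu⟩ ⟨hu', by simpa using htu⟩

/-- The vertex set of a cycle is biconnected. -/
theorem isBiconnected_cycle {n : ℕ} (hn : 3 ≤ n) (c : ℕ → V)
    (hinj : ∀ i j, i < n → j < n → c i = c j → i = j)
    (hadj : ∀ i, i + 1 < n → G.Adj (c i) (c (i + 1))) (hlast : G.Adj (c (n - 1)) (c 0)) :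
    IsBiconnected G {v | ∃ i < n, v = c i} := by
  -- consecutive vertices that lie in `S` are joined in `S`
  have seg : ∀ (S : Set V) a d, a + d < n → (∀ i, a ≤ i → i ≤ a + d → c i ∈ S) →
      JoinedIn G S (c a) (c (a + d)) := by
    intro S a d
    induction d with
    | zero => exact fun _ _ => JoinedIn.refl _
    | succ d ih =>
      intro hd hS
      exact (ih (by omega) fun i hi hi' => hS i hi (by omega)).trans
        (JoinedIn.of_adj (hadj (a + d) (by omega)) (hS _ (by omega) (by omega))
          (hS _ (by omega) (by omega)))
  have seg' : ∀ (S : Set V) a b, a ≤ b → b < n → (∀ i, a ≤ i → i ≤ b → c i ∈ S) →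
      JoinedIn G S (c a) (c b) := by
    intro S a b hab hb hS
    obtain ⟨d, rfl⟩ := Nat.exists_eq_add_of_le hab
    exact seg S a d hb hS
  refine ⟨⟨c 0, 0, by omega, rfl⟩, ?_, ?_⟩
  · refine isJoined_of_base (c := c 0) ?_
    rintro _ ⟨i, hi, rfl⟩
    exact (seg' {v | ∃ i < n, v = c i} 0 i (by omega) hi fun j _ hj => ⟨j, by omega, rfl⟩).symm
  · rintro _ ⟨t, ht, rfl⟩
    have hmem : ∀ i, i < n → i ≠ t → c i ∈ ({v | ∃ i < n, v = c i} \ {c t} : Set V) :=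
      fun i hi hit => ⟨⟨i, hi, rfl⟩, fun h => hit (hinj i t hi ht h)⟩
    rcases Nat.eq_zero_or_pos t with rfl | ht0
    · refine isJoined_of_base (c := c 1) ?_
      rintro _ ⟨⟨i, hi, rfl⟩, hit⟩
      have hi0 : i ≠ 0 := fun h => hit (by rw [h]; rfl)
      exact (seg' _ 1 i (by omega) hi fun j _ hj => hmem j (by omega) (by omega)).symm
    · refine isJoined_of_base (c := c 0) ?_
      rintro _ ⟨⟨i, hi, rfl⟩, hit⟩
      have hit' : i ≠ t := fun h => hit (by rw [h]; rfl)
      rcases Nat.lt_or_ge i t with h | h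
      · exact (seg' _ 0 i (by omega) hi fun j _ hj => hmem j (by omega) (by omega)).symm
      · refine (seg' _ i (n - 1) (by omega) (by omega)
          fun j _ hj => hmem j (by omega) (by omega)).trans ?_
        exact JoinedIn.of_adj hlast (hmem _ (by omega) (by omega)) (hmem _ (by omega) (by omega))

/-- The vertex sets of blocks: maximal biconnected sets. -/
abbrev IsBlockSet (G : SimpleGraph V) (W : Set V) : Prop := Maximal (IsBiconnected G) W

theorem IsBiconnected.exists_isBlockSet [Finite V] {W : Set V} (h : IsBiconnected G W) :
    ∃ W', W ⊆ W' ∧ IsBlockSet G W' :=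
  (Set.toFinite {W : Set V | IsBiconnected G W}).exists_le_maximal h

theorem IsBlockSet.subset_of_two {W W' : Set V} (hW : IsBlockSet G W) (hW' : IsBiconnected G W')
    {u v : V} (hu : u ∈ W) (hv : v ∈ W) (hu' : u ∈ W') (hv' : v ∈ W') (huv : u ≠ v) : W' ⊆ W :=
  Set.subset_union_right.trans
    (hW.2 (hW.1.union hW' hu hv hu' hv' huv) Set.subset_union_left)

theorem IsBlockSet.mem_of_adj_two {W : Set V} (hW : IsBlockSet G W) {x u v : V} (hu : u ∈ W)
    (hv : v ∈ W) (huv : u ≠ v) (hxu : G.Adj x u) (hxv : G.Adj x v) : x ∈ W :=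
  hW.2 (hW.1.insert_vertex hu hv huv hxu hxv) (Set.subset_insert _ _) (Set.mem_insert _ _)

/-- A connected subgraph without cut-vertices has a biconnected vertex set. -/
theorem isBiconnected_verts {H : G.Subgraph} (hc : H.Connected)
    (hcut : ∀ v : H.verts, ¬ IsCutVertex H.coe v) : IsBiconnected G H.verts := by
  have hreach : ∀ a b : H.verts, H.coe.Reachable a b := fun a b => hc.preconnected a b
  refine ⟨hc.nonempty, fun a ha b hb => ?_, fun t ht a ha b hb => ?_⟩
  · have := (reachable_iff_reflTransGen _ _).1 (hreach ⟨a, ha⟩ ⟨b, hb⟩)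
    exact Relation.ReflTransGen.lift (p := fun u v => G.Adj u v ∧ u ∈ H.verts ∧ v ∈ H.verts)
      Subtype.val (fun u v huv => ⟨H.adj_sub huv, u.2, v.2⟩) _ _ this
  · have h1 := hcut ⟨t, ht⟩
    rw [isCutVertex_iff] at h1
    push Not at h1
    have hat : (⟨a, ha.1⟩ : H.verts) ≠ ⟨t, ht⟩ := fun h => ha.2 (congrArg Subtype.val h)
    have hbt : (⟨b, hb.1⟩ : H.verts) ≠ ⟨t, ht⟩ := fun h => hb.2 (congrArg Subtype.val h)
    have h2 := h1 ⟨a, ha.1⟩ ⟨b, hb.1⟩ hat hbt (hreach _ _)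
    refine Relation.ReflTransGen.lift
      (p := fun u v => G.Adj u v ∧ u ∈ H.verts \ {t} ∧ v ∈ H.verts \ {t})
      Subtype.val (fun u v huv => ⟨H.adj_sub huv.1, ⟨u.2, fun h => huv.2.1 (Subtype.ext h)⟩,
        ⟨v.2, fun h => huv.2.2 (Subtype.ext h)⟩⟩) _ _ h2

theorem joinedIn_coe {W S : Set V} {a b : V} (h : JoinedIn G S a b) (hS : S ⊆ W) (ha : a ∈ W)
    (hb : b ∈ W) : JoinedIn ((⊤ : G.Subgraph).induce W).coe {x | (x : V) ∈ S} ⟨a, ha⟩ ⟨b, hb⟩ := by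
  induction h with
  | refl => exact JoinedIn.refl _
  | tail _ hbc ih =>
    refine (ih (hS hbc.2.1)).trans (JoinedIn.of_adj ?_ hbc.2.1 hbc.2.2)
    exact ⟨hS hbc.2.1, hS hbc.2.2, hbc.1⟩

theorem IsBiconnected.induce {W : Set V} (h : IsBiconnected G W) :
    ((⊤ : G.Subgraph).induce W).Connected ∧
      ∀ v : ((⊤ : G.Subgraph).induce W).verts,
        ¬ IsCutVertex ((⊤ : G.Subgraph).induce W).coe v := by
  constructor
  · rw [Subgraph.connected_iff]
    refine ⟨⟨fun ⟨a, ha⟩ ⟨b, hb⟩ => ?_⟩, h.nonempty⟩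
    rw [reachable_iff_reflTransGen]
    exact Relation.ReflTransGen.mono (fun _ _ h => h.1) _ _
      (joinedIn_coe (h.joined a ha b hb) subset_rfl ha hb)
  · rintro ⟨t, ht⟩ hcut
    obtain ⟨⟨x, hx⟩, ⟨y, hy⟩, hxt, hyt, -, hn⟩ := isCutVertex_iff.1 hcut
    refine hn ((joinedIn_coe (h.diff t ht x ⟨hx, fun h => hxt (Subtype.ext h)⟩ y
      ⟨hy, fun h => hyt (Subtype.ext h)⟩) Set.sdiff_subset hx hy).mono ?_)
    exact fun z hz h => hz.2 (congrArg Subtype.val h)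

theorem IsBlock.isBlockSet {B : G.Subgraph} (h : IsBlock G B) : IsBlockSet G B.verts := by
  refine ⟨isBiconnected_verts h.1.1 h.1.2, fun W hW hle => ?_⟩
  have : B ≤ (⊤ : G.Subgraph).induce W :=
    ⟨hle, fun a b hab => ⟨hle (B.edge_vert hab), hle (B.edge_vert hab.symm), B.adj_sub hab⟩⟩
  exact (h.2 hW.induce this).1

theorem IsBlock.adj_iff {B : G.Subgraph} (h : IsBlock G B) {a b : V} (ha : a ∈ B.verts)
    (hb : b ∈ B.verts) : B.Adj a b ↔ G.Adj a b := by
  refine ⟨fun hab => B.adj_sub hab, fun hab => ?_⟩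
  have : B ≤ (⊤ : G.Subgraph).induce B.verts :=
    ⟨subset_rfl, fun a b hab => ⟨B.edge_vert hab, B.edge_vert hab.symm, B.adj_sub hab⟩⟩
  exact (h.2 h.isBlockSet.1.induce this).2 ⟨ha, hb, hab⟩

theorem IsBlock.eq_of_verts {B B' : G.Subgraph} (h : IsBlock G B) (h' : IsBlock G B')
    (hv : B.verts = B'.verts) : B = B' := by
  refine Subgraph.ext hv ?_
  ext a b
  constructor
  · intro hab
    rw [h'.adj_iff (hv ▸ B.edge_vert hab) (hv ▸ B.edge_vert hab.symm)]
    exact B.adj_sub hab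
  · intro hab
    rw [h.adj_iff (hv ▸ B'.edge_vert hab) (hv ▸ B'.edge_vert hab.symm)]
    exact B'.adj_sub hab

theorem IsBlockSet.isBlock {W : Set V} (h : IsBlockSet G W) :
    IsBlock G ((⊤ : G.Subgraph).induce W) := by
  refine ⟨h.1.induce, fun H hH hle => ?_⟩
  have hsub : H.verts ⊆ W := h.2 (isBiconnected_verts hH.1 hH.2) hle.1
  exact ⟨hsub, fun a b hab => ⟨hsub (H.edge_vert hab), hsub (H.edge_vert hab.symm),
    H.adj_sub hab⟩⟩

/-- A block is isomorphic to `H` if and only if its vertex set is that of an induced copy of `H`. -/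
theorem IsBlock.nonempty_iso_iff {B : G.Subgraph} (h : IsBlock G B) {U : Type*}
    {H : SimpleGraph U} :
    Nonempty (B.coe ≃g H) ↔ ∃ g : H ↪g G, Set.range g = B.verts := by
  constructor
  · rintro ⟨e⟩
    refine ⟨⟨⟨fun i => (e.symm i : V), fun i j hij => e.symm.injective (Subtype.ext hij)⟩, ?_⟩, ?_⟩
    · intro i j
      change G.Adj (e.symm i : V) (e.symm j : V) ↔ _
      rw [← h.adj_iff (e.symm i).2 (e.symm j).2]
      exact e.symm.map_adj_iff
    · ext v
      constructor
      · rintro ⟨i, rfl⟩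
        exact (e.symm i).2
      · intro hv
        exact ⟨e ⟨v, hv⟩, congrArg Subtype.val (e.symm_apply_apply ⟨v, hv⟩)⟩
  · rintro ⟨g, hg⟩
    have hmem : ∀ i, g i ∈ B.verts := fun i => hg ▸ ⟨i, rfl⟩
    have hbij : Function.Bijective fun i : U => (⟨g i, hmem i⟩ : B.verts) := by
      refine ⟨fun i j hij => g.injective (congrArg Subtype.val hij), ?_⟩
      rintro ⟨v, hv⟩
      obtain ⟨i, rfl⟩ : v ∈ Set.range g := hg ▸ hv
      exact ⟨i, rfl⟩
    refine ⟨Iso.symm ⟨Equiv.ofBijective _ hbij, ?_⟩⟩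
    intro i j
    change B.Adj (g i) (g j) ↔ _
    rw [h.adj_iff (hmem i) (hmem j)]
    exact g.map_adj_iff

/-- A vertex of a biconnected set that contains all its neighbours is not a cut-vertex. -/
theorem IsBiconnected.exists_adj_of_isCutVertex {W : Set V} (h : IsBiconnected G W) {v : V}
    (hv : IsCutVertex G v) : ∃ y, y ∉ W ∧ G.Adj v y := by
  by_contra! hcon
  have hnb : ∀ y, G.Adj v y → y ∈ W := fun y hy => by
    by_contra hyW
    exact hcon y hyW hy
  obtain ⟨x, z, hx, hz, hreach, hn⟩ := isCutVertex_iff.1 hv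
  rw [reachable_iff_reflTransGen] at hreach
  -- the walk avoids `v`, or can be continued from any other vertex of `W` when it meets `v`
  have key : (z ≠ v → JoinedIn G ({v}ᶜ : Set V) x z) ∧
      (z = v → ∀ w ∈ W, w ≠ v → JoinedIn G ({v}ᶜ : Set V) x w) := by
    clear hz hn
    induction hreach with
    | refl => exact ⟨fun _ => JoinedIn.refl _, fun h => absurd h hx⟩
    | @tail a b _ hab ih =>
      refine ⟨fun hb => ?_, fun hb w hw hwv => ?_⟩
      · by_cases ha : a = v
        · subst ha
          exact ih.2 rfl b (hnb b hab) hb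
        · exact (ih.1 ha).trans (JoinedIn.of_adj hab ha hb)
      · subst hb
        have ha := G.ne_of_adj hab
        refine (ih.1 ha).trans ((h.diff' b a ⟨hnb a hab.symm, ha⟩ w ⟨hw, hwv⟩).mono ?_)
        exact fun y hy => hy.2
  exact hn (key.1 hz)

theorem IsBlockSet.exists_adj {W : Set V} (hW : IsBlockSet G W) {v y : V} (hv : v ∈ W)
    (hvy : G.Adj v y) : ∃ u ∈ W, G.Adj v u := by
  by_cases hy : y ∈ W
  · exact ⟨y, hy, hvy⟩
  obtain ⟨u, hu, huv⟩ : ∃ u ∈ W, u ≠ v := by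
    by_contra! hcon
    refine hy (hW.2 (isBiconnected_pair hvy) (fun u hu => Or.inl (hcon u hu)) (Or.inr rfl))
  rcases Relation.ReflTransGen.cases_head (hW.1.joined v hv u hu) with h | ⟨c, hc, -⟩
  · exact absurd h.symm huv
  · exact ⟨c, hc.2.2, hc.1⟩

/-- A vertex of a block with a neighbour outside the block is a cut-vertex: otherwise there would be
a cycle through this neighbour and an edge of the block. -/
theorem IsBlockSet.isCutVertex {W : Set V} (hW : IsBlockSet G W) {v y : V} (hv : v ∈ W)
    (hy : y ∉ W) (hvy : G.Adj v y) : IsCutVertex G v := by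
  by_contra hcut
  obtain ⟨u, hu, hvu⟩ := hW.exists_adj hv hvy
  have hyu : y ≠ u := fun h => hy (h ▸ hu)
  have hjoin : JoinedIn G ({v}ᶜ : Set V) y u := by
    by_contra hn
    exact hcut (isCutVertex_iff.2 ⟨y, u, hvy.ne', hvu.ne', hvy.symm.reachable.trans hvu.reachable,
      hn⟩)
  obtain ⟨q, hq⟩ := ((reachable_induce_iff ⟨y, hvy.ne'⟩ ⟨u, hvu.ne'⟩).2 hjoin).exists_isPath
  have hlen : 1 ≤ q.length := by
    by_contra h0
    exact hyu (congrArg Subtype.val (Walk.eq_of_length_eq_zero (p := q) (by omega)))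
  let c : ℕ → V := fun i => if i = 0 then v else (q.getVert (i - 1) : V)
  have hc := isBiconnected_cycle (G := G) (n := q.length + 2) (by omega) c ?_ ?_ ?_
  · refine hy (hW.subset_of_two hc hv hu ⟨0, by omega, rfl⟩ ⟨q.length + 1, by omega, ?_⟩ hvu.ne
      ⟨1, by omega, ?_⟩)
    · simp [c]
    · simp [c]
  · intro i j hi hj hij
    rcases i with _ | i <;> rcases j with _ | j
    · rfl
    · exact absurd hij.symm (q.getVert j).2
    · exact absurd hij (q.getVert i).2
    · have := hq.getVert_injOn (by simp; omega) (by simp; omega)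
        (Subtype.ext hij : q.getVert i = q.getVert j)
      omega
  · intro i hi
    rcases i with _ | i
    · simpa [c] using hvy
    · exact q.adj_getVert_succ (by omega)
  · simpa [c] using hvu.symm

end Biconnected

/-! ### Graphs satisfying the block conditions -/

theorem not_forall_mem_gem {V : Type*} {G : SimpleGraph V} {W : Set V} {g : gem ↪g G}
    (hg : Set.range g = W) {n : ℕ} (hn : 6 ≤ n) (f : Fin n → V)
    (hf : Function.Injective f) (hW : ∀ i, f i ∈ W) : False := by
  have : ∀ i, ∃ j, g j = f i := fun i => by
    have := hW i
    rwa [← hg] at this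
  choose r hr using this
  have hinj : Function.Injective r := fun i j hij => hf (by rw [← hr, ← hr, hij])
  have := Fintype.card_le_of_injective r hinj
  simp at this
  omega

section BlockConditions

variable {V : Type*} [Fintype V] {G : SimpleGraph V} [DecidableRel G.Adj]

theorem BlockConditions.degree_le (h : BlockConditions G) {v : V} (hv : IsCutVertex G v) :
    G.degree v ≤ 3 := (h.cutVertices v hv).2

theorem BlockConditions.no_four_neighbors (h : BlockConditions G) {v a b c d : V}
    (hv : IsCutVertex G v) (ha : G.Adj v a) (hb : G.Adj v b) (hc : G.Adj v c) (hd : G.Adj v d)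
    (hab : a ≠ b) (hac : a ≠ c) (had : a ≠ d) (hbc : b ≠ c) (hbd : b ≠ d) (hcd : c ≠ d) :
    False := by
  classical
  have h3 := h.degree_le hv
  have hsub : ({a, b, c, d} : Finset V) ⊆ G.neighborFinset v := by
    intro x hx
    simp only [Finset.mem_insert, Finset.mem_singleton] at hx
    rw [mem_neighborFinset]
    rcases hx with rfl | rfl | rfl | rfl <;> assumption
  have := Finset.card_le_card hsub
  rw [card_neighborFinset_eq_degree, Finset.card_insert_of_notMem (by simp [*]),
    Finset.card_insert_of_notMem (by simp [*]), Finset.card_pair hcd] at this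
  omega

theorem BlockConditions.exists_isBlockSet (_h : BlockConditions G) {a b : V} (hab : G.Adj a b) :
    ∃ W, IsBlockSet G W ∧ a ∈ W ∧ b ∈ W := by
  obtain ⟨W, hW, hW'⟩ := (isBiconnected_pair hab).exists_isBlockSet
  exact ⟨W, hW', hW (Or.inl rfl), hW (Or.inr rfl)⟩

/-- A block with two non-adjacent vertices is a gem, and only one of its vertices is a
cut-vertex. -/
theorem BlockConditions.exists_gem (h : BlockConditions G) {W : Set V} (hW : IsBlockSet G W)
    {a b : V} (ha : a ∈ W) (hb : b ∈ W) (hab : a ≠ b) (hn : ¬ G.Adj a b) :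
    ∃ g : gem ↪g G, Set.range g = W ∧
      ∃ c ∈ W, IsCutVertex G c ∧ ∀ v ∈ W, IsCutVertex G v → v = c := by
  have hB := hW.isBlock
  have hcomplete : ∀ n, ¬ Nonempty (((⊤ : G.Subgraph).induce W).coe ≃g completeGraph (Fin n)) := by
    rintro n he
    obtain ⟨g, hg⟩ := hB.nonempty_iso_iff.1 he
    obtain ⟨i, rfl⟩ : a ∈ Set.range g := hg ▸ ha
    obtain ⟨j, rfl⟩ : b ∈ Set.range g := hg ▸ hb
    exact hn (g.map_adj_iff.2 fun hij => hab (by rw [hij]))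
  rcases h.blocks _ hB with he | he | he
  · exact absurd he (hcomplete 2)
  · exact absurd he (hcomplete 3)
  · obtain ⟨g, hg⟩ := hB.nonempty_iso_iff.1 he
    obtain ⟨c, hc⟩ := Set.encard_eq_one.1 (h.gemBlocks _ hB he)
    have hmem : c ∈ cutVerticesIn G ((⊤ : G.Subgraph).induce W) := hc ▸ rfl
    refine ⟨g, hg, c, hmem.1, hmem.2, fun v hv hv' => ?_⟩
    have : v ∈ cutVerticesIn G ((⊤ : G.Subgraph).induce W) := ⟨hv, hv'⟩
    rwa [hc] at this

/-- A block that is complete and has three vertices is a triangle, with two cut-vertices. -/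
theorem BlockConditions.triangle (h : BlockConditions G) {W : Set V} (hW : IsBlockSet G W)
    {a b c : V} (ha : a ∈ W) (hb : b ∈ W) (hc : c ∈ W) (hab : a ≠ b) (hac : a ≠ c) (hbc : b ≠ c)
    (hcl : ∀ x ∈ W, ∀ y ∈ W, x ≠ y → G.Adj x y) :
    (cutVerticesIn G ((⊤ : G.Subgraph).induce W)).encard = 2 ∧ W = {a, b, c} := by
  have hB := hW.isBlock
  rcases h.blocks _ hB with he | he | he
  · obtain ⟨g, hg⟩ := hB.nonempty_iso_iff.1 he
    obtain ⟨i, rfl⟩ : a ∈ Set.range g := hg ▸ ha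
    obtain ⟨j, rfl⟩ : b ∈ Set.range g := hg ▸ hb
    obtain ⟨l, rfl⟩ : c ∈ Set.range g := hg ▸ hc
    have e1 : i ≠ j := fun h => hab (by rw [h])
    have e2 : i ≠ l := fun h => hac (by rw [h])
    have e3 : j ≠ l := fun h => hbc (by rw [h])
    omega
  · refine ⟨h.triangleBlocks _ hB he, ?_⟩
    obtain ⟨g, hg⟩ := hB.nonempty_iso_iff.1 he
    change Set.range g = W at hg
    obtain ⟨i, rfl⟩ : a ∈ Set.range g := hg ▸ ha
    obtain ⟨j, rfl⟩ : b ∈ Set.range g := hg ▸ hb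
    obtain ⟨l, rfl⟩ : c ∈ Set.range g := hg ▸ hc
    have e1 : i ≠ j := fun h => hab (by rw [h])
    have e2 : i ≠ l := fun h => hac (by rw [h])
    have e3 : j ≠ l := fun h => hbc (by rw [h])
    ext v
    constructor
    · intro hv
      obtain ⟨m, rfl⟩ : v ∈ Set.range g := hg ▸ hv
      rcases (show m = i ∨ m = j ∨ m = l by omega) with rfl | rfl | rfl <;> simp
    · rintro (rfl | rfl | rfl) <;> assumption
  · obtain ⟨g, hg⟩ := hB.nonempty_iso_iff.1 he
    change Set.range g = W at hg
    have := hcl (g 0) (hg ▸ ⟨0, rfl⟩) (g 2) (hg ▸ ⟨2, rfl⟩) (g.injective.ne (by decide))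
    rw [g.map_adj_iff] at this
    exact absurd this (by decide)


/-- A block with two non-adjacent vertices is a gem, so that no induced subgraph of order six or
more that is not complete lies in a block. -/
theorem BlockConditions.no_six (h : BlockConditions G) {W : Set V} (hW : IsBlockSet G W) {n : ℕ}
    (hn : 6 ≤ n) {F : SimpleGraph (Fin n)} (e : F ↪g G) (hmem : ∀ i, e i ∈ W) {i j : Fin n}
    (hij : i ≠ j) (hnij : ¬ F.Adj i j) : False := by
  obtain ⟨g, hg, -⟩ := h.exists_gem hW (hmem i) (hmem j) (e.injective.ne hij)
    (fun h' => hnij (e.map_adj_iff.1 h'))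
  exact not_forall_mem_gem hg hn e e.injective hmem

/-- A vertex with two neighbours in a block belongs to it. In this way a graph that arises from an
edge by adding vertices with two earlier neighbours is seen to lie in a single block. -/
theorem mem_block {V : Type*} {G : SimpleGraph V} {W : Set V} (hW : IsBlockSet G W) {n : ℕ}
    {F : SimpleGraph (Fin n)} (e : F ↪g G) (x u v : Fin n) (h : u ≠ v ∧ F.Adj x u ∧ F.Adj x v)
    (hu : e u ∈ W) (hv : e v ∈ W) : e x ∈ W :=
  hW.mem_of_adj_two hu hv (e.injective.ne h.1) (e.map_adj_iff.2 h.2.1) (e.map_adj_iff.2 h.2.2)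

/-- The centre of a claw is a cut-vertex, or it has its three neighbours in one block. In the first
case the claw meets at most two blocks, so that one of them is a gem with two edges of the claw, and
the centre has degree at least four. The second case is impossible as the gem is claw-free. -/
theorem BlockConditions.claw_free (h : BlockConditions G) : ¬ F1.IsIndContained G := by
  rintro ⟨e⟩
  have adj : ∀ i, i ≠ 3 → G.Adj (e 3) (e i) := fun i hi =>
    e.map_adj_iff.2 ((by decide : ∀ i : Fin 4, i ≠ 3 → F1.Adj 3 i) i hi)
  have nadj : ∀ i j, i ≠ 3 → j ≠ 3 → ¬ G.Adj (e i) (e j) := fun i j hi hj h' =>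
    (by decide : ∀ i j : Fin 4, i ≠ 3 → j ≠ 3 → ¬ F1.Adj i j) i j hi hj (e.map_adj_iff.1 h')
  by_cases hcut : IsCutVertex G (e 3)
  · -- two of the three edges at the cut-vertex lie in a common block
    have two : ∀ W, IsBlockSet G W → ∀ i j, i ≠ 3 → j ≠ 3 → i ≠ j → e 3 ∈ W → e i ∈ W →
        e j ∈ W → False := by
      intro W hW i j hi hj hij h3 hi' hj'
      obtain ⟨g, hg, -⟩ := h.exists_gem hW hi' hj' (e.injective.ne hij) (nadj i j hi hj)
      obtain ⟨y, hy, h3y⟩ := hW.1.exists_adj_of_isCutVertex hcut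
      obtain ⟨a, ha⟩ : e 3 ∈ Set.range g := hg ▸ h3
      obtain ⟨b, hb⟩ : e i ∈ Set.range g := hg ▸ hi'
      obtain ⟨c, hc⟩ : e j ∈ Set.range g := hg ▸ hj'
      have hab : gem.Adj a b := g.map_adj_iff.1 (by rw [ha, hb]; exact adj i hi)
      have hac : gem.Adj a c := g.map_adj_iff.1 (by rw [ha, hc]; exact adj j hj)
      have hbc : ¬ gem.Adj b c := fun h' => nadj i j hi hj (by
        rw [← hb, ← hc]; exact g.map_adj_iff.2 h')
      have hne : b ≠ c := by
        rintro rfl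
        exact hij (e.injective (hb.symm.trans hc))
      obtain ⟨d, hd, hdb, hdc⟩ := (by decide : ∀ a b c : Fin 5, gem.Adj a b → gem.Adj a c →
        ¬ gem.Adj b c → b ≠ c → ∃ d, gem.Adj a d ∧ d ≠ b ∧ d ≠ c) a b c hab hac hbc hne
      have hW' : ∀ l, g l ∈ W := fun l => hg ▸ ⟨l, rfl⟩
      have hyne : ∀ l, g l ≠ y := fun l hl => hy (hl ▸ hW' l)
      refine h.no_four_neighbors hcut (a := g b) (b := g c) (c := g d) (d := y) ?_ ?_ ?_ h3y
        (g.injective.ne hne) (g.injective.ne hdb.symm) (hyne b) (g.injective.ne hdc.symm)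
        (hyne c) (hyne d)
      · rw [← ha]; exact g.map_adj_iff.2 hab
      · rw [← ha]; exact g.map_adj_iff.2 hac
      · rw [← ha]; exact g.map_adj_iff.2 hd
    obtain ⟨W0, hW0, h03, h00⟩ := h.exists_isBlockSet (adj 0 (by decide))
    obtain ⟨W1, hW1, h13, h11⟩ := h.exists_isBlockSet (adj 1 (by decide))
    obtain ⟨W2, hW2, h23, h22⟩ := h.exists_isBlockSet (adj 2 (by decide))
    have n01 : W0 ≠ W1 := by
      rintro rfl
      exact two W0 hW0 0 1 (by decide) (by decide) (by decide) h03 h00 h11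
    have n02 : W0 ≠ W2 := by
      rintro rfl
      exact two W0 hW0 0 2 (by decide) (by decide) (by decide) h03 h00 h22
    have n12 : W1 ≠ W2 := by
      rintro rfl
      exact two W1 hW1 1 2 (by decide) (by decide) (by decide) h13 h11 h22
    have hle := (h.cutVertices _ hcut).1
    have hinj : ∀ W W' : Set V, (⊤ : G.Subgraph).induce W = (⊤ : G.Subgraph).induce W' → W = W' :=
      fun W W' h' => congrArg Subgraph.verts h'
    have hsub : ({(⊤ : G.Subgraph).induce W0, (⊤ : G.Subgraph).induce W1,
        (⊤ : G.Subgraph).induce W2} : Set G.Subgraph) ⊆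
        {B : G.Subgraph | IsBlock G B ∧ e 3 ∈ B.verts} := by
      rintro B (rfl | rfl | rfl)
      exacts [⟨hW0.isBlock, h03⟩, ⟨hW1.isBlock, h13⟩, ⟨hW2.isBlock, h23⟩]
    have h3 := (Set.encard_le_encard hsub).trans hle
    rw [Set.encard_insert_of_notMem, Set.encard_pair fun h' => n12 (hinj _ _ h')] at h3
    · exact absurd h3 (by decide)
    · rintro (h' | h')
      exacts [n01 (hinj _ _ h'), n02 (hinj _ _ h')]
  · obtain ⟨W, hW, h3, h0⟩ := h.exists_isBlockSet (adj 0 (by decide))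
    have hmem : ∀ i, e i ∈ W := by
      intro i
      by_cases hi : i = 3
      · rw [hi]; exact h3
      · by_contra hn
        exact hcut (hW.isCutVertex h3 hn (adj i hi))
    obtain ⟨g, hg, -⟩ := h.exists_gem hW (hmem 0) (hmem 1) (e.injective.ne (by decide))
      (nadj 0 1 (by decide) (by decide))
    have hr : ∀ i, ∃ j, g j = e i := fun i => by
      have := hmem i
      rwa [← hg] at this
    choose r hr using hr
    have hrinj : ∀ i j, i ≠ j → r i ≠ r j := fun i j hij h' => hij (e.injective (by
      rw [← hr, ← hr, h']))
    have hradj : ∀ i j, F1.Adj i j ↔ gem.Adj (r i) (r j) := fun i j => by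
      rw [← e.map_adj_iff, ← g.map_adj_iff, hr, hr]
    have key : ∀ a b : Fin 5, gem.Adj a b → ∀ c, gem.Adj a c → ¬ gem.Adj b c → b ≠ c →
      ∀ d, gem.Adj a d → b ≠ d → c ≠ d → gem.Adj b d ∨ gem.Adj c d := by decide
    rcases key (r 3) (r 0) ((hradj _ _).1 (by decide)) (r 1) ((hradj _ _).1 (by decide))
      (fun h' => absurd ((hradj _ _).2 h') (by decide)) (hrinj _ _ (by decide)) (r 2)
      ((hradj _ _).1 (by decide)) (hrinj _ _ (by decide)) (hrinj _ _ (by decide)) with h' | h'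
    · exact absurd ((hradj _ _).2 h') (by decide)
    · exact absurd ((hradj _ _).2 h') (by decide)

/-- An induced subgraph all of whose vertices lie in a block that is a gem is an induced subgraph of
the gem. -/
theorem exists_map_gem {V : Type*} {G : SimpleGraph V} {W : Set V} {g : gem ↪g G}
    (hg : Set.range g = W) {n : ℕ} (f : Fin n → V) (hf : ∀ i, f i ∈ W) :
    ∃ r : Fin n → Fin 5, (∀ i, g (r i) = f i) ∧ ∀ i j, gem.Adj (r i) (r j) ↔ G.Adj (f i) (f j) := by
  have hr : ∀ i, ∃ j, g j = f i := fun i => by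
    have := hf i
    rwa [← hg] at this
  choose r hr using hr
  exact ⟨r, hr, fun i j => by rw [← g.map_adj_iff, hr, hr]⟩

/-- The common vertex of the two triangles has degree at least four, so that it is no cut-vertex and
the butterfly lies in a single block. -/
theorem BlockConditions.butterfly_free (h : BlockConditions G) : ¬ F2.IsIndContained G := by
  rintro ⟨e⟩
  have adj : ∀ i, i ≠ 4 → G.Adj (e 4) (e i) := fun i hi =>
    e.map_adj_iff.2 ((by decide : ∀ i : Fin 5, i ≠ 4 → F2.Adj 4 i) i hi)
  have hcut : ¬ IsCutVertex G (e 4) := fun hcut =>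
    h.no_four_neighbors hcut (adj 0 (by decide)) (adj 1 (by decide)) (adj 2 (by decide))
      (adj 3 (by decide)) (e.injective.ne (by decide)) (e.injective.ne (by decide))
      (e.injective.ne (by decide)) (e.injective.ne (by decide)) (e.injective.ne (by decide))
      (e.injective.ne (by decide))
  obtain ⟨W, hW, h4, h0⟩ := h.exists_isBlockSet (adj 0 (by decide))
  have hmem : ∀ i, e i ∈ W := by
    intro i
    by_cases hi : i = 4
    · rw [hi]; exact h4
    · by_contra hn
      exact hcut (hW.isCutVertex h4 hn (adj i hi))
  obtain ⟨g, hg, -⟩ := h.exists_gem hW (hmem 0) (hmem 2) (e.injective.ne (by decide))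
    (fun h' => absurd (e.map_adj_iff.1 h') (by decide))
  obtain ⟨r, -, hr⟩ := exists_map_gem hg e hmem
  have hr' : ∀ i j, gem.Adj (r i) (r j) ↔ F2.Adj i j := fun i j => (hr i j).trans e.map_adj_iff
  have key : ∀ c x : Fin 5, gem.Adj c x → ∀ y, gem.Adj c y → gem.Adj x y → ∀ u, gem.Adj c u →
    ¬ gem.Adj x u → ¬ gem.Adj y u → ∀ v, gem.Adj c v → gem.Adj u v → ¬ gem.Adj x v →
    gem.Adj y v := by decide
  have := key (r 4) (r 0) (by rw [hr']; decide) (r 1) (by rw [hr']; decide) (by rw [hr']; decide)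
    (r 2) (by rw [hr']; decide) (by rw [hr']; decide) (by rw [hr']; decide) (r 3)
    (by rw [hr']; decide) (by rw [hr']; decide) (by rw [hr']; decide)
  rw [hr'] at this
  exact absurd this (by decide)

theorem BlockConditions.F3_free (h : BlockConditions G) : ¬ F3.IsIndContained G := by
  rintro ⟨e⟩
  obtain ⟨W, hW, h1, h2⟩ := h.exists_isBlockSet (e.map_adj_iff.2 (by decide : F3.Adj 1 2))
  have h4 := mem_block hW e 4 1 2 (by decide) h1 h2
  have h5 := mem_block hW e 5 1 2 (by decide) h1 h2
  have h0 := mem_block hW e 0 1 5 (by decide) h1 h5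
  have h3 := mem_block hW e 3 2 4 (by decide) h2 h4
  refine h.no_six hW (by norm_num) e (fun i => ?_) (by decide : (0 : Fin 6) ≠ 2) (by decide)
  fin_cases i <;> assumption

theorem BlockConditions.F5_free (h : BlockConditions G) : ¬ F5.IsIndContained G := by
  rintro ⟨e⟩
  obtain ⟨W, hW, h1, h3⟩ := h.exists_isBlockSet (e.map_adj_iff.2 (by decide : F5.Adj 1 3))
  have h4 := mem_block hW e 4 1 3 (by decide) h1 h3
  have h0 := mem_block hW e 0 1 3 (by decide) h1 h3
  have h2 := mem_block hW e 2 1 4 (by decide) h1 h4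
  have h5 := mem_block hW e 5 4 3 (by decide) h4 h3
  refine h.no_six hW (by norm_num) e (fun i => ?_) (by decide : (0 : Fin 6) ≠ 2) (by decide)
  fin_cases i <;> assumption

theorem BlockConditions.F8_free (h : BlockConditions G) : ¬ F8.IsIndContained G := by
  rintro ⟨e⟩
  obtain ⟨W, hW, h0, h4⟩ := h.exists_isBlockSet (e.map_adj_iff.2 (by decide : F8.Adj 0 4))
  have h1 := mem_block hW e 1 0 4 (by decide) h0 h4
  have h5 := mem_block hW e 5 4 1 (by decide) h4 h1
  have h2 := mem_block hW e 2 1 5 (by decide) h1 h5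
  have h6 := mem_block hW e 6 5 2 (by decide) h5 h2
  have h3 := mem_block hW e 3 2 6 (by decide) h2 h6
  refine h.no_six hW (by norm_num) e (fun i => ?_) (by decide : (0 : Fin 7) ≠ 2) (by decide)
  fin_cases i <;> assumption

theorem BlockConditions.F9_free (h : BlockConditions G) : ¬ F9.IsIndContained G := by
  rintro ⟨e⟩
  obtain ⟨W, hW, h0, h3⟩ := h.exists_isBlockSet (e.map_adj_iff.2 (by decide : F9.Adj 0 3))
  have h1 := mem_block hW e 1 0 3 (by decide) h0 h3
  have h4 := mem_block hW e 4 3 1 (by decide) h3 h1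
  have h2 := mem_block hW e 2 1 4 (by decide) h1 h4
  have h5 := mem_block hW e 5 4 2 (by decide) h4 h2
  have h6 := mem_block hW e 6 1 2 (by decide) h1 h2
  refine h.no_six hW (by norm_num) e (fun i => ?_) (by decide : (0 : Fin 7) ≠ 2) (by decide)
  fin_cases i <;> assumption

/-- The three vertices of the triangle would be cut-vertices if the triangle was a block. In a gem
at most one of them is a cut-vertex, so that two of the pendant edges lie in the gem. -/
theorem BlockConditions.F4_free (h : BlockConditions G) : ¬ F4.IsIndContained G := by
  rintro ⟨e⟩
  have hadj : ∀ i j, G.Adj (e i) (e j) ↔ F4.Adj i j := fun i j => e.map_adj_iff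
  have hne : ∀ i j, i ≠ j → e i ≠ e j := fun i j hij => e.injective.ne hij
  obtain ⟨W, hW, h1, h2⟩ := h.exists_isBlockSet (e.map_adj_iff.2 (by decide : F4.Adj 1 2))
  have h4 := mem_block hW e 4 1 2 (by decide) h1 h2
  by_cases hcl : ∀ x ∈ W, ∀ y ∈ W, x ≠ y → G.Adj x y
  · -- all three vertices of the triangle are cut-vertices
    obtain ⟨hcard, hWeq⟩ := h.triangle hW h1 h2 h4 (hne _ _ (by decide)) (hne _ _ (by decide))
      (hne _ _ (by decide)) hcl
    have hcut : ∀ i ∈ ({1, 2, 4} : Finset (Fin 6)), IsCutVertex G (e i) := by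
      have hout : ∀ j, j ∉ ({1, 2, 4} : Finset (Fin 6)) → e j ∉ W := by
        intro j hj hjW
        rw [hWeq] at hjW
        simp only [Set.mem_insert_iff, Set.mem_singleton_iff, e.injective.eq_iff] at hjW
        simp only [Finset.mem_insert, Finset.mem_singleton] at hj
        exact hj hjW
      intro i hi
      simp only [Finset.mem_insert, Finset.mem_singleton] at hi
      rcases hi with rfl | rfl | rfl
      · exact hW.isCutVertex h1 (hout 0 (by decide)) ((hadj 1 0).2 (by decide))
      · exact hW.isCutVertex h2 (hout 3 (by decide)) ((hadj 2 3).2 (by decide))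
      · exact hW.isCutVertex h4 (hout 5 (by decide)) ((hadj 4 5).2 (by decide))
    have hsub : ({e 1, e 2, e 4} : Set V) ⊆ cutVerticesIn G ((⊤ : G.Subgraph).induce W) := by
      rintro v (rfl | rfl | rfl)
      exacts [⟨h1, hcut 1 (by decide)⟩, ⟨h2, hcut 2 (by decide)⟩, ⟨h4, hcut 4 (by decide)⟩]
    have h3 := (Set.encard_le_encard hsub).trans hcard.le
    rw [Set.encard_insert_of_notMem, Set.encard_pair (hne _ _ (by decide))] at h3
    · exact absurd h3 (by decide)
    · rintro (h' | h')
      exacts [hne 1 2 (by decide) h', hne 1 4 (by decide) h']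
  · push Not at hcl
    obtain ⟨x, hx, y, hy, hxy, hnxy⟩ := hcl
    obtain ⟨g, hg, c, -, -, hc⟩ := h.exists_gem hW hx hy hxy hnxy
    -- two of the pendant vertices lie in the gem
    have bull : ∀ a b c a' b', e a ∈ W → e b ∈ W → e c ∈ W → e a' ∈ W → e b' ∈ W →
        (F4.Adj a b ∧ F4.Adj a c ∧ F4.Adj b c ∧ F4.Adj a a' ∧ F4.Adj b b' ∧ ¬ F4.Adj a' b ∧
          ¬ F4.Adj a' c ∧ ¬ F4.Adj a b' ∧ ¬ F4.Adj b' c ∧ ¬ F4.Adj a' b') → False := by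
      intro a b c a' b' ha hb hc ha' hb' hF
      obtain ⟨r, -, hr⟩ := exists_map_gem hg ![e a, e b, e c, e a', e b']
        (by intro i; fin_cases i <;> assumption)
      have key : ∀ a b : Fin 5, gem.Adj a b → ∀ c, gem.Adj a c ∧ gem.Adj b c → ∀ a',
        gem.Adj a a' ∧ ¬ gem.Adj a' b ∧ ¬ gem.Adj a' c → ∀ b', gem.Adj b b' ∧ ¬ gem.Adj a b' ∧
        ¬ gem.Adj b' c → gem.Adj a' b' := by decide
      have hrF : ∀ i j : Fin 5, gem.Adj (r i) (r j) ↔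
          F4.Adj (![a, b, c, a', b'] i) (![a, b, c, a', b'] j) := fun i j => by
        rw [hr, ← hadj]
        fin_cases i <;> fin_cases j <;> rfl
      have := key (r 0) (r 1) ((hrF _ _).2 hF.1) (r 2)
        ⟨(hrF _ _).2 hF.2.1, (hrF _ _).2 hF.2.2.1⟩ (r 3)
        ⟨(hrF _ _).2 hF.2.2.2.1, fun h' => hF.2.2.2.2.2.1 ((hrF _ _).1 h'),
          fun h' => hF.2.2.2.2.2.2.1 ((hrF _ _).1 h')⟩ (r 4)
        ⟨(hrF _ _).2 hF.2.2.2.2.1, fun h' => hF.2.2.2.2.2.2.2.1 ((hrF _ _).1 h'),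
          fun h' => hF.2.2.2.2.2.2.2.2.1 ((hrF _ _).1 h')⟩
      exact hF.2.2.2.2.2.2.2.2.2 ((hrF _ _).1 this)
    have one : ∀ i j i' j', e i ∈ W → e j ∈ W → F4.Adj i i' → F4.Adj j j' → i ≠ j →
        e i' ∈ W ∨ e j' ∈ W := by
      intro i j i' j' hi hj hii hjj hij
      by_contra! hcon
      refine hne i j hij ?_
      rw [hc _ hi (hW.isCutVertex hi hcon.1 ((hadj _ _).2 hii)),
        hc _ hj (hW.isCutVertex hj hcon.2 ((hadj _ _).2 hjj))]
    rcases one 1 2 0 3 h1 h2 (by decide) (by decide) (by decide) with h0 | h3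
    · rcases one 2 4 3 5 h2 h4 (by decide) (by decide) (by decide) with h3 | h5
      · exact bull 1 2 4 0 3 h1 h2 h4 h0 h3 (by decide)
      · exact bull 1 4 2 0 5 h1 h4 h2 h0 h5 (by decide)
    · rcases one 1 4 0 5 h1 h4 (by decide) (by decide) (by decide) with h0 | h5
      · exact bull 1 2 4 0 3 h1 h2 h4 h0 h3 (by decide)
      · exact bull 2 4 1 3 5 h2 h4 h1 h3 h5 (by decide)

/-- The vertices other than the ends of the path lie in a gem, which has only one cut-vertex, so
that one of these ends belongs to the gem as well. -/
theorem BlockConditions.F6_free (h : BlockConditions G) : ¬ F6.IsIndContained G := by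
  rintro ⟨e⟩
  have hadj : ∀ i j, G.Adj (e i) (e j) ↔ F6.Adj i j := fun i j => e.map_adj_iff
  obtain ⟨W, hW, h1, h2⟩ := h.exists_isBlockSet (e.map_adj_iff.2 (by decide : F6.Adj 1 2))
  have h5 := mem_block hW e 5 1 2 (by decide) h1 h2
  have h3 := mem_block hW e 3 2 5 (by decide) h2 h5
  obtain ⟨g, hg, c, -, -, hc⟩ := h.exists_gem hW h1 h3 (e.injective.ne (by decide))
    (fun h' => absurd ((hadj _ _).1 h') (by decide))
  -- one of the ends of the path lies in the gem
  have one : e 0 ∈ W ∨ e 4 ∈ W := by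
    by_contra! hcon
    refine e.injective.ne (by decide : (1 : Fin 6) ≠ 3) ?_
    rw [hc _ h1 (hW.isCutVertex h1 hcon.1 ((hadj _ _).2 (by decide))),
      hc _ h3 (hW.isCutVertex h3 hcon.2 ((hadj _ _).2 (by decide)))]
  have pend : ∀ i j l, e i ∈ W → e j ∈ W → e l ∈ W → (F6.Adj i j ∧ ¬ F6.Adj i l ∧ ¬ F6.Adj i 2 ∧
      ¬ F6.Adj i 5 ∧ F6.Adj j 2 ∧ F6.Adj j 5 ∧ F6.Adj l 2 ∧ F6.Adj l 5 ∧ F6.Adj 2 5 ∧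
      ¬ F6.Adj j l ∧ j ≠ l) → False := by
    intro i j l hi hj hl hF
    obtain ⟨r, hr0, hr⟩ := exists_map_gem hg ![e i, e j, e l, e 2, e 5]
      (by intro i; fin_cases i <;> assumption)
    have key : ∀ i j : Fin 5, gem.Adj i j → ∀ b, gem.Adj j b → ¬ gem.Adj i b → ∀ c, gem.Adj j c →
      gem.Adj b c → ¬ gem.Adj i c → ∀ l, gem.Adj l b → gem.Adj l c → ¬ gem.Adj j l → j ≠ l →
      gem.Adj i l := by decide
    refine hF.2.1 ((hadj _ _).1 ((hr 0 2).1 (key (r 0) (r 1) ((hr _ _).2 ((hadj _ _).2 hF.1)) (r 3)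
      ((hr _ _).2 ((hadj _ _).2 hF.2.2.2.2.1)) (fun h' => hF.2.2.1 ((hadj _ _).1 ((hr _ _).1 h')))
      (r 4) ((hr _ _).2 ((hadj _ _).2 hF.2.2.2.2.2.1))
      ((hr _ _).2 ((hadj _ _).2 hF.2.2.2.2.2.2.2.2.1))
      (fun h' => hF.2.2.2.1 ((hadj _ _).1 ((hr _ _).1 h'))) (r 2)
      ((hr _ _).2 ((hadj _ _).2 hF.2.2.2.2.2.2.1)) ((hr _ _).2 ((hadj _ _).2 hF.2.2.2.2.2.2.2.1))
      (fun h' => hF.2.2.2.2.2.2.2.2.2.1 ((hadj _ _).1 ((hr _ _).1 h'))) ?_)))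
    intro h'
    exact hF.2.2.2.2.2.2.2.2.2.2 (e.injective ((hr0 1).symm.trans ((congrArg g h').trans (hr0 2))))
  rcases one with h0 | h4
  · exact pend 0 1 3 h0 h1 h3 (by decide)
  · exact pend 4 3 1 h4 h3 h1 (by decide)

/-- The vertices other than the ends of the path form a gem, with two cut-vertices. -/
theorem BlockConditions.F7_free (h : BlockConditions G) : ¬ F7.IsIndContained G := by
  rintro ⟨e⟩
  have hadj : ∀ i j, G.Adj (e i) (e j) ↔ F7.Adj i j := fun i j => e.map_adj_iff
  obtain ⟨W, hW, h1, h2⟩ := h.exists_isBlockSet (e.map_adj_iff.2 (by decide : F7.Adj 1 2))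
  have h6 := mem_block hW e 6 1 2 (by decide) h1 h2
  have h3 := mem_block hW e 3 2 6 (by decide) h2 h6
  have h4 := mem_block hW e 4 3 6 (by decide) h3 h6
  obtain ⟨g, hg, c, -, -, hc⟩ := h.exists_gem hW h1 h3 (e.injective.ne (by decide))
    (fun h' => absurd ((hadj _ _).1 h') (by decide))
  have out : ∀ i, i = 0 ∨ i = 5 → e i ∉ W := by
    intro i hi hiW
    refine not_forall_mem_gem hg le_rfl (fun j : Fin 6 => e (![1, 2, 3, 4, 6, i] j))
      (fun j l hjl => ?_) (fun j => by fin_cases j <;> assumption)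
    have h' := e.injective hjl
    rcases hi with rfl | rfl
    · exact (by decide : ∀ j l : Fin 6, (![1, 2, 3, 4, 6, 0] : Fin 6 → Fin 7) j =
        (![1, 2, 3, 4, 6, 0] : Fin 6 → Fin 7) l → j = l) j l h'
    · exact (by decide : ∀ j l : Fin 6, (![1, 2, 3, 4, 6, 5] : Fin 6 → Fin 7) j =
        (![1, 2, 3, 4, 6, 5] : Fin 6 → Fin 7) l → j = l) j l h'
  refine e.injective.ne (by decide : (1 : Fin 7) ≠ 4) ?_
  rw [hc _ h1 (hW.isCutVertex h1 (out 0 (by decide)) ((hadj _ _).2 (by decide))),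
    hc _ h4 (hW.isCutVertex h4 (out 5 (by decide)) ((hadj _ _).2 (by decide)))]

/-- A cycle lies in a block, and the gem is chordal. -/
theorem BlockConditions.isChordal (h : BlockConditions G) : IsChordal G := by
  rintro n hn ⟨e⟩
  let c : ℕ → V := fun i => if hi : i < n then e ⟨i, hi⟩ else e ⟨0, by omega⟩
  have hc : ∀ i (hi : i < n), c i = e ⟨i, hi⟩ := fun i hi => dif_pos hi
  have hadj : ∀ i j (hi : i < n) (hj : j < n), G.Adj (c i) (c j) ↔
      i + 1 = j ∨ j + 1 = i ∨ (i = 0 ∧ j + 1 = n) ∨ (j = 0 ∧ i + 1 = n) := by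
    intro i j hi hj
    rw [hc i hi, hc j hj, e.map_adj_iff, cycleGraph_adj_iff (by omega)]
  have hinj : ∀ i j, i < n → j < n → c i = c j → i = j := by
    intro i j hi hj hij
    rw [hc i hi, hc j hj] at hij
    exact congrArg Fin.val (e.injective hij)
  have hbi := isBiconnected_cycle (G := G) (n := n) (by omega) c hinj
    (fun i hi => (hadj i (i + 1) (by omega) hi).2 (by omega))
    ((hadj (n - 1) 0 (by omega) (by omega)).2 (by omega))
  obtain ⟨W, hsub, hW⟩ := hbi.exists_isBlockSet
  have hmem : ∀ i < n, c i ∈ W := fun i hi => hsub ⟨i, hi, rfl⟩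
  obtain ⟨g, hg, -⟩ := h.exists_gem hW (hmem 0 (by omega)) (hmem 2 (by omega))
    (fun h' => absurd (hinj 0 2 (by omega) (by omega) h') (by omega))
    (by rw [hadj _ _ (by omega) (by omega)]; omega)
  obtain ⟨r, hr0, hr⟩ := exists_map_gem hg (fun i : Fin n => c i) (fun i => hmem i i.isLt)
  have hrinj : ∀ i j, r i = r j → i = j := by
    intro i j hij
    have := hinj i j i.isLt j.isLt (by rw [← hr0, ← hr0, hij])
    exact Fin.ext this
  have hn5 : n ≤ 5 := by
    simpa using Fintype.card_le_of_injective r hrinj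
  have hr' : ∀ i j, gem.Adj (r i) (r j) ↔ i.val + 1 = j.val ∨ j.val + 1 = i.val ∨
      (i.val = 0 ∧ j.val + 1 = n) ∨ (j.val = 0 ∧ i.val + 1 = n) :=
    fun i j => (hr i j).trans (hadj i j i.isLt j.isLt)
  have key : ∀ a b : Fin 5, gem.Adj a b → ∀ c, gem.Adj b c → ¬ gem.Adj a c → a ≠ c →
    ∀ d, gem.Adj c d → ¬ gem.Adj b d → b ≠ d → ¬ gem.Adj a d ∧
      ∀ f, gem.Adj d f → gem.Adj f a → gem.Adj f b ∨ gem.Adj f c := by decide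
  have k1 := key (r ⟨0, by omega⟩) (r ⟨1, by omega⟩) (by rw [hr']; simp) (r ⟨2, by omega⟩)
    (by rw [hr']; simp) (by rw [hr']; simp; omega) (fun h' => by simpa using hrinj _ _ h')
    (r ⟨3, by omega⟩) (by rw [hr']; simp) (by rw [hr']; simp)
    (fun h' => by simpa using hrinj _ _ h')
  rcases (show n = 4 ∨ n = 5 by omega) with rfl | rfl
  · exact k1.1 ((hr' _ _).2 (by simp))
  · have := k1.2 (r ⟨4, by omega⟩) ((hr' _ _).2 (by simp)) ((hr' _ _).2 (by simp))
    rw [hr', hr'] at this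
    simp at this

theorem BlockConditions.forbiddenFree (h : BlockConditions G) : ForbiddenFree G :=
  ⟨h.claw_free, h.butterfly_free, h.F3_free, h.F4_free, h.F5_free, h.F6_free, h.F7_free, h.F8_free,
    h.F9_free⟩

/-- The only homogeneous sets of the gem with an edge are the four vertices of its path and the
whole vertex set. -/
theorem gem_homogeneous (S : Fin 5 → Prop)
    (hS : ∀ x, ¬ S x → (∀ u, S u → gem.Adj x u) ∨ (∀ u, S u → ¬ gem.Adj x u)) {i j : Fin 5}
    (hi : S i) (hj : S j) (hij : gem.Adj i j) (l : Fin 5) (hl : l ≠ 4) : S l := by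
  have key : ∀ T : Finset (Fin 5),
      (∀ x, x ∈ T ∨ (∀ u, u ∈ T → gem.Adj x u) ∨ (∀ u, u ∈ T → ¬ gem.Adj x u)) →
      ∀ i j, i ∈ T ∧ j ∈ T ∧ gem.Adj i j → ∀ l, l = 4 ∨ l ∈ T := by decide
  classical
  have hmem : ∀ x, x ∈ Finset.univ.filter S ↔ S x := by simp
  have := key (Finset.univ.filter S) (fun x => ?_) i j ⟨(hmem i).2 hi, (hmem j).2 hj, hij⟩ l
  · exact (hmem l).1 (this.resolve_left hl)
  · by_cases hx : S x
    · exact Or.inl ((hmem x).2 hx)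
    · rcases hS x hx with h | h
      · exact Or.inr (Or.inl fun u hu => h u ((hmem u).1 hu))
      · exact Or.inr (Or.inr fun u hu => h u ((hmem u).1 hu))

theorem BlockConditions.isIndepSet (h : BlockConditions G) (U : Set V)
    (hU : IsNontrivialHomogeneous G U) : G.IsIndepSet U := by
  intro u hu v hv _ huv
  obtain ⟨c, hc⟩ : ∃ c, c ∉ U := by
    by_contra! hcon
    apply hU.2.2.2
    rw [Set.eq_univ_of_forall hcon, Set.ncard_univ]
  obtain ⟨a, w, ha, hw, haw⟩ := exists_boundary_adj h.connected.preconnected hu hc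
  have hwU : ∀ b ∈ U, G.Adj w b := by
    rcases hU.1 w hw with h' | h'
    · exact h'
    · exact absurd haw.symm (h' a ha)
  obtain ⟨W, hW, huW, hvW⟩ := h.exists_isBlockSet huv
  have hwW := hW.mem_of_adj_two huW hvW huv.ne (hwU u hu) (hwU v hv)
  -- a cut-vertex in `U` would have a neighbour outside the block that is in the block
  have hcut : ∀ x ∈ U, x ∈ W → ¬ IsCutVertex G x := by
    intro x hx hxW hxc
    obtain ⟨y, hy, hxy⟩ := hW.1.exists_adj_of_isCutVertex hxc
    by_cases hyU : y ∈ U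
    · exact hy (hW.mem_of_adj_two hxW hwW (fun h' => hw (h' ▸ hx)) hxy.symm (hwU y hyU).symm)
    · rcases hU.1 y hyU with h' | h'
      · exact hy (hW.mem_of_adj_two huW hvW huv.ne (h' u hu) (h' v hv))
      · exact h' x hx hxy.symm
  have hwu : w ≠ u := fun h' => hw (h' ▸ hu)
  have hwv : w ≠ v := fun h' => hw (h' ▸ hv)
  by_cases hcl : ∀ x ∈ W, ∀ y ∈ W, x ≠ y → G.Adj x y
  · obtain ⟨hcard, hWeq⟩ := h.triangle hW huW hvW hwW huv.ne hwu.symm hwv.symm hcl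
    have hsub : cutVerticesIn G ((⊤ : G.Subgraph).induce W) ⊆ {w} := by
      rintro x ⟨hxW, hxc⟩
      change x ∈ W at hxW
      rw [hWeq] at hxW
      rcases hxW with rfl | rfl | rfl
      · exact absurd hxc (hcut x hu huW)
      · exact absurd hxc (hcut x hv hvW)
      · rfl
    have h1 := Set.encard_le_encard hsub
    rw [hcard, Set.encard_singleton] at h1
    exact absurd h1 (by decide)
  · push Not at hcl
    obtain ⟨x, hx, y, hy, hxy, hnxy⟩ := hcl
    obtain ⟨g, hg, c, hcW, hcc, -⟩ := h.exists_gem hW hx hy hxy hnxy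
    have hmem : ∀ l, g l ∈ W := fun l => hg ▸ ⟨l, rfl⟩
    obtain ⟨i, rfl⟩ : u ∈ Set.range g := hg ▸ huW
    obtain ⟨j, rfl⟩ : v ∈ Set.range g := hg ▸ hvW
    obtain ⟨m, rfl⟩ : c ∈ Set.range g := hg ▸ hcW
    have hall := gem_homogeneous (fun l => g l ∈ U) (fun l hl => by
      rcases hU.1 (g l) hl with h' | h'
      · exact Or.inl fun b hb => g.map_adj_iff.1 (h' _ hb)
      · exact Or.inr fun b hb hb' => h' _ hb (g.map_adj_iff.2 hb')) hu hv (g.map_adj_iff.1 huv)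
    obtain rfl : m = 4 := by
      by_contra hm
      exact hcut (g m) (hall m hm) hcW hcc
    exact h.no_four_neighbors hcc (g.map_adj_iff.2 (by decide : gem.Adj 4 0))
      (g.map_adj_iff.2 (by decide : gem.Adj 4 1)) (g.map_adj_iff.2 (by decide : gem.Adj 4 2))
      (g.map_adj_iff.2 (by decide : gem.Adj 4 3)) (g.injective.ne (by decide))
      (g.injective.ne (by decide)) (g.injective.ne (by decide)) (g.injective.ne (by decide))
      (g.injective.ne (by decide)) (g.injective.ne (by decide))

end BlockConditions

/-! ### The blocks of a path with apices and hubs -/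

section ApexPathBlocks

variable {V : Type*} {G : SimpleGraph V} {k : ℕ} {p : ℕ → V}

/-- The vertices between `p i` and `p e`: the part of the path and the outside vertices all of whose
neighbours are in that part. -/
def between (G : SimpleGraph V) (k : ℕ) (p : ℕ → V) (i e : ℕ) : Set V :=
  {w | (∃ j < k, i ≤ j ∧ j ≤ e ∧ w = p j) ∨
    ((∀ l < k, w ≠ p l) ∧ ∀ j < k, G.Adj w (p j) → i ≤ j ∧ j ≤ e)}

/-- No outside vertex is adjacent to both neighbours of `p c` on the path. -/
def IsClean (G : SimpleGraph V) (k : ℕ) (p : ℕ → V) (c : ℕ) : Prop :=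
  ∀ x i s, HasTrace G k p x i s → ¬ (i < c ∧ c + 1 < i + s)

/-- The vertices before `p c`. -/
def before (G : SimpleGraph V) (k : ℕ) (p : ℕ → V) (c : ℕ) : Set V :=
  {v | (∃ j < k, j < c ∧ v = p j) ∨ ((∀ l < k, v ≠ p l) ∧ ∃ j < k, j < c ∧ G.Adj v (p j))}

theorem IsApexPath.exists_trace' (h : IsApexPath G k p) {x : V} (hx : ∀ l < k, x ≠ p l) :
    ∃ i s, HasTrace G k p x i s ∧ 2 ≤ s ∧ IsShape k i s := by
  obtain ⟨i, s, hs, ht⟩ := h.exists_trace x hx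
  exact ⟨i, s, ht, by rcases hs with ⟨rfl, -⟩ | ⟨rfl, -⟩ <;> omega, hs⟩

theorem IsApexPath.mem_before_of_adj (h : IsApexPath G k p) {c : ℕ}
    (hcl : IsClean G k p c) {u v : V} (hu : u ∈ before G k p c) (hv : v ≠ p c)
    (huv : G.Adj u v) : v ∈ before G k p c := by
  rcases hu with ⟨j, hj, hjc, rfl⟩ | ⟨hu, j, hj, hjc, huj⟩
  · by_cases hvp : ∃ m < k, v = p m
    · obtain ⟨m, hm, rfl⟩ := hvp
      have hmc : m ≠ c := fun h' => hv (by rw [h'])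
      rw [h.adj j m hj hm] at huv
      exact Or.inl ⟨m, hm, by omega, rfl⟩
    · exact Or.inr ⟨fun l hl h' => hvp ⟨l, hl, h'⟩, j, hj, hjc, huv.symm⟩
  · obtain ⟨m, hm, rfl⟩ := h.mem_path u hu v huv
    have hmc : m ≠ c := fun h' => hv (by rw [h'])
    obtain ⟨i, s, ht, -, -⟩ := h.exists_trace' hu
    rw [ht.adj _ hj] at huj
    rw [ht.adj _ hm] at huv
    refine Or.inl ⟨m, hm, ?_, rfl⟩
    by_contra hcon
    exact hcl u i s ht (by omega)

/-- Joined vertices lie on the same side of `p c`. -/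
theorem IsApexPath.mem_before_iff (h : IsApexPath G k p) {c : ℕ}
    (hcl : IsClean G k p c) {S : Set V} (hS : p c ∉ S) {u v : V} (huv : JoinedIn G S u v) :
    u ∈ before G k p c ↔ v ∈ before G k p c := by
  have key : ∀ u v, JoinedIn G S u v → u ∈ before G k p c → v ∈ before G k p c :=
    fun u v huv hu => huv.mem_of_closed hu fun a b ha _ hb hab =>
      h.mem_before_of_adj hcl ha (fun h' => hS (h' ▸ hb)) hab
  exact ⟨key u v huv, key v u huv.symm⟩

theorem IsApexPath.path_mem_before_iff (h : IsApexPath G k p) {c j : ℕ} (hj : j < k) :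
    p j ∈ before G k p c ↔ j < c := by
  constructor
  · rintro (⟨m, hm, hmc, h'⟩ | ⟨h', -⟩)
    · rwa [(h.eq_iff _ _ hj hm).1 h']
    · exact absurd rfl (h' j hj)
  · exact fun hjc => Or.inl ⟨j, hj, hjc, rfl⟩

theorem HasTrace.mem_before_iff {x : V} {i s c : ℕ} (ht : HasTrace G k p x i s) (hs : 0 < s) :
    x ∈ before G k p c ↔ i < c := by
  have hle := ht.le
  constructor
  · rintro (⟨m, hm, -, h'⟩ | ⟨-, j, hj, hjc, h'⟩)
    · exact absurd h' (ht.ne m hm)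
    · rw [ht.adj j hj] at h'
      omega
  · exact fun hic => Or.inr ⟨ht.ne, i, by omega, hic, (ht.adj i (by omega)).2 (by omega)⟩

theorem IsApexPath.path_mem_between_iff (h : IsApexPath G k p) {i e j : ℕ} (hj : j < k) :
    p j ∈ between G k p i e ↔ i ≤ j ∧ j ≤ e := by
  constructor
  · rintro (⟨m, hm, h1, h2, h'⟩ | ⟨h', -⟩)
    · rw [(h.eq_iff _ _ hj hm).1 h']
      exact ⟨h1, h2⟩
    · exact absurd rfl (h' j hj)
  · exact fun hj' => Or.inl ⟨j, hj, hj'.1, hj'.2, rfl⟩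

theorem HasTrace.mem_between_iff {x : V} {i s a e : ℕ} (ht : HasTrace G k p x i s) (hs : 0 < s) :
    x ∈ between G k p a e ↔ a ≤ i ∧ i + s ≤ e + 1 := by
  have hle := ht.le
  constructor
  · rintro (⟨m, hm, -, -, h'⟩ | ⟨-, h'⟩)
    · exact absurd h' (ht.ne m hm)
    · have h1 := h' i (by omega) ((ht.adj i (by omega)).2 (by omega))
      have h2 := h' (i + s - 1) (by omega) ((ht.adj _ (by omega)).2 (by omega))
      omega
  · refine fun h1 => Or.inr ⟨ht.ne, fun j hj hj' => ?_⟩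
    rw [ht.adj j hj] at hj'
    omega

/-- Every vertex is on the path or has a trace. -/
theorem IsApexPath.cases (h : IsApexPath G k p) (v : V) :
    (∃ j < k, v = p j) ∨ ∃ i s, HasTrace G k p v i s ∧ 2 ≤ s ∧ IsShape k i s := by
  by_cases hv : ∃ j < k, v = p j
  · exact Or.inl hv
  · exact Or.inr (h.exists_trace' fun l hl h' => hv ⟨l, hl, h'⟩)

/-- The vertices `p i` and `p e` separate the vertices between them from the other vertices, so that
no larger set is biconnected. -/
theorem IsApexPath.subset_between (h : IsApexPath G k p) {i e : ℕ} (hie : i < e) (he : e < k)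
    (hi' : IsClean G k p i) (he' : IsClean G k p e) {W : Set V} (hW : IsBiconnected G W)
    {a b : V} (ha : a ∈ W) (hb : b ∈ W) (hab : a ≠ b) (ha' : a ∈ between G k p i e)
    (hb' : b ∈ between G k p i e) : W ⊆ between G k p i e := by
  intro w hw
  by_contra hwn
  have sep : ∀ c < k, IsClean G k p c → w ≠ p c →
      (∀ d ∈ between G k p i e, d ≠ p c → ¬ (w ∈ before G k p c ↔ d ∈ before G k p c)) →
      False := by
    intro c hc hcl hwc hd
    obtain ⟨d, hdW, hdD, hdc⟩ : ∃ d ∈ W, d ∈ between G k p i e ∧ d ≠ p c := by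
      by_cases hac : a = p c
      · exact ⟨b, hb, hb', fun hbc => hab (hac.trans hbc.symm)⟩
      · exact ⟨a, ha, ha', hac⟩
    exact hd d hdD hdc (h.mem_before_iff hcl (fun hmem => hmem.2 rfl)
      (hW.diff' (p c) w ⟨hw, hwc⟩ d ⟨hdW, hdc⟩))
  have side_i : ∀ d ∈ between G k p i e, d ∉ before G k p i := by
    intro d hd
    rcases h.cases d with ⟨j, hj, rfl⟩ | ⟨i', s, ht, hs, -⟩
    · rw [h.path_mem_between_iff hj] at hd
      rw [h.path_mem_before_iff hj]
      omega
    · rw [ht.mem_between_iff (by omega)] at hd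
      rw [ht.mem_before_iff (by omega)]
      omega
  have side_e : ∀ d ∈ between G k p i e, d ≠ p e → d ∈ before G k p e := by
    intro d hd hde
    rcases h.cases d with ⟨j, hj, rfl⟩ | ⟨i', s, ht, hs, -⟩
    · rw [h.path_mem_between_iff hj] at hd
      rw [h.path_mem_before_iff hj]
      have : j ≠ e := fun h' => hde (by rw [h'])
      omega
    · rw [ht.mem_between_iff (by omega)] at hd
      rw [ht.mem_before_iff (by omega)]
      omega
  have side : w ∈ before G k p i ∨ (w ∉ before G k p e ∧ w ≠ p e) := by
    rcases h.cases w with ⟨j, hj, rfl⟩ | ⟨i', s, ht, hs, -⟩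
    · rw [h.path_mem_between_iff hj] at hwn
      rw [h.path_mem_before_iff hj, h.path_mem_before_iff hj, ne_eq, h.eq_iff _ _ hj he]
      omega
    · rw [ht.mem_between_iff (by omega)] at hwn
      rw [ht.mem_before_iff (by omega), ht.mem_before_iff (by omega)]
      have h1 := he' w i' s ht
      have h2 := ht.ne e he
      by_cases hlt : i' < i
      · exact Or.inl hlt
      · exact Or.inr ⟨by omega, h2⟩
  rcases side with hs | ⟨hs, hs'⟩
  · refine sep i (by omega) hi' ?_ fun d hd _ hiff => side_i d hd (hiff.1 hs)
    rintro rfl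
    rw [h.path_mem_before_iff (by omega)] at hs
    omega
  · exact sep e he he' hs' fun d hd hde hiff => hs (hiff.2 (side_e d hd hde))

/-- The description of the blocks: `W` lies between `p i` and `p e`, and is an edge of the path, a
triangle over an edge of the path, or a gem at an end of the path. -/
structure IsSegment (G : SimpleGraph V) (k : ℕ) (p : ℕ → V) (i e : ℕ) : Prop where
  lt : i < e
  e_lt : e < k
  clean_left : IsClean G k p i
  clean_right : IsClean G k p e
  type : (e = i + 1 ∧ between G k p i e = {p i, p (i + 1)}) ∨
    (∃ x, e = i + 1 ∧ HasTrace G k p x i 2 ∧ 1 ≤ i ∧ i + 3 ≤ k ∧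
      between G k p i e = {p i, p (i + 1), x}) ∨
    ∃ x, e = i + 3 ∧ HasTrace G k p x i 4 ∧ 5 ≤ k ∧ (i = 0 ∨ i + 4 = k) ∧
      between G k p i e = {p i, p (i + 1), p (i + 2), p (i + 3), x}

theorem IsApexPath.trace_disjoint (h : IsApexPath G k p) {x y : V} {i s j t : ℕ}
    (hx : HasTrace G k p x i s) (hy : HasTrace G k p y j t) (hxy : x ≠ y) (l : ℕ)
    (hl : i ≤ l ∧ l < i + s) : ¬ (j ≤ l ∧ l < j + t) := by
  intro hl'
  have hle := hx.le
  exact hxy (h.unique x y (p l) hx.ne hy.ne ((hx.adj l (by omega)).2 hl)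
    ((hy.adj l (by omega)).2 hl'))

theorem HasTrace.eq {x : V} {i s j t : ℕ} (hx : HasTrace G k p x i s) (hy : HasTrace G k p x j t)
    (hs : 0 < s) (ht : 0 < t) : i = j ∧ s = t := by
  have h1 := hx.le
  have h2 := hy.le
  have e : ∀ l < k, (i ≤ l ∧ l < i + s) ↔ (j ≤ l ∧ l < j + t) := fun l hl =>
    (hx.adj l hl).symm.trans (hy.adj l hl)
  have e1 := e i (by omega)
  have e2 := e j (by omega)
  have e3 := e (i + s - 1) (by omega)
  have e4 := e (j + t - 1) (by omega)
  omega

/-- An outside vertex spans a triangle or a gem with its neighbours. -/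
theorem IsApexPath.isSegment_of_trace (h : IsApexPath G k p) {x : V} {i s : ℕ}
    (hx : HasTrace G k p x i s) (hs : IsShape k i s) : IsSegment G k p i (i + s - 1) := by
  have hle := hx.le
  have hpos : 2 ≤ s := by rcases hs with ⟨rfl, -⟩ | ⟨rfl, -⟩ <;> omega
  have hclean : ∀ c, c = i ∨ c = i + s - 1 → IsClean G k p c := by
    intro c hc y j t hy hlt
    by_cases hxy : x = y
    · subst hxy
      obtain ⟨rfl, rfl⟩ := hx.eq hy (by omega) (by omega)
      omega
    · exact h.trace_disjoint hx hy hxy c (by omega) (by omega)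
  -- the vertices between the ends of the trace
  have hbet : ∀ w, w ∈ between G k p i (i + s - 1) ↔ w = x ∨ ∃ j, i ≤ j ∧ j < i + s ∧ w = p j := by
    intro w
    rcases h.cases w with ⟨j, hj, rfl⟩ | ⟨j, t, hw, ht, -⟩
    · rw [h.path_mem_between_iff hj]
      constructor
      · exact fun h' => Or.inr ⟨j, by omega, by omega, rfl⟩
      · rintro (h' | ⟨m, hm, hm', h'⟩)
        · exact absurd h'.symm (hx.ne j hj)
        · rw [(h.eq_iff _ _ hj (by omega)).1 h']
          omega
    · rw [hw.mem_between_iff (by omega)]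
      constructor
      · intro h'
        left
        by_contra hwx
        exact h.trace_disjoint hx hw (fun e => hwx e.symm) j (by omega) (by omega)
      · rintro (rfl | ⟨m, hm, hm', h'⟩)
        · obtain ⟨rfl, rfl⟩ := hx.eq hw (by omega) (by omega)
          omega
        · exact absurd h' (hw.ne m (by omega))
  refine ⟨by omega, by omega, hclean _ (Or.inl rfl), hclean _ (Or.inr rfl), Or.inr ?_⟩
  rcases hs with ⟨rfl, hi⟩ | ⟨rfl, hk, hi⟩
  · refine Or.inl ⟨x, by omega, hx, hi.1, hi.2, ?_⟩
    ext w
    rw [hbet]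
    constructor
    · rintro (rfl | ⟨j, hj, hj', rfl⟩)
      · simp
      · rcases (show j = i ∨ j = i + 1 by omega) with rfl | rfl <;> simp
    · rintro (rfl | rfl | rfl)
      exacts [Or.inr ⟨i, by omega, by omega, rfl⟩, Or.inr ⟨i + 1, by omega, by omega, rfl⟩,
        Or.inl rfl]
  · refine Or.inr ⟨x, by omega, hx, hk, hi, ?_⟩
    ext w
    rw [hbet]
    constructor
    · rintro (rfl | ⟨j, hj, hj', rfl⟩)
      · simp
      · rcases (show j = i ∨ j = i + 1 ∨ j = i + 2 ∨ j = i + 3 by omega) with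
          rfl | rfl | rfl | rfl <;> simp
    · rintro (rfl | rfl | rfl | rfl | rfl)
      exacts [Or.inr ⟨i, by omega, by omega, rfl⟩, Or.inr ⟨i + 1, by omega, by omega, rfl⟩,
        Or.inr ⟨i + 2, by omega, by omega, rfl⟩, Or.inr ⟨i + 3, by omega, by omega, rfl⟩,
        Or.inl rfl]

/-- Every edge lies in a segment. -/
theorem IsApexPath.exists_isSegment (h : IsApexPath G k p) {a b : V} (hab : G.Adj a b) :
    ∃ i e, IsSegment G k p i e ∧ a ∈ between G k p i e ∧ b ∈ between G k p i e := by
  have outer : ∀ x w, (∀ l < k, x ≠ p l) → G.Adj x w →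
      ∃ i e, IsSegment G k p i e ∧ x ∈ between G k p i e ∧ w ∈ between G k p i e := by
    intro x w hx hxw
    obtain ⟨l, hl, rfl⟩ := h.mem_path x hx w hxw
    obtain ⟨i, s, ht, hs, hsh⟩ := h.exists_trace' hx
    refine ⟨i, _, h.isSegment_of_trace ht hsh, (ht.mem_between_iff (by omega)).2 (by omega),
      (h.path_mem_between_iff hl).2 ?_⟩
    rw [ht.adj l hl] at hxw
    omega
  have path : ∀ l, l + 1 < k →
      ∃ i e, IsSegment G k p i e ∧ p l ∈ between G k p i e ∧ p (l + 1) ∈ between G k p i e := by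
    intro l hl
    by_cases hx : ∃ x i s, HasTrace G k p x i s ∧ i ≤ l ∧ l + 1 < i + s
    · obtain ⟨x, i, s, ht, hil, hls⟩ := hx
      obtain ⟨j, t, ht', h2, hsh⟩ := h.exists_trace' ht.ne
      obtain ⟨rfl, rfl⟩ := ht.eq ht' (by omega) (by omega)
      refine ⟨i, _, h.isSegment_of_trace ht hsh, (h.path_mem_between_iff (by omega)).2 (by omega),
        (h.path_mem_between_iff (by omega)).2 (by omega)⟩
    · push Not at hx
      refine ⟨l, l + 1, ⟨by omega, hl, ?_, ?_, Or.inl ⟨rfl, ?_⟩⟩,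
        (h.path_mem_between_iff (by omega)).2 (by omega),
        (h.path_mem_between_iff (by omega)).2 (by omega)⟩
      · intro x i s ht hlt
        have := hx x i s ht (by omega)
        omega
      · intro x i s ht hlt
        have := hx x i s ht (by omega)
        omega
      · ext w
        rcases h.cases w with ⟨j, hj, rfl⟩ | ⟨i, s, ht, hs, -⟩
        · rw [h.path_mem_between_iff hj, Set.mem_insert_iff, Set.mem_singleton_iff,
            h.eq_iff _ _ hj (by omega), h.eq_iff _ _ hj (by omega)]
          omega
        · rw [ht.mem_between_iff (by omega), Set.mem_insert_iff, Set.mem_singleton_iff]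
          have h1 := ht.ne l (by omega)
          have h2 := ht.ne (l + 1) (by omega)
          have h3 := hx w i s ht
          simp only [h1, h2, or_self, iff_false]
          omega
  by_cases ha : ∃ i < k, a = p i
  · by_cases hb : ∃ j < k, b = p j
    · obtain ⟨i, hi, rfl⟩ := ha
      obtain ⟨j, hj, rfl⟩ := hb
      rcases (h.adj i j hi hj).1 hab with rfl | rfl
      · exact path i hj
      · obtain ⟨i', e, h1, h2, h3⟩ := path j hi
        exact ⟨i', e, h1, h3, h2⟩
    · obtain ⟨i, e, h1, h2, h3⟩ := outer b a (fun l hl h' => hb ⟨l, hl, h'⟩) hab.symm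
      exact ⟨i, e, h1, h3, h2⟩
  · exact outer a b (fun l hl h' => ha ⟨l, hl, h'⟩) hab

theorem IsApexPath.isBiconnected_between (h : IsApexPath G k p) {i e : ℕ}
    (hs : IsSegment G k p i e) : IsBiconnected G (between G k p i e) := by
  have h1 := hs.lt
  have h2 := hs.e_lt
  have hpp : ∀ j, j + 1 < k → G.Adj (p j) (p (j + 1)) := fun j hj =>
    (h.adj _ _ (by omega) hj).2 (by omega)
  rcases hs.type with ⟨rfl, hb⟩ | ⟨x, rfl, hx, -, -, hb⟩ | ⟨x, rfl, hx, -, -, hb⟩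
  · rw [hb]
    exact isBiconnected_pair (hpp i (by omega))
  · rw [hb, show ({p i, p (i + 1), x} : Set V) = insert x {p i, p (i + 1)} by
      ext w; simp only [Set.mem_insert_iff, Set.mem_singleton_iff]; tauto]
    exact (isBiconnected_pair (hpp i (by omega))).insert_vertex (u := p i) (v := p (i + 1))
      (by simp) (by simp) (hpp i (by omega)).ne ((hx.adj _ (by omega)).2 (by omega))
      ((hx.adj _ (by omega)).2 (by omega))
  · rw [hb, show ({p i, p (i + 1), p (i + 2), p (i + 3), x} : Set V) =
      insert (p (i + 3)) (insert (p (i + 2)) (insert (p (i + 1)) {p i, x})) by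
      ext w; simp only [Set.mem_insert_iff, Set.mem_singleton_iff]; tauto]
    have hpx : ∀ j, i ≤ j → j < i + 4 → G.Adj (p j) x := fun j hj hj' =>
      (hx.adj' j (by omega)).2 (by omega)
    have b0 := isBiconnected_pair (hpx i le_rfl (by omega))
    have b1 := b0.insert_vertex (x := p (i + 1)) (u := p i) (v := x) (by simp) (by simp)
      (hpx i le_rfl (by omega)).ne (hpp i (by omega)).symm (hpx _ (by omega) (by omega))
    have b2 := b1.insert_vertex (x := p (i + 2)) (u := p (i + 1)) (v := x) (by simp) (by simp)
      (hpx _ (by omega) (by omega)).ne (hpp (i + 1) (by omega)).symm (hpx _ (by omega) (by omega))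
    exact b2.insert_vertex (x := p (i + 3)) (u := p (i + 2)) (v := x) (by simp) (by simp)
      (hpx _ (by omega) (by omega)).ne (hpp (i + 2) (by omega)).symm (hpx _ (by omega) (by omega))

theorem IsApexPath.exists_adj (h : IsApexPath G k p) (v : V) : ∃ w, G.Adj v w := by
  have := h.two_le
  rcases h.cases v with ⟨j, hj, rfl⟩ | ⟨i, s, ht, hs, -⟩
  · rcases Nat.eq_zero_or_pos j with rfl | h0
    · exact ⟨p 1, (h.adj _ _ hj (by omega)).2 (by omega)⟩
    · exact ⟨p (j - 1), (h.adj _ _ hj (by omega)).2 (by omega)⟩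
  · have := ht.le
    exact ⟨p i, (ht.adj i (by omega)).2 (by omega)⟩

/-- The blocks are the segments. -/
theorem IsApexPath.exists_eq_between (h : IsApexPath G k p) {W : Set V} (hW : IsBlockSet G W) :
    ∃ i e, IsSegment G k p i e ∧ W = between G k p i e := by
  obtain ⟨v, hv⟩ := hW.1.nonempty
  obtain ⟨y, hvy⟩ := h.exists_adj v
  obtain ⟨u, hu, hvu⟩ := hW.exists_adj hv hvy
  obtain ⟨i, e, hs, hv', hu'⟩ := h.exists_isSegment hvu
  have hsub := h.subset_between hs.lt hs.e_lt hs.clean_left hs.clean_right hW.1 hv hu hvu.ne hv' hu'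
  exact ⟨i, e, hs, hsub.antisymm (hW.2 (h.isBiconnected_between hs) hsub)⟩

/-- The only possible cut-vertices in a segment are its ends that are inner vertices of the path. -/
theorem IsApexPath.eq_of_isCutVertex (h : IsApexPath G k p) {i e : ℕ} (hs : IsSegment G k p i e)
    {v : V} (hv : v ∈ between G k p i e) (hcut : IsCutVertex G v) :
    (1 ≤ i ∧ v = p i) ∨ (e + 1 < k ∧ v = p e) := by
  have hlt := hs.lt
  have hek := hs.e_lt
  obtain ⟨y, hy, hvy⟩ := (h.isBiconnected_between hs).exists_adj_of_isCutVertex hcut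
  rcases h.cases v with ⟨c, hc, rfl⟩ | ⟨j, t, ht, htpos, -⟩
  · rw [h.path_mem_between_iff hc] at hv
    rw [h.eq_iff _ _ hc (by omega), h.eq_iff _ _ hc (by omega)]
    rcases h.cases y with ⟨m, hm, rfl⟩ | ⟨j, t, ht, htpos, -⟩
    · rw [h.path_mem_between_iff hm] at hy
      rw [h.adj _ _ hc hm] at hvy
      omega
    · rw [ht.mem_between_iff (by omega)] at hy
      rw [ht.adj' c hc] at hvy
      have h1 := hs.clean_left y j t ht
      have h2 := hs.clean_right y j t ht
      have := ht.le
      omega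
  · obtain ⟨m, hm, rfl⟩ := h.mem_path v ht.ne y hvy
    rw [ht.mem_between_iff (by omega)] at hv
    rw [h.path_mem_between_iff hm] at hy
    rw [ht.adj m hm] at hvy
    omega

/-- An inner vertex `p c` of the path whose neighbours on the path have no common neighbour outside
the path separates these neighbours. -/
theorem IsApexPath.isCutVertex (h : IsApexPath G k p) {c : ℕ} (hc : 1 ≤ c) (hck : c + 1 < k)
    (hcl : IsClean G k p c) : IsCutVertex G (p c) := by
  have h1 : G.Adj (p (c - 1)) (p c) := (h.adj _ _ (by omega) (by omega)).2 (by omega)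
  have h2 : G.Adj (p c) (p (c + 1)) := (h.adj _ _ (by omega) (by omega)).2 (by omega)
  refine isCutVertex_iff.2 ⟨p (c - 1), p (c + 1), h1.ne, h2.ne', h1.reachable.trans h2.reachable,
    fun hj => ?_⟩
  have := h.mem_before_iff (S := ({p c}ᶜ : Set V)) hcl (fun hmem => hmem rfl) hj
  rw [h.path_mem_before_iff (by omega), h.path_mem_before_iff (by omega)] at this
  omega

theorem IsApexPath.connected (h : IsApexPath G k p) : G.Connected := by
  have h2 := h.two_le
  have hp : ∀ j, j < k → G.Reachable (p j) (p 0) := by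
    intro j
    induction j with
    | zero => exact fun _ => Reachable.refl _
    | succ j ih =>
      exact fun hj => (show G.Adj (p (j + 1)) (p j) from
        (h.adj _ _ hj (by omega)).2 (by omega)).reachable.trans (ih (by omega))
  have hv : ∀ v, G.Reachable v (p 0) := by
    intro v
    rcases h.cases v with ⟨j, hj, rfl⟩ | ⟨i, s, ht, hs, -⟩
    · exact hp j hj
    · have := ht.le
      exact ((ht.adj i (by omega)).2 (by omega)).reachable.trans (hp i (by omega))
  exact { preconnected := fun u v => (hv u).trans (hv v).symm, nonempty := ⟨p 0⟩ }

/-- A segment induces an edge, a triangle or a gem. -/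
theorem IsApexPath.exists_embedding (h : IsApexPath G k p) {i e : ℕ} (hs : IsSegment G k p i e) :
    (∃ g : completeGraph (Fin 2) ↪g G, Set.range g = between G k p i e) ∨
    (∃ g : completeGraph (Fin 3) ↪g G, Set.range g = between G k p i e) ∨
    ∃ g : gem ↪g G, Set.range g = between G k p i e := by
  have he := hs.e_lt
  have hp := h.toIsIndPath
  rcases hs.type with ⟨rfl, hb⟩ | ⟨x, rfl, hx, h1, h3, hb⟩ | ⟨x, rfl, hx, h5, hi, hb⟩
  · obtain ⟨g, hg⟩ := exists_embedding_of_map (G := G) (F := completeGraph (Fin 2)) (by decide)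
      ![p i, p (i + 1)] (forall_adj_iff_of_lt (by
        simp +decide (disch := omega) [Fin.forall_fin_succ, hp.adj]))
    refine Or.inl ⟨g, ?_⟩
    rw [hb, show (g : Fin 2 → V) = _ from funext hg]
    simp [Set.pair_comm]
  · obtain ⟨g, hg⟩ := exists_embedding_of_map (G := G) (F := completeGraph (Fin 3)) (by decide)
      ![p i, p (i + 1), x] (forall_adj_iff_of_lt (by
        simp +decide (disch := omega) [Fin.forall_fin_succ, hp.adj, hx.adj']))
    refine Or.inr (Or.inl ⟨g, ?_⟩)
    rw [hb, show (g : Fin 3 → V) = _ from funext hg]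
    simp only [Matrix.range_cons, Matrix.range_empty, Set.union_empty]
    ext w
    simp only [Set.mem_union, Set.mem_insert_iff, Set.mem_singleton_iff]
  · obtain ⟨g, hg⟩ := exists_embedding_of_map (G := G) (F := gem) (by decide)
      ![p i, p (i + 1), p (i + 2), p (i + 3), x] (forall_adj_iff_of_lt (by
        simp +decide (disch := omega) [Fin.forall_fin_succ, hp.adj, hx.adj']
        omega))
    refine Or.inr (Or.inr ⟨g, ?_⟩)
    rw [hb, show (g : Fin 5 → V) = _ from funext hg]
    simp only [Matrix.range_cons, Matrix.range_empty, Set.union_empty]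
    ext w
    simp only [Set.mem_union, Set.mem_insert_iff, Set.mem_singleton_iff]

/-- Every cut-vertex is an inner vertex of the path. -/
theorem IsApexPath.exists_of_isCutVertex (h : IsApexPath G k p) {v : V} (hv : IsCutVertex G v) :
    ∃ c, 1 ≤ c ∧ c + 1 < k ∧ v = p c := by
  obtain ⟨w, hvw⟩ := h.exists_adj v
  obtain ⟨i, e, hs, hv', -⟩ := h.exists_isSegment hvw
  have hlt := hs.lt
  have he := hs.e_lt
  rcases h.eq_of_isCutVertex hs hv' hv with ⟨hi, rfl⟩ | ⟨hk, rfl⟩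
  · exact ⟨i, hi, by omega, rfl⟩
  · exact ⟨e, by omega, hk, rfl⟩

/-- A block that contains a cut-vertex also contains the next or the previous vertex of the path. -/
theorem IsApexPath.mem_or_mem (h : IsApexPath G k p) {c : ℕ} (hck : c + 1 < k)
    (hcut : IsCutVertex G (p c)) {W : Set V} (hW : IsBlockSet G W) (hc : p c ∈ W) :
    p (c - 1) ∈ W ∨ p (c + 1) ∈ W := by
  obtain ⟨i, e, hs, rfl⟩ := h.exists_eq_between hW
  have hlt := hs.lt
  have he := hs.e_lt
  rw [h.path_mem_between_iff (by omega), h.path_mem_between_iff (by omega)]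
  rcases h.eq_of_isCutVertex hs hc hcut with ⟨hi, h'⟩ | ⟨hk, h'⟩
  · have := h.inj _ _ (by omega) (by omega) h'
    omega
  · have := h.inj _ _ (by omega) (by omega) h'
    omega

theorem encard_le_two_of_forall {α : Type*} {S T₁ T₂ : Set α} (h : S ⊆ T₁ ∪ T₂)
    (h₁ : T₁.Subsingleton) (h₂ : T₂.Subsingleton) : S.encard ≤ 2 :=
  calc S.encard ≤ (T₁ ∪ T₂).encard := Set.encard_le_encard h
    _ ≤ T₁.encard + T₂.encard := Set.encard_union_le _ _
    _ ≤ 1 + 1 := add_le_add (Set.encard_le_one_iff_subsingleton.2 h₁)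
      (Set.encard_le_one_iff_subsingleton.2 h₂)
    _ = 2 := one_add_one_eq_two

theorem IsApexPath.encard_blocks_le (h : IsApexPath G k p) {v : V} (hv : IsCutVertex G v) :
    {B : G.Subgraph | IsBlock G B ∧ v ∈ B.verts}.encard ≤ 2 := by
  obtain ⟨c, hc, hck, rfl⟩ := h.exists_of_isCutVertex hv
  -- two blocks that share `p c` and a further vertex are equal
  have key : ∀ d < k, d ≠ c →
      {B : G.Subgraph | IsBlock G B ∧ p c ∈ B.verts ∧ p d ∈ B.verts}.Subsingleton := by
    rintro d hd hdc B ⟨hB, h1, h2⟩ B' ⟨hB', h1', h2'⟩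
    have hne : p c ≠ p d := fun h' => hdc (h.inj _ _ hd (by omega) h'.symm)
    exact hB.eq_of_verts hB' ((hB'.isBlockSet.subset_of_two hB.isBlockSet.1 h1' h2' h1 h2
      hne).antisymm (hB.isBlockSet.subset_of_two hB'.isBlockSet.1 h1 h2 h1' h2' hne))
  refine encard_le_two_of_forall ?_ (key (c - 1) (by omega) (by omega))
    (key (c + 1) (by omega) (by omega))
  rintro B ⟨hB, hcB⟩
  exact (h.mem_or_mem hck hv hB.isBlockSet hcB).imp (fun h' => ⟨hB, hcB, h'⟩)
    fun h' => ⟨hB, hcB, h'⟩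

theorem IsApexPath.degree_le [Fintype V] [DecidableRel G.Adj] (h : IsApexPath G k p) {v : V}
    (hv : IsCutVertex G v) : G.degree v ≤ 3 := by
  classical
  obtain ⟨c, hc, hck, rfl⟩ := h.exists_of_isCutVertex hv
  let O : Finset V := Finset.univ.filter fun x => (∀ l < k, x ≠ p l) ∧ G.Adj (p c) x
  have hO : O.card ≤ 1 := by
    rw [Finset.card_le_one]
    intro x hx y hy
    simp only [O, Finset.mem_filter, Finset.mem_univ, true_and] at hx hy
    exact h.unique x y (p c) hx.1 hy.1 hx.2.symm hy.2.symm
  have hsub : G.neighborFinset (p c) ⊆ {p (c - 1), p (c + 1)} ∪ O := by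
    intro y hy
    rw [mem_neighborFinset] at hy
    by_cases hyp : ∃ l < k, y = p l
    · obtain ⟨l, hl, rfl⟩ := hyp
      rw [h.adj _ _ (by omega) hl] at hy
      rcases hy with rfl | rfl <;> simp
    · push Not at hyp
      simp only [O, Finset.mem_union, Finset.mem_filter, Finset.mem_univ, true_and]
      exact Or.inr ⟨hyp, hy⟩
  rw [← card_neighborFinset_eq_degree]
  calc _ ≤ _ := Finset.card_le_card hsub
    _ ≤ _ := Finset.card_union_le _ _
    _ ≤ 2 + 1 := add_le_add Finset.card_le_two hO

/-- The cut-vertices in a triangle are its two vertices on the path. -/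
theorem IsApexPath.encard_triangle (h : IsApexPath G k p) {i e : ℕ} (hs : IsSegment G k p i e)
    {g : completeGraph (Fin 3) ↪g G} (hg : Set.range g = between G k p i e) :
    {v | v ∈ between G k p i e ∧ IsCutVertex G v}.encard = 2 := by
  have he := hs.e_lt
  rcases hs.type with ⟨rfl, hb⟩ | ⟨x, rfl, hx, h1, h3, hb⟩ | ⟨x, rfl, hx, h5, hi, hb⟩
  · exfalso
    have h3 : (Set.range g).encard = 3 := by
      rw [← Set.image_univ, g.injective.encard_image, Set.encard_univ]
      simp
    have hne : p i ≠ p (i + 1) := fun h' => by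
      have := h.inj _ _ (by omega) (by omega) h'
      omega
    rw [hg, hb, Set.encard_pair hne] at h3
    norm_num at h3
  · have hset : {v | v ∈ between G k p i (i + 1) ∧ IsCutVertex G v} = {p i, p (i + 1)} := by
      ext v
      constructor
      · rintro ⟨hv, hcut⟩
        exact (h.eq_of_isCutVertex hs hv hcut).imp And.right And.right
      · rintro (rfl | rfl)
        · exact ⟨(h.path_mem_between_iff (by omega)).2 (by omega),
            h.isCutVertex h1 (by omega) hs.clean_left⟩
        · exact ⟨(h.path_mem_between_iff (by omega)).2 (by omega),
            h.isCutVertex (by omega) (by omega) hs.clean_right⟩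
    rw [hset, Set.encard_pair fun h' => by have := h.inj _ _ (by omega) (by omega) h'; omega]
  · exfalso
    obtain ⟨a, ha⟩ : p i ∈ Set.range g := by rw [hg, hb]; simp
    obtain ⟨b, hb'⟩ : p (i + 2) ∈ Set.range g := by rw [hg, hb]; simp
    have hab : a ≠ b := by
      rintro rfl
      have := h.inj _ _ (by omega) (by omega) (ha.symm.trans hb')
      omega
    have := g.map_adj_iff.2 (show (completeGraph (Fin 3)).Adj a b from hab)
    rw [ha, hb', h.adj _ _ (by omega) (by omega)] at this
    omega

/-- The only cut-vertex in a gem is the end of its path that is an inner vertex of `p`. -/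
theorem IsApexPath.encard_gem (h : IsApexPath G k p) {i e : ℕ} (hs : IsSegment G k p i e)
    {g : gem ↪g G} (hg : Set.range g = between G k p i e) :
    {v | v ∈ between G k p i e ∧ IsCutVertex G v}.encard = 1 := by
  have he := hs.e_lt
  have hclique : ¬ ∀ a ∈ between G k p i e, ∀ b ∈ between G k p i e, a ≠ b → G.Adj a b := by
    intro hall
    have := hall (g 0) (hg ▸ ⟨0, rfl⟩) (g 2) (hg ▸ ⟨2, rfl⟩) (g.injective.ne (by decide))
    exact absurd (g.map_adj_iff.1 this) (by decide)
  have clique : ∀ S : Set V, S = between G k p i e →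
      (∀ a ∈ S, ∀ b ∈ S, a ≠ b → G.Adj a b) → False := fun S hS hall => hclique (hS ▸ hall)
  rcases hs.type with ⟨rfl, hb⟩ | ⟨x, rfl, hx, h1, h3, hb⟩ | ⟨x, rfl, hx, h5, hi, hb⟩
  · exfalso
    have hadj : G.Adj (p i) (p (i + 1)) := (h.adj _ _ (by omega) (by omega)).2 (by omega)
    refine clique _ hb.symm ?_
    rintro a (rfl | rfl) b (rfl | rfl) hab
    exacts [absurd rfl hab, hadj, hadj.symm, absurd rfl hab]
  · exfalso
    have hadj : G.Adj (p i) (p (i + 1)) := (h.adj _ _ (by omega) (by omega)).2 (by omega)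
    have hx1 : G.Adj x (p i) := (hx.adj _ (by omega)).2 (by omega)
    have hx2 : G.Adj x (p (i + 1)) := (hx.adj _ (by omega)).2 (by omega)
    refine clique _ hb.symm ?_
    rintro a (rfl | rfl | rfl) b (rfl | rfl | rfl) hab
    exacts [absurd rfl hab, hadj, hx1.symm, hadj.symm, absurd rfl hab, hx2.symm, hx1, hx2,
      absurd rfl hab]
  · rw [Set.encard_eq_one]
    rcases hi with rfl | hi
    · refine ⟨p (0 + 3), ?_⟩
      ext v
      constructor
      · rintro ⟨hv, hcut⟩
        exact (h.eq_of_isCutVertex hs hv hcut).elim (fun h' => absurd h'.1 (by omega)) And.right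
      · rintro rfl
        exact ⟨(h.path_mem_between_iff (by omega)).2 (by omega),
          h.isCutVertex (by omega) (by omega) hs.clean_right⟩
    · refine ⟨p i, ?_⟩
      ext v
      constructor
      · rintro ⟨hv, hcut⟩
        exact (h.eq_of_isCutVertex hs hv hcut).elim And.right fun h' => absurd h'.1 (by omega)
      · rintro rfl
        exact ⟨(h.path_mem_between_iff (by omega)).2 (by omega),
          h.isCutVertex (by omega) (by omega) hs.clean_left⟩

theorem IsApexPath.blockConditions [Fintype V] [DecidableRel G.Adj] (h : IsApexPath G k p) :
    BlockConditions G where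
  connected := h.connected
  blocks B hB := by
    obtain ⟨i, e, hs, hW⟩ := h.exists_eq_between hB.isBlockSet
    rw [hB.nonempty_iso_iff, hB.nonempty_iso_iff, hB.nonempty_iso_iff, hW]
    exact h.exists_embedding hs
  cutVertices _ hv := ⟨h.encard_blocks_le hv, h.degree_le hv⟩
  triangleBlocks B hB he := by
    obtain ⟨i, e, hs, hW⟩ := h.exists_eq_between hB.isBlockSet
    obtain ⟨g, hg⟩ := hB.nonempty_iso_iff.1 he
    rw [cutVerticesIn, hW]
    exact h.encard_triangle hs (hg.trans hW)
  gemBlocks B hB he := by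
    obtain ⟨i, e, hs, hW⟩ := h.exists_eq_between hB.isBlockSet
    obtain ⟨g, hg⟩ := hB.nonempty_iso_iff.1 he
    rw [cutVerticesIn, hW]
    exact h.encard_gem hs (hg.trans hW)

end ApexPathBlocks

end GallaiTree

theorem theorem2 {V : Type*} [Fintype V] [Nonempty V] (G : SimpleGraph V) [DecidableRel G.Adj]
    (hiso : ∀ v : V, ∃ w : V, G.Adj v w) :
    List.TFAE
      [ (GallaiTree.gallaiGraph G).IsTree,
        (∀ U : Set V, GallaiTree.IsNontrivialHomogeneous G U → G.IsIndepSet U) ∧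
          GallaiTree.ForbiddenFree G ∧ GallaiTree.IsChordal G,
        Nonempty (G ≃g GallaiTree.F8minus) ∨ GallaiTree.BlockConditions G ] := by
  have tree_of_iso : Nonempty (G ≃g GallaiTree.F8minus) → (GallaiTree.gallaiGraph G).IsTree :=
    fun ⟨e⟩ => (GallaiTree.gallaiGraphIso e).isTree_iff.2 GallaiTree.gallaiGraph_F8minus_isTree
  tfae_have 1 → 2 := fun h =>
    ⟨fun U hU => GallaiTree.isIndepSet_of_preconnected hiso h.connected.preconnected U hU,
      GallaiTree.forbiddenFree_of_isAcyclic h.isAcyclic,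
      GallaiTree.isChordal_of_isAcyclic h.isAcyclic⟩
  tfae_have 2 → 1 := fun ⟨hom, hfree, hch⟩ => by
    obtain he | ⟨k, p, h⟩ := GallaiTree.exists_isApexPath hiso hom hfree hch
    · exact tree_of_iso he
    · exact h.gallaiGraph_isTree
  tfae_have 2 → 3 := fun ⟨hom, hfree, hch⟩ =>
    (GallaiTree.exists_isApexPath hiso hom hfree hch).imp_right fun ⟨_, _, h⟩ => h.blockConditions
  tfae_have 3 → 2 := by
    rintro (he | h)
    · exact tfae_1_to_2 (tree_of_iso he)
    · exact ⟨fun U hU => h.isIndepSet U hU, h.forbiddenFree, h.isChordal⟩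
  tfae_finish
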